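/- Let $L_1,L_2>0$, $I=(-L_1,L_2)$, and let $q\in C^2(\overline I;\mathbb R)$ satisfy $q(0)=0$, $q'(0)>0$ and $q(x)\neq 0$ for $x\in\overline I\setminus\{0\}$. For $\nu\in\mathbb C$ let $P_\nu=-\partial_x^2+\nu^2q(x)^2$ be the unbounded operator on $L^2(I)$ with domain $H^2(I)\cap H^1_0(I)$. For $\beta\in\mathbb C$ with $\operatorname{Re}\beta>0$ let $H_\beta=-\partial_x^2+\beta^2x^2$ be the unbounded operator on $L^2(\mathbb R)$ with domain $\{u\in L^2(\mathbb R): -u''+\beta^2x^2u\in L^2(\mathbb R)\}$, derivatives being taken in the sense of distributions. Let $\mathbf 1_I:L^2(I)\to L^2(\mathbb R)$ be the extension by zero and $\mathbf 1_I^*:L^2(\mathbb R)\to L^2(I)$ the restriction to $I$. For an isolated point $\lambda$ of the spectrum of an operator $A$, the spectral projection of $A$ associated with $\lambda$ is $-\frac1{2i\pi}\oint_{|z-\lambda|=r}(A-z)^{-1}\,dz$, for any $r>0$ such that the closed disc of center $\lambda$ and radius $r$ contains no other point of the spectrum; an isolated eigenvalue is algebraically simple if this projection has rank one. Let $\theta_0\in[0,\frac\pi2)$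 and $\Sigma_{\theta_0}=\{\nu\in\mathbb C:|\nu|\ge1,\ |\arg\nu|\le\theta_0\}$. There exists $\nu_{\theta_0}\ge0$ such that, for every $\nu\in\Sigma_{\theta_0}$ with $|\nu|\ge\nu_{\theta_0}$, the operator $P_\nu$ has a unique eigenvalue $\lambda_\nu$ with $|\lambda_\nu-q'(0)\nu|\le q'(0)|\nu|$. This eigenvalue is algebraically simple, and $$|\lambda_\nu-q'(0)\nu|=o(|\nu|)\qquad\text{as }|\nu|\to+\infty,\ \nu\in\Sigma_{\theta_0}.$$ Moreover, for every $\nu\in\Sigma_{\theta_0}$, $q'(0)\nu$ is an isolated eigenvalue of $H_{q'(0)\nu}$. If $\Pi_\nu$ denotes the spectral projection of $P_\nu$ associated with $\lambda_\nu$, and $\Pi^{\mathrm H}_{q'(0)\nu}$ the spectral projection of $H_{q'(0)\nu}$ associated with $q'(0)\nu$, then $$\big\|\Pi_\nu-\mathbf 1_I^*\,\Pi^{\mathrm H}_{q'(0)\nu}\,\mathbf 1_I\big\|_{\mathcal L(L^2(I))}\longrightarrow0\qquad\text{as }|\nu|\to+\infty,\ \nu\in\Sigma_{\theta_0}.$$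 -/

import Mathlib

open MeasureTheory Set Filter Topology

open scoped ContDiff ENNReal

noncomputable section

namespace Grushin

/-! ### Spectral theory of unbounded operators -/

section Spectral

variable {H : Type*} [NormedAddCommGroup H] [NormedSpace ℂ H]

/-- The bounded operator `R` is a two-sided inverse of `A - z : Dom(A) → H`. -/
def IsResolventAt (A : H →ₗ.[ℂ] H) (z : ℂ) (R : H →L[ℂ] H) : Prop :=
  (∀ f : H, ∃ h : R f ∈ A.domain, A ⟨R f, h⟩ - z • R f = f) ∧
    ∀ u : A.domain, R (A u - z • (u : H)) = u

/-- The resolvent set: the `z` such that `A - z : Dom(A) → H` has a bounded inverse. -/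
def resolventSet (A : H →ₗ.[ℂ] H) : Set ℂ :=
  {z | ∃ R : H →L[ℂ] H, IsResolventAt A z R}

open Classical in
/-- The resolvent `(A - z)⁻¹` (and `0` outside of the resolvent set). -/
def resolvent (A : H →ₗ.[ℂ] H) (z : ℂ) : H →L[ℂ] H :=
  if h : ∃ R : H →L[ℂ] H, IsResolventAt A z R then h.choose else 0

/-- `z` is an eigenvalue of `A`. -/
def IsEigenvalue (A : H →ₗ.[ℂ] H) (z : ℂ) : Prop :=
  ∃ u : A.domain, (u : H) ≠ 0 ∧ A u = z • (u : H)

/-- The closed disc of center `z` and radius `r` contains no point of the spectrum of `A`,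
except possibly `z` itself. -/
def IsolatingRadius (A : H →ₗ.[ℂ] H) (z : ℂ) (r : ℝ) : Prop :=
  0 < r ∧ ∀ w : ℂ, w ≠ z → ‖w - z‖ ≤ r → w ∈ resolventSet A

/-- `z` is an eigenvalue of `A` which is an isolated point of the spectrum of `A`. -/
def IsIsolatedEigenvalue (A : H →ₗ.[ℂ] H) (z : ℂ) : Prop :=
  IsEigenvalue A z ∧ ∃ r : ℝ, IsolatingRadius A z r

/-- The contour integral `-(2iπ)⁻¹ ∮_{|w - z| = r} (A - w)⁻¹ dw`. -/
def rieszIntegral (A : H →ₗ.[ℂ] H) (z : ℂ) (r : ℝ) : H →L[ℂ] H :=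
  -((2 * (Real.pi : ℂ) * Complex.I)⁻¹ • ∮ w in C(z, r), resolvent A w)

open Classical in
/-- The (Riesz) spectral projection of `A` associated with an isolated point `z` of its spectrum:
the Riesz integral over a circle around `z` enclosing no other point of the spectrum. By Cauchy's
theorem it does not depend on the choice of this circle. (It is set to `0` if there is no such
circle.) -/
def spectralProjection (A : H →ₗ.[ℂ] H) (z : ℂ) : H →L[ℂ] H :=
  if h : ∃ r : ℝ, IsolatingRadius A z r then rieszIntegral A z h.choose else 0

/-- `z` is an algebraically simple eigenvalue of `A`: an isolated eigenvalue of algebraic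
multiplicity one, the algebraic multiplicity being the rank of the spectral projection. -/
def IsAlgebraicallySimple (A : H →ₗ.[ℂ] H) (z : ℂ) : Prop :=
  IsIsolatedEigenvalue A z ∧
    Module.finrank ℂ (LinearMap.range (spectralProjection A z : H →ₗ[ℂ] H)) = 1

end Spectral

/-! ### Test functions, weak derivatives, Sobolev spaces on an open interval -/

/-- Complex-valued test functions, `φ ∈ C_c^∞(Ω)`. -/
def IsTest (Ω : Set ℝ) (φ : ℝ → ℂ) : Prop :=
  ContDiff ℝ ∞ φ ∧ HasCompactSupport φ ∧ tsupport φ ⊆ Ω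

theorem IsTest.zero (Ω : Set ℝ) : IsTest Ω 0 :=
  ⟨contDiff_const, HasCompactSupport.zero, by
    have : tsupport (0 : ℝ → ℂ) = ∅ := by simp
    rw [this]; exact empty_subset _⟩

theorem IsTest.add {Ω : Set ℝ} {φ ψ : ℝ → ℂ} (hφ : IsTest Ω φ) (hψ : IsTest Ω ψ) :
    IsTest Ω (φ + ψ) :=
  ⟨hφ.1.add hψ.1, hφ.2.1.add hψ.2.1,
    (tsupport_add φ ψ).trans (union_subset hφ.2.2 hψ.2.2)⟩

theorem IsTest.smul {Ω : Set ℝ} {φ : ℝ → ℂ} (c : ℂ) (hφ : IsTest Ω φ) :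
    IsTest Ω (c • φ) := by
  refine ⟨contDiff_const.smul hφ.1, ?_, ?_⟩
  · exact hφ.2.1.smul_left (f := fun _ => c)
  · exact (closure_mono (Function.support_const_smul_subset c φ)).trans hφ.2.2

theorem IsTest.differentiable {Ω : Set ℝ} {φ : ℝ → ℂ} (hφ : IsTest Ω φ) : Differentiable ℝ φ :=
  hφ.1.differentiable (by simp)

theorem IsTest.deriv {Ω : Set ℝ} {φ : ℝ → ℂ} (hφ : IsTest Ω φ) : IsTest Ω (deriv φ) :=
  ⟨(contDiff_infty_iff_deriv.1 hφ.1).2, hφ.2.1.deriv,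
    (closure_minimal (support_deriv_subset) (isClosed_tsupport _)).trans hφ.2.2⟩

/-- The space `L²(Ω)` of complex-valued functions on `Ω ⊆ ℝ`, with the Lebesgue measure. -/
abbrev L2 (Ω : Set ℝ) : Type := Lp ℂ 2 (volume.restrict Ω)

/-- The space `L²(ℝ)`. -/
abbrev L2R : Type := Lp ℂ 2 (volume : Measure ℝ)

/-- The product of a square-integrable function and of a continuous function with compact support
is integrable. -/
theorem integrable_mul {μ : Measure ℝ} [IsFiniteMeasureOnCompacts μ] (u : Lp ℂ 2 μ) {g : ℝ → ℂ}
    (hg : Continuous g) (hs : HasCompactSupport g) : Integrable (fun x => u x * g x) μ :=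
  (Lp.memLp u).integrable_mul (q := 2) (hg.memLp_of_hasCompactSupport hs)

/-- `v` is the derivative of `u` on `Ω` in the sense of distributions. -/
def HasWeakDeriv (Ω : Set ℝ) (u v : ℝ → ℂ) : Prop :=
  ∀ φ : ℝ → ℂ, IsTest Ω φ → ∫ x in Ω, u x * deriv φ x = -∫ x in Ω, v x * φ x

theorem HasWeakDeriv.zero (Ω : Set ℝ) : HasWeakDeriv Ω (0 : L2 Ω) (0 : L2 Ω) := by
  intro φ _
  have h : ((0 : L2 Ω) : ℝ → ℂ) =ᵐ[volume.restrict Ω] 0 := Lp.coeFn_zero _ _ _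
  have e : ∀ ψ : ℝ → ℂ, ∫ x in Ω, (0 : L2 Ω) x * ψ x = 0 := fun ψ => by
    rw [integral_congr_ae (g := fun _ => (0 : ℂ)) (h.mono fun x hx => by rw [hx]; simp),
      integral_zero]
  rw [e, e, neg_zero]

theorem HasWeakDeriv.add {Ω : Set ℝ} {u₁ v₁ u₂ v₂ : L2 Ω} (h₁ : HasWeakDeriv Ω u₁ v₁)
    (h₂ : HasWeakDeriv Ω u₂ v₂) : HasWeakDeriv Ω (u₁ + u₂ : L2 Ω) (v₁ + v₂ : L2 Ω) := by
  intro φ hφ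
  have e₁ : ∀ (w₁ w₂ : L2 Ω) (ψ : ℝ → ℂ), IsTest Ω ψ →
      ∫ x in Ω, (w₁ + w₂ : L2 Ω) x * ψ x
        = (∫ x in Ω, w₁ x * ψ x) + ∫ x in Ω, w₂ x * ψ x := by
    intro w₁ w₂ ψ hψ
    rw [← integral_add (integrable_mul w₁ hψ.1.continuous hψ.2.1)
      (integrable_mul w₂ hψ.1.continuous hψ.2.1)]
    refine integral_congr_ae ((Lp.coeFn_add w₁ w₂).mono fun x hx => ?_)
    simp only [hx, Pi.add_apply]; ring
  rw [e₁ _ _ _ hφ.deriv, e₁ _ _ _ hφ, h₁ φ hφ, h₂ φ hφ]; ring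

theorem HasWeakDeriv.smul {Ω : Set ℝ} {u v : L2 Ω} (c : ℂ) (h : HasWeakDeriv Ω u v) :
    HasWeakDeriv Ω (c • u : L2 Ω) (c • v : L2 Ω) := by
  intro φ hφ
  have e : ∀ (w : L2 Ω) (ψ : ℝ → ℂ),
      ∫ x in Ω, (c • w : L2 Ω) x * ψ x = c * ∫ x in Ω, w x * ψ x := by
    intro w ψ
    rw [← integral_const_mul]
    refine integral_congr_ae ((Lp.coeFn_smul c w).mono fun x hx => ?_)
    simp only [hx, Pi.smul_apply, smul_eq_mul]; ring
  rw [e, e, h φ hφ]; ring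

/-- A square-integrable function which vanishes as a distribution vanishes. -/
theorem eq_zero_of_test {Ω : Set ℝ} (hΩ : IsOpen Ω) (f : L2 Ω)
    (h : ∀ φ : ℝ → ℂ, IsTest Ω φ → ∫ x in Ω, f x * φ x = 0) : f = 0 := by
  have hloc : LocallyIntegrable (f : ℝ → ℂ) (volume.restrict Ω) :=
    (Lp.memLp f).locallyIntegrable (by norm_num)
  have key := hΩ.ae_eq_zero_of_integral_contDiff_smul_eq_zero (μ := volume.restrict Ω)
    (hloc.locallyIntegrableOn Ω) (fun g hg hgs hgt => by
      have := h (fun x => (g x : ℂ)) ⟨Complex.ofRealCLM.contDiff.comp hg,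
        hgs.comp_left (g := fun y : ℝ => (y : ℂ)) (by simp),
        (closure_mono (by intro x hx; simpa using hx)).trans hgt⟩
      rw [← this]
      exact integral_congr_ae (ae_of_all _ fun x => by
        simp only [Complex.real_smul]; ring))
  refine (Lp.eq_zero_iff_ae_eq_zero).2 ?_
  filter_upwards [key, ae_restrict_mem hΩ.measurableSet] with x hx hxΩ using hx hxΩ

/-- The weak derivative is unique. -/
theorem HasWeakDeriv.eq_zero {Ω : Set ℝ} (hΩ : IsOpen Ω) {v : L2 Ω}
    (h : HasWeakDeriv Ω (0 : L2 Ω) v) : v = 0 := by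
  refine eq_zero_of_test hΩ v fun φ hφ => ?_
  have h0 : ((0 : L2 Ω) : ℝ → ℂ) =ᵐ[volume.restrict Ω] 0 := Lp.coeFn_zero _ _ _
  have h1 := h φ hφ
  rw [integral_congr_ae (g := fun _ => (0 : ℂ)) (h0.mono fun x hx => by rw [hx]; simp)] at h1
  simpa using h1.symm

/-- The pairs `(φ, φ')` in `L²(Ω) × L²(Ω)`, for `φ` a test function on `Ω`. -/
def testPairs (Ω : Set ℝ) : Submodule ℂ (L2 Ω × L2 Ω) where
  carrier := {p | ∃ φ : ℝ → ℂ, IsTest Ω φ ∧ p.1 =ᵐ[volume.restrict Ω] φ ∧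
    p.2 =ᵐ[volume.restrict Ω] deriv φ}
  zero_mem' := ⟨0, IsTest.zero Ω, Lp.coeFn_zero _ _ _, by
    have : deriv (0 : ℝ → ℂ) = 0 := by ext x; simp
    rw [this]; exact Lp.coeFn_zero _ _ _⟩
  add_mem' := by
    rintro p p' ⟨φ, hφ, h1, h2⟩ ⟨ψ, hψ, h3, h4⟩
    refine ⟨φ + ψ, hφ.add hψ, (Lp.coeFn_add _ _).trans (h1.add h3), ?_⟩
    have : deriv (φ + ψ) = deriv φ + deriv ψ := by
      ext x; exact deriv_add (hφ.differentiable x) (hψ.differentiable x)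
    rw [this]
    exact (Lp.coeFn_add _ _).trans (h2.add h4)
  smul_mem' := by
    rintro c p ⟨φ, hφ, h1, h2⟩
    refine ⟨c • φ, hφ.smul c, (Lp.coeFn_smul _ _).trans (h1.const_smul c), ?_⟩
    have : deriv (c • φ) = c • deriv φ := by
      ext x; exact deriv_const_smul c (hφ.differentiable x)
    rw [this]
    exact (Lp.coeFn_smul _ _).trans (h2.const_smul c)

/-- The Sobolev space `H¹₀(Ω)`, each function `u` being given together with its derivative `u'`:
the closure of `C_c^∞(Ω)` for the `H¹`-norm. -/
def H10 (Ω : Set ℝ) : Submodule ℂ (L2 Ω × L2 Ω) :=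
  (testPairs Ω).topologicalClosure

/-! ### The operator `P_ν = -∂ₓ² + ν² q²` with Dirichlet boundary conditions -/

/-- The graph of `P_ν`, on `L²(Ω)` with `Ω` an open interval: the pairs `(u, -u'' + ν² q² u)` with
`u ∈ H²(Ω) ∩ H¹₀(Ω)`. Here `u ∈ H²(Ω)` means that `u` has weak derivatives `u'` and `u''`
in `L²(Ω)`. -/
def dirichletGraph (Ω : Set ℝ) (q : ℝ → ℝ) (ν : ℂ) : Submodule ℂ (L2 Ω × L2 Ω) where
  carrier := {p | ∃ u' u'' : L2 Ω, HasWeakDeriv Ω p.1 u' ∧ HasWeakDeriv Ω u' u'' ∧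
    (p.1, u') ∈ H10 Ω ∧
    p.2 =ᵐ[volume.restrict Ω] fun x => -u'' x + ν ^ 2 * (q x : ℂ) ^ 2 * p.1 x}
  zero_mem' := by
    refine ⟨0, 0, HasWeakDeriv.zero Ω, HasWeakDeriv.zero Ω, (H10 Ω).zero_mem, ?_⟩
    filter_upwards [Lp.coeFn_zero ℂ 2 (volume.restrict Ω)] with x hx
    simp only [Prod.fst_zero, Prod.snd_zero, hx, Pi.zero_apply]; ring
  add_mem' := by
    rintro ⟨u, f⟩ ⟨v, g⟩ ⟨u', u'', h1, h2, h3, h4⟩ ⟨v', v'', k1, k2, k3, k4⟩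
    refine ⟨u' + v', u'' + v'', h1.add k1, h2.add k2, (H10 Ω).add_mem h3 k3, ?_⟩
    filter_upwards [h4, k4, Lp.coeFn_add f g, Lp.coeFn_add u v, Lp.coeFn_add u'' v'']
      with x e1 e2 e3 e4 e5
    simp only [Prod.mk_add_mk, e3, e4, e5, Pi.add_apply] at e1 e2 ⊢
    rw [e1, e2]; ring
  smul_mem' := by
    rintro c ⟨u, f⟩ ⟨u', u'', h1, h2, h3, h4⟩
    refine ⟨c • u', c • u'', h1.smul c, h2.smul c, (H10 Ω).smul_mem c h3, ?_⟩
    filter_upwards [h4, Lp.coeFn_smul c f, Lp.coeFn_smul c u, Lp.coeFn_smul c u'']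
      with x e1 e3 e4 e5
    simp only [Prod.smul_mk, e3, e4, e5, Pi.smul_apply, smul_eq_mul] at e1 ⊢
    rw [e1]; ring

/-- The open interval `I = (-L₁, L₂)`. -/
def interval (L₁ L₂ : ℝ) : Set ℝ := Ioo (-L₁) L₂

/-- The unbounded operator `P_ν = -∂ₓ² + ν² q²` on `L²(I)`, `I = (-L₁, L₂)`, with domain
`H²(I) ∩ H¹₀(I)` (for `q` bounded on `I`). -/
def P (L₁ L₂ : ℝ) (q : ℝ → ℝ) (ν : ℂ) :
    L2 (interval L₁ L₂) →ₗ.[ℂ] L2 (interval L₁ L₂) :=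
  (dirichletGraph (interval L₁ L₂) q ν).toLinearPMap

/-- The graph of `P_ν` is indeed the prescribed one. -/
theorem P_graph (L₁ L₂ : ℝ) (q : ℝ → ℝ) (ν : ℂ) :
    (P L₁ L₂ q ν).graph = dirichletGraph (interval L₁ L₂) q ν := by
  refine Submodule.toLinearPMap_graph_eq _ ?_
  rintro ⟨u, f⟩ ⟨u', u'', h1, h2, -, h4⟩ hu
  simp only at hu h1 h4 ⊢
  subst hu
  have hI : IsOpen (interval L₁ L₂) := isOpen_Ioo
  obtain rfl := h1.eq_zero hI
  obtain rfl := h2.eq_zero hI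
  refine (Lp.eq_zero_iff_ae_eq_zero).2 ?_
  filter_upwards [h4, Lp.coeFn_zero ℂ 2 (volume.restrict (interval L₁ L₂))] with x e1 e2
  simp only [e1, e2, Pi.zero_apply]; ring

/-! ### The non-selfadjoint harmonic oscillator `H_β = -∂ₓ² + β² x²` on `L²(ℝ)` -/

/-- The formal operator `-φ'' + β² x² φ` on smooth functions. -/
def formalOsc (β : ℂ) (φ : ℝ → ℂ) (x : ℝ) : ℂ :=
  -deriv (deriv φ) x + β ^ 2 * (x : ℂ) ^ 2 * φ x

theorem continuous_formalOsc (β : ℂ) {φ : ℝ → ℂ} (hφ : IsTest univ φ) :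
    Continuous (formalOsc β φ) := by
  have h1 := hφ.1.continuous
  have h2 := hφ.deriv.deriv.1.continuous
  unfold formalOsc
  fun_prop

theorem hasCompactSupport_formalOsc (β : ℂ) {φ : ℝ → ℂ} (hφ : IsTest univ φ) :
    HasCompactSupport (formalOsc β φ) :=
  (hφ.deriv.deriv.2.1.neg).add (hφ.2.1.mul_left (f := fun x : ℝ => β ^ 2 * (x : ℂ) ^ 2))

/-- The graph of `H_β`: the pairs `(u, f)` in `L²(ℝ) × L²(ℝ)` such that `-u'' + β² x² u = f` in
the sense of distributions. -/
def oscillatorGraph (β : ℂ) : Submodule ℂ (L2R × L2R) where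
  carrier := {p | ∀ φ : ℝ → ℂ, IsTest univ φ →
    ∫ x, p.1 x * formalOsc β φ x = ∫ x, p.2 x * φ x}
  zero_mem' := by
    intro φ _
    have h : ((0 : L2R) : ℝ → ℂ) =ᵐ[volume] 0 := Lp.coeFn_zero _ _ _
    refine integral_congr_ae (h.mono fun x hx => ?_)
    simp only [Prod.fst_zero, Prod.snd_zero, hx, Pi.zero_apply, zero_mul]
  add_mem' := by
    rintro ⟨u, f⟩ ⟨v, g⟩ h k φ hφ
    have e : ∀ (w₁ w₂ : L2R) (ψ : ℝ → ℂ), Continuous ψ → HasCompactSupport ψ →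
        ∫ x, (w₁ + w₂ : L2R) x * ψ x = (∫ x, w₁ x * ψ x) + ∫ x, w₂ x * ψ x := by
      intro w₁ w₂ ψ hc hs
      rw [← integral_add (integrable_mul w₁ hc hs) (integrable_mul w₂ hc hs)]
      refine integral_congr_ae ((Lp.coeFn_add w₁ w₂).mono fun x hx => ?_)
      simp only [hx, Pi.add_apply]; ring
    simp only [Prod.mk_add_mk]
    rw [e _ _ _ (continuous_formalOsc β hφ) (hasCompactSupport_formalOsc β hφ),
      e _ _ _ hφ.1.continuous hφ.2.1, h φ hφ, k φ hφ]
  smul_mem' := by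
    rintro c ⟨u, f⟩ h φ hφ
    have e : ∀ (w : L2R) (ψ : ℝ → ℂ),
        ∫ x, (c • w : L2R) x * ψ x = c * ∫ x, w x * ψ x := by
      intro w ψ
      rw [← integral_const_mul]
      refine integral_congr_ae ((Lp.coeFn_smul c w).mono fun x hx => ?_)
      simp only [hx, Pi.smul_apply, smul_eq_mul]; ring
    simp only [Prod.smul_mk]
    rw [e, e, h φ hφ]

/-- The non-selfadjoint harmonic oscillator `H_β = -∂ₓ² + β² x²` on `L²(ℝ)`, with domain
`{u ∈ L²(ℝ) : -u'' + β² x² u ∈ L²(ℝ)}`. -/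
def oscillator (β : ℂ) : L2R →ₗ.[ℂ] L2R :=
  (oscillatorGraph β).toLinearPMap

/-- The graph of `H_β` is indeed the prescribed one. -/
theorem oscillator_graph (β : ℂ) : (oscillator β).graph = oscillatorGraph β := by
  refine Submodule.toLinearPMap_graph_eq _ ?_
  rintro ⟨u, f⟩ h hu
  simp only at hu ⊢
  subst hu
  have h0 : ((0 : L2R) : ℝ → ℂ) =ᵐ[volume] 0 := Lp.coeFn_zero _ _ _
  have hloc : LocallyIntegrable (f : ℝ → ℂ) volume :=
    (Lp.memLp f).locallyIntegrable (by norm_num)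
  have key := isOpen_univ.ae_eq_zero_of_integral_contDiff_smul_eq_zero (μ := volume)
    (hloc.locallyIntegrableOn univ) (fun g hg hgs hgt => by
      have := h (fun x => (g x : ℂ)) ⟨Complex.ofRealCLM.contDiff.comp hg,
        hgs.comp_left (g := fun y : ℝ => (y : ℂ)) (by simp), subset_univ _⟩
      simp only at this
      rw [integral_congr_ae (g := fun _ => (0 : ℂ)) (h0.mono fun x hx => by rw [hx]; simp)] at this
      rw [integral_zero] at this
      rw [this]
      exact integral_congr_ae (ae_of_all _ fun x => by
        simp only [Complex.real_smul]; ring))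
  refine (Lp.eq_zero_iff_ae_eq_zero).2 ?_
  filter_upwards [key] with x hx using hx (mem_univ x)

/-! ### Extension by zero and restriction -/

theorem memLp_indicator {Ω : Set ℝ} (hΩ : MeasurableSet Ω) (u : L2 Ω) :
    MemLp (Ω.indicator (u : ℝ → ℂ)) 2 volume :=
  (memLp_indicator_iff_restrict hΩ).2 (Lp.memLp u)

/-- The operator `𝟙_I : L²(I) → L²(ℝ)` of extension by zero, `I = (-L₁, L₂)`. -/
def extendZero (L₁ L₂ : ℝ) : L2 (interval L₁ L₂) →L[ℂ] L2R :=
  LinearMap.mkContinuous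
    { toFun := fun u => (memLp_indicator (Ω := interval L₁ L₂) measurableSet_Ioo u).toLp _
      map_add' := by
        intro u v
        rw [← MemLp.toLp_add]
        refine MemLp.toLp_congr _ _ ?_
        have h := (ae_restrict_iff' (s := interval L₁ L₂) measurableSet_Ioo).1 (Lp.coeFn_add u v)
        filter_upwards [h] with x hx
        by_cases hm : x ∈ interval L₁ L₂
        · simp only [Pi.add_apply, indicator_of_mem hm, hx hm]
        · simp [hm]
      map_smul' := by
        intro c u
        rw [RingHom.id_apply, ← MemLp.toLp_const_smul]
        refine MemLp.toLp_congr _ _ ?_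
        have h := (ae_restrict_iff' (s := interval L₁ L₂) measurableSet_Ioo).1 (Lp.coeFn_smul c u)
        filter_upwards [h] with x hx
        by_cases hm : x ∈ interval L₁ L₂
        · simp only [Pi.smul_apply, indicator_of_mem hm, hx hm]
        · simp [hm] }
    1 (by
      intro u
      rw [one_mul]
      simp only [LinearMap.coe_mk, AddHom.coe_mk, Lp.norm_toLp]
      rw [eLpNorm_indicator_eq_eLpNorm_restrict (by exact measurableSet_Ioo), ← Lp.norm_def])

/-- `𝟙_I u` is indeed the extension of `u` by zero. -/
theorem extendZero_coeFn (L₁ L₂ : ℝ) (u : L2 (interval L₁ L₂)) :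
    extendZero L₁ L₂ u =ᵐ[volume] (interval L₁ L₂).indicator u :=
  MemLp.coeFn_toLp (memLp_indicator (Ω := interval L₁ L₂) measurableSet_Ioo u)

/-- The operator `𝟙_I^* : L²(ℝ) → L²(I)` of restriction to `I = (-L₁, L₂)`. -/
def restrict (L₁ L₂ : ℝ) : L2R →L[ℂ] L2 (interval L₁ L₂) :=
  LpToLpRestrictCLM ℝ ℂ ℂ volume 2 (interval L₁ L₂)

/-- The sector `{ν ∈ ℂ : |ν| ≥ 1, |arg ν| ≤ θ₀}`. -/
def sector (θ₀ : ℝ) : Set ℂ := {ν | 1 ≤ ‖ν‖ ∧ |Complex.arg ν| ≤ θ₀}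

end Grushin

end

open MeasureTheory Set Filter Topology

open scoped ContDiff ENNReal

noncomputable section

namespace Grushin

/-! ### Resolvents and spectral projections -/

section Resolvents

variable {H : Type*} [NormedAddCommGroup H] [NormedSpace ℂ H]

/-! Put a = q'(0). The operators P_ν and H_{aν} are compared through their resolvents at -aν.
Everything follows once |ν| times the norm of the difference of these resolvents tends to 0 in the
sector.

Comparison. Write q(x) = x p(x) with p continuous, bounded away from 0, and p(0) = a. Both
resolvents are solution operators of forms on triples (u, u', xu). Multiplied by the conjugate of ν,
these forms have a real part that controls the energy, because Re ν ≥ cos θ₀ |ν|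
(`FormData.energy_le`), and Heisenberg's inequality recovers the norm of u. Let u and v solve the
oscillator and the Dirichlet problem with the same f, let χ be a cut-off near 0, and let w = v - χu.
The form evaluated at w only involves χ', (1 - χ)/x and (p² - a²)χ. Since u, u', xu have sizes
|ν|⁻¹, |ν|^(-1/2), |ν|^(-3/2), the difference of the resolvents times |ν| is O(η + K/√|ν|), where η
bounds (p² - a²)χ and K bounds the other two multipliers (`norm_res_sub_oscRes_le`). Choosing χ and
then |ν| makes this small.

Model. H_β is not selfadjoint, so spectral information alone gives no resolvent bound. The
factorizations (∂ + βx)(-∂ + βx) = H_β + β and (-∂ + βx)(∂ + βx) = H_β - β show that 2β(H_β + β)⁻¹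
is a rank one projection onto the Gaussian plus 2βXY, with X = (-∂ + βx)(H_β + 3β)⁻¹, Y = (H_β +
β)⁻¹(∂ + βx) and YX = (H_β + 3β)⁻¹. The formula (1 - sXY)⁻¹ = 1 + sX(1 - sYX)⁻¹Y then reduces the
complementary part to resolvents of H_β at points -βt with Re t ≥ 0, bounded uniformly in the sector
(`SectorData.exists_simpleModel`).

Perturbation. With z = -aν + 2aνσ, the disc |z - aν| ≤ a|ν| becomes |σ - 1| ≤ 1/2. There the
eigenvalues are the roots of one scalar equation, which has a single simple root by the contraction
principle. The spectral projection is the residue of the Sherman-Morrison formula at that root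
(`SimpleModel.perturbation`). If δ bounds the perturbation, the eigenvalue moves by O(δ|ν|) and the
projection by O(δ). -/

theorem IsResolventAt.unique {A : H →ₗ.[ℂ] H} {z : ℂ} {R R' : H →L[ℂ] H}
    (h : IsResolventAt A z R) (h' : IsResolventAt A z R') : R = R' := by
  ext f
  obtain ⟨hm, e⟩ := h.1 f
  have := h'.2 ⟨R f, hm⟩
  rw [e] at this
  exact this.symm

theorem IsResolventAt.resolvent_eq {A : H →ₗ.[ℂ] H} {z : ℂ} {R : H →L[ℂ] H}
    (h : IsResolventAt A z R) : resolvent A z = R := by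
  have hex : ∃ R : H →L[ℂ] H, IsResolventAt A z R := ⟨R, h⟩
  rw [resolvent, dif_pos hex]
  exact hex.choose_spec.unique h

theorem IsResolventAt.not_isEigenvalue {A : H →ₗ.[ℂ] H} {z : ℂ} {R : H →L[ℂ] H}
    (h : IsResolventAt A z R) : ¬ IsEigenvalue A z := by
  rintro ⟨u, hu, e⟩
  have := h.2 u
  rw [e, sub_self, map_zero] at this
  exact hu this.symm

/-- On the domain, A - z = (1 - (z - z₀)R)(A - z₀). Inverting A - z thus becomes a question about a
bounded operator, and the unbounded one can be left aside. -/
theorem IsResolventAt.of_inverse {A : H →ₗ.[ℂ] H} {z₀ z : ℂ} {R B : H →L[ℂ] H}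
    (h : IsResolventAt A z₀ R) (h1 : (1 - (z - z₀) • R) * B = 1)
    (h2 : B * (1 - (z - z₀) • R) = 1) : IsResolventAt A z (R * B) := by
  refine ⟨fun f => ?_, fun u => ?_⟩
  · obtain ⟨hm, e⟩ := h.1 (B f)
    refine ⟨hm, ?_⟩
    have e1 := DFunLike.congr_fun h1 f
    simp only [mul_apply_eq_comp, sub_apply,
      one_apply_eq_self, smul_apply] at e1 ⊢
    rw [sub_eq_iff_eq_add] at e
    rw [e]
    refine Eq.trans ?_ e1
    module
  · have e := h.2 u
    set g := A u - z₀ • (u : H) with hg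
    have e2 := DFunLike.congr_fun h2 g
    simp only [mul_apply_eq_comp, sub_apply,
      one_apply_eq_self, smul_apply] at e2 ⊢
    have e3 : A u - z • (u : H) = g - (z - z₀) • R g := by rw [e, hg]; module
    rw [e3, e2, e]

theorem IsResolventAt.eventually [CompleteSpace H] {A : H →ₗ.[ℂ] H} {z₀ : ℂ} {R : H →L[ℂ] H}
    (h : IsResolventAt A z₀ R) :
    ∀ᶠ z in 𝓝 z₀, IsResolventAt A z (R * Ring.inverse (1 - (z - z₀) • R)) := by
  have hc : Tendsto (fun z : ℂ => 1 - (z - z₀) • R) (𝓝 z₀) (𝓝 1) := by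
    have : Continuous (fun z : ℂ => 1 - (z - z₀) • R) := by fun_prop
    simpa using this.tendsto z₀
  have hu : ∀ᶠ z in 𝓝 z₀, IsUnit (1 - (z - z₀) • R) :=
    hc.eventually (Units.isOpen.mem_nhds (by simp : IsUnit (1 : H →L[ℂ] H)))
  filter_upwards [hu] with z hz
  exact h.of_inverse (Ring.mul_inverse_cancel _ hz) (Ring.inverse_mul_cancel _ hz)

theorem differentiableAt_resolvent [CompleteSpace H] {A : H →ₗ.[ℂ] H} {z₀ : ℂ}
    (h : z₀ ∈ resolventSet A) : DifferentiableAt ℂ (resolvent A) z₀ := by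
  obtain ⟨R, hR⟩ := h
  have he : resolvent A =ᶠ[𝓝 z₀] fun z => R * Ring.inverse (1 - (z - z₀) • R) :=
    hR.eventually.mono fun z hz => hz.resolvent_eq
  refine DifferentiableAt.congr_of_eventuallyEq ?_ he
  have hi : DifferentiableAt ℂ (fun z : ℂ => Ring.inverse (1 - (z - z₀) • R)) z₀ := by
    have h1 : IsUnit (1 - (z₀ - z₀) • R) := by simp
    exact DifferentiableAt.comp (g := Ring.inverse) (f := fun z : ℂ => 1 - (z - z₀) • R) z₀
      (differentiableAt_inverse h1) (by fun_prop)
  exact (differentiableAt_const R).mul hi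

/-- The spectral projection at an isolated point `l` of the spectrum is `-Q` if the resolvent is
equivalent to `Q / (w - l)` at `l`. -/
theorem spectralProjection_eq [CompleteSpace H] {A : H →ₗ.[ℂ] H} {l : ℂ} {Q : H →L[ℂ] H}
    (hr : ∃ r, IsolatingRadius A l r)
    (ht : Tendsto (fun w => (w - l) • resolvent A w) (𝓝[≠] l) (𝓝 (-Q))) :
    spectralProjection A l = Q := by
  rw [spectralProjection, dif_pos hr]
  obtain ⟨h0, h1⟩ := hr.choose_spec
  set r := hr.choose
  have hd : ∀ z ∈ Metric.closedBall l r \ {l},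
      DifferentiableAt ℂ (fun w => (w - l) • resolvent A w) z := by
    rintro z ⟨hz, hne⟩
    have := differentiableAt_resolvent (h1 z hne (by rwa [← dist_eq_norm]))
    exact (differentiableAt_id.sub_const l).smul this
  -- Cauchy's formula at the center for (w - l)(A - w)⁻¹. It needs only a limit at l, so no Laurent
  -- expansion of the resolvent is required.
  have key :=
    Complex.circleIntegral_sub_center_inv_smul_of_differentiable_on_off_countable_of_tendsto
    h0 (f := fun w => (w - l) • resolvent A w) (y := -Q) countable_empty
    (fun z hz => (hd z hz).continuousAt.continuousWithinAt)
    (fun z hz => hd z ⟨Metric.ball_subset_closedBall hz.1.1, hz.1.2⟩) ht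
  have hi : (∮ w in C(l, r), resolvent A w)
      = ∮ w in C(l, r), (w - l)⁻¹ • ((w - l) • resolvent A w) := by
    refine circleIntegral.integral_congr h0.le fun w hw => ?_
    have hne : w - l ≠ 0 := by
      rw [← norm_pos_iff, ← dist_eq_norm, Metric.mem_sphere.1 hw]; exact h0
    simp only [smul_smul, inv_mul_cancel₀ hne, one_smul]
  rw [rieszIntegral, hi, key, smul_smul, inv_mul_cancel₀ Complex.two_pi_I_ne_zero, one_smul,
    neg_neg]

end Resolvents

/-! ### Perturbation of a simple eigenvalue -/

section Perturbation

variable {X : Type*} [NormedAddCommGroup X] [NormedSpace ℂ X] [CompleteSpace X]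

/-- The operator `M + φ ⊗ ψ` has the simple eigenvalue `1`, with eigenprojection `φ ⊗ ψ`, and its
reduced part `M` is such that `(1 - σ M)⁻¹` is bounded by `C` for `|σ - 1| ≤ 1/2`. -/
structure SimpleModel (M : X →L[ℂ] X) (φ : X) (ψ : X →L[ℂ] ℂ) (C : ℝ) : Prop where
  one_le : 1 ≤ C
  norm_vec : ‖φ‖ ≤ 1
  norm_func : ‖ψ‖ ≤ C
  norm_op : ‖M‖ ≤ C
  map_vec : M φ = 0
  func_map : ∀ x, ψ (M x) = 0
  pairing : ψ φ = 1
  inv : ∀ σ : ℂ, ‖σ - 1‖ ≤ 1 / 2 →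
    ∃ B : X →L[ℂ] X, (1 - σ • M) * B = 1 ∧ B * (1 - σ • M) = 1 ∧ ‖B‖ ≤ C

theorem norm_le_two_of_near_one {σ : ℂ} (hσ : ‖σ - 1‖ ≤ 1 / 2) : ‖σ‖ ≤ 2 := by
  have := norm_add_le (σ - 1) 1
  simp only [sub_add_cancel, norm_one] at this
  linarith

/-- The inverse of `1 - σ K`. -/
def invOne (K : X →L[ℂ] X) (σ : ℂ) : X →L[ℂ] X := Ring.inverse (1 - σ • K)

namespace SimpleModel

variable {M D : X →L[ℂ] X} {φ : X} {ψ : X →L[ℂ] ℂ} {C δ : ℝ}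

-- The smallness assumption is stated with C⁴ only. Since C ≥ 1, these comparisons let it absorb
-- every lower power that occurs.
omit [CompleteSpace X] in
theorem small (h : SimpleModel M φ ψ C) (hD : ‖D‖ ≤ δ) :
    0 ≤ δ ∧ δ ≤ C ^ 4 * δ ∧ C * δ ≤ C ^ 4 * δ ∧ C ^ 2 * δ ≤ C ^ 4 * δ := by
  have h0 : 0 ≤ δ := (norm_nonneg _).trans hD
  have h1 := h.one_le
  refine ⟨h0, ?_, ?_, ?_⟩
  · exact le_mul_of_one_le_left h0 (one_le_pow₀ h1)
  · exact mul_le_mul_of_nonneg_right (le_self_pow₀ h1 (by norm_num)) h0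
  · exact mul_le_mul_of_nonneg_right (pow_le_pow_right₀ h1 (by norm_num)) h0

/-- Neumann series: 1 - σ(M + D) = (1 - σM)(1 - BσD) with B = (1 - σM)⁻¹ and BσD small. For the
norm, the inverse V satisfies V = B + VσDB, and the last term is at most half of the norm of V,
hence is absorbed. -/
theorem isUnit (h : SimpleModel M φ ψ C) (hD : ‖D‖ ≤ δ) (hδ : 100 * C ^ 4 * δ ≤ 1)
    {σ : ℂ} (hσ : ‖σ - 1‖ ≤ 1 / 2) :
    IsUnit (1 - σ • (M + D)) ∧ ‖invOne (M + D) σ‖ ≤ 2 * C := by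
  obtain ⟨h0, -, hs, -⟩ := h.small hD
  have hC := h.one_le
  obtain ⟨B, hB1, hB2, hB3⟩ := h.inv σ hσ
  have hσ2 := norm_le_two_of_near_one hσ
  have hn : ‖B * (σ • D)‖ ≤ 2 * (C * δ) := by
    refine (norm_mul_le _ _).trans ?_
    rw [norm_smul]
    calc ‖B‖ * (‖σ‖ * ‖D‖) ≤ C * (2 * δ) := by gcongr
      _ = 2 * (C * δ) := by ring
  have hfac : 1 - σ • (M + D) = (1 - σ • M) * (1 - B * (σ • D)) := by
    rw [mul_sub, ← mul_assoc, hB1, mul_one, one_mul, smul_add]; abel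
  have hu : IsUnit (1 - σ • (M + D)) := by
    rw [hfac]
    exact IsUnit.mul ⟨⟨_, _, hB1, hB2⟩, rfl⟩ (isUnit_one_sub_of_norm_lt_one (by linarith))
  refine ⟨hu, ?_⟩
  have hV := Ring.inverse_mul_cancel _ hu
  change invOne (M + D) σ * _ = 1 at hV
  set V := invOne (M + D) σ
  have e : V = B + V * (σ • D) * B := by
    have : V * (1 - σ • M) = 1 + V * (σ • D) := by
      rw [smul_add] at hV
      have e : V * (1 - σ • M) = V * (1 - (σ • M + σ • D)) + V * (σ • D) := by
        rw [← mul_add]; congr 1; abel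
      rw [e, hV]
    calc V = V * (1 - σ • M) * B := by rw [mul_assoc, hB1, mul_one]
      _ = _ := by rw [this, add_mul, one_mul]
  have hle : ‖V‖ ≤ C + ‖V‖ * (2 * (C * δ)) := by
    calc ‖V‖ = ‖B + V * (σ • D) * B‖ := by rw [← e]
      _ ≤ ‖B‖ + ‖V‖ * (‖σ‖ * ‖D‖) * ‖B‖ := by
        refine (norm_add_le _ _).trans (add_le_add_right ?_ _)
        refine (norm_mul_le _ _).trans ?_
        gcongr
        refine (norm_mul_le _ _).trans ?_
        rw [norm_smul]
      _ ≤ C + ‖V‖ * (2 * δ) * C := by gcongr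
      _ = _ := by ring
  have : ‖V‖ * (2 * (C * δ)) ≤ ‖V‖ * (1 / 2) := by gcongr; linarith
  linarith

variable (h : SimpleModel M φ ψ C) (hD : ‖D‖ ≤ δ) (hδ : 100 * C ^ 4 * δ ≤ 1)
include h hD hδ

theorem mul_invOne {σ : ℂ} (hσ : ‖σ - 1‖ ≤ 1 / 2) :
    (1 - σ • (M + D)) * invOne (M + D) σ = 1 :=
  Ring.mul_inverse_cancel _ (h.isUnit hD hδ hσ).1

theorem invOne_mul {σ : ℂ} (hσ : ‖σ - 1‖ ≤ 1 / 2) :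
    invOne (M + D) σ * (1 - σ • (M + D)) = 1 :=
  Ring.inverse_mul_cancel _ (h.isUnit hD hδ hσ).1

theorem continuousAt_invOne {σ : ℂ} (hσ : ‖σ - 1‖ ≤ 1 / 2) :
    ContinuousAt (invOne (M + D)) σ := by
  have h1 := (h.isUnit hD hδ hσ).1
  have h2 : ContinuousAt (Ring.inverse : (X →L[ℂ] X) → _) (1 - σ • (M + D)) :=
    (differentiableAt_inverse (𝕜 := ℂ) h1).continuousAt
  exact ContinuousAt.comp (f := fun τ : ℂ => 1 - τ • (M + D)) h2 (by fun_prop)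

/-- Because Mφ = 0, one has Vφ - φ = σVDφ: the vector φ moves only through D. The dual estimate on ψ
uses ψM = 0 in the same way. -/
theorem norm_vec_sub {σ : ℂ} (hσ : ‖σ - 1‖ ≤ 1 / 2) :
    ‖invOne (M + D) σ φ - φ‖ ≤ 4 * (C * δ) := by
  have hC := h.one_le
  have e := DFunLike.congr_fun (h.invOne_mul hD hδ hσ) φ
  have hV := (h.isUnit hD hδ hσ).2
  set V := invOne (M + D) σ
  simp only [mul_apply_eq_comp, sub_apply, one_apply_eq_self, smul_apply, add_apply, h.map_vec,
    zero_add, map_sub, map_smul] at e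
  have e1 : V φ - φ = σ • V (D φ) := by rw [sub_eq_iff_eq_add] at e; rw [e]; abel
  rw [e1, norm_smul]
  calc ‖σ‖ * ‖V (D φ)‖ ≤ ‖σ‖ * (‖V‖ * (‖D‖ * ‖φ‖)) := by
        gcongr; exact V.le_opNorm_of_le (D.le_opNorm _)
    _ ≤ 2 * (2 * C * (δ * 1)) := by
        have := norm_le_two_of_near_one hσ
        have := h.norm_vec
        have := (h.small hD).1
        gcongr
    _ = _ := by ring

theorem norm_vec_le {σ : ℂ} (hσ : ‖σ - 1‖ ≤ 1 / 2) : ‖invOne (M + D) σ φ‖ ≤ 2 * C := by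
  have hC := h.one_le
  have hV := (h.isUnit hD hδ hσ).2
  calc _ ≤ ‖invOne (M + D) σ‖ * ‖φ‖ := ContinuousLinearMap.le_opNorm _ _
    _ ≤ 2 * C * 1 := by gcongr; exact h.norm_vec
    _ = _ := mul_one _

theorem norm_func_le {σ : ℂ} (hσ : ‖σ - 1‖ ≤ 1 / 2) :
    ‖ψ.comp (invOne (M + D) σ)‖ ≤ 2 * C ^ 2 := by
  have hC := h.one_le
  have hV := (h.isUnit hD hδ hσ).2
  calc _ ≤ ‖ψ‖ * ‖invOne (M + D) σ‖ := ContinuousLinearMap.opNorm_comp_le _ _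
    _ ≤ C * (2 * C) := by gcongr; exact h.norm_func
    _ = _ := by ring

theorem norm_func_sub {σ : ℂ} (hσ : ‖σ - 1‖ ≤ 1 / 2) :
    ‖ψ.comp (invOne (M + D) σ) - ψ‖ ≤ 4 * (C ^ 2 * δ) := by
  have hC := h.one_le
  have h0 := (h.small hD).1
  refine ContinuousLinearMap.opNorm_le_bound _ (by positivity) fun x => ?_
  have e := DFunLike.congr_fun (h.mul_invOne hD hδ hσ) x
  have hV := (h.isUnit hD hδ hσ).2
  set V := invOne (M + D) σ
  simp only [mul_apply_eq_comp, sub_apply, one_apply_eq_self, smul_apply, add_apply] at e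
  have e1 : (ψ.comp V - ψ) x = σ • ψ (D (V x)) := by
    have := congrArg ψ e
    simp only [map_sub, map_smul, map_add, h.func_map, zero_add] at this
    simp only [sub_apply, ContinuousLinearMap.comp_apply]
    rw [← this]; abel
  rw [e1, norm_smul]
  calc ‖σ‖ * ‖ψ (D (V x))‖ ≤ ‖σ‖ * (‖ψ‖ * (‖D‖ * (‖V‖ * ‖x‖))) := by
        gcongr
        exact ψ.le_opNorm_of_le (D.le_opNorm_of_le (V.le_opNorm _))
    _ ≤ 2 * (C * (δ * (2 * C * ‖x‖))) := by
        gcongr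
        · exact norm_le_two_of_near_one hσ
        · exact h.norm_func
    _ = _ := by ring

theorem norm_pairing_sub {σ : ℂ} (hσ : ‖σ - 1‖ ≤ 1 / 2) :
    ‖ψ (invOne (M + D) σ φ) - 1‖ ≤ 4 * (C ^ 2 * δ) := by
  have hC := h.one_le
  have h0 := (h.small hD).1
  rw [← h.pairing, ← map_sub]
  calc _ ≤ ‖ψ‖ * _ := ψ.le_opNorm _
    _ ≤ C * (4 * (C * δ)) := by
      gcongr
      · exact h.norm_func
      · exact h.norm_vec_sub hD hδ hσ
    _ = _ := by ring

/-- The resolvent identity V_σ - V_τ = (σ - τ)V_σ(M + D)V_τ, tested on φ and ψ. It is an exact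
divided difference, which replaces differentiation in σ throughout. -/
theorem pairing_sub {σ τ : ℂ} (hσ : ‖σ - 1‖ ≤ 1 / 2) (hτ : ‖τ - 1‖ ≤ 1 / 2) :
    ψ (invOne (M + D) σ φ) - ψ (invOne (M + D) τ φ) =
      (σ - τ) * ψ (invOne (M + D) σ ((M + D) (invOne (M + D) τ φ))) := by
  have e1 := DFunLike.congr_fun (h.mul_invOne hD hδ hτ) φ
  have e2 := DFunLike.congr_fun (h.invOne_mul hD hδ hσ) (invOne (M + D) τ φ)
  set V := invOne (M + D) σ
  set U := invOne (M + D) τ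
  simp only [mul_apply_eq_comp, sub_apply, one_apply_eq_self, smul_apply] at e1 e2
  have e3 : V φ - U φ = (σ - τ) • V ((M + D) (U φ)) := by
    have : V φ = V (U φ) - τ • V ((M + D) (U φ)) := by
      nth_rewrite 1 [← e1]; rw [map_sub, map_smul]
    have e4 : U φ = V (U φ) - σ • V ((M + D) (U φ)) := by
      rw [← map_smul, ← map_sub, e2]
    rw [this]; refine Eq.trans (congrArg (_ - ·) e4) ?_; module
  rw [← map_sub, e3, map_smul, smul_eq_mul]

/-- The divided difference is O(δ) and not merely bounded: M kills φ, so (M + D)V_τφ = M(V_τφ - φ) +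
DV_τφ, and both terms are O(δ). -/
theorem norm_pairing_quotient {σ τ : ℂ} (hσ : ‖σ - 1‖ ≤ 1 / 2) (hτ : ‖τ - 1‖ ≤ 1 / 2) :
    ‖ψ (invOne (M + D) σ ((M + D) (invOne (M + D) τ φ)))‖ ≤ 12 * (C ^ 4 * δ) := by
  have hC := h.one_le
  have h0 := (h.small hD).1
  set U := invOne (M + D) τ with hU
  have e : (M + D) (U φ) = M (U φ - φ) + D (U φ) := by
    rw [map_sub, h.map_vec, sub_zero, add_apply]
  have hb : ‖(M + D) (U φ)‖ ≤ 6 * (C ^ 2 * δ) := by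
    rw [e]
    calc _ ≤ ‖M‖ * ‖U φ - φ‖ + ‖D‖ * ‖U φ‖ :=
          (norm_add_le _ _).trans (add_le_add (M.le_opNorm _) (D.le_opNorm _))
      _ ≤ C * (4 * (C * δ)) + δ * (2 * C) := by
          gcongr
          · exact h.norm_op
          · exact h.norm_vec_sub hD hδ hτ
          · exact h.norm_vec_le hD hδ hτ
      _ ≤ 6 * (C ^ 2 * δ) := by
          have : C * δ ≤ C ^ 2 * δ := by gcongr; exact le_self_pow₀ hC (by norm_num)
          nlinarith
  have hη := h.norm_func_le hD hδ hσ
  calc _ ≤ ‖ψ.comp (invOne (M + D) σ)‖ * ‖(M + D) (U φ)‖ :=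
        (ψ.comp (invOne (M + D) σ)).le_opNorm _
    _ ≤ 2 * C ^ 2 * (6 * (C ^ 2 * δ)) := by gcongr
    _ = _ := by ring

theorem norm_pairing_ge {σ : ℂ} (hσ : ‖σ - 1‖ ≤ 1 / 2) :
    4 / 5 ≤ ‖ψ (invOne (M + D) σ φ)‖ := by
  have h1 := h.norm_pairing_sub hD hδ hσ
  have h2 := (h.small hD).2.2.2
  have := norm_sub_norm_le (1 : ℂ) (1 - ψ (invOne (M + D) σ φ))
  rw [sub_sub_cancel, norm_sub_rev 1 (ψ _), norm_one] at this
  linarith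

/-- The equation `σ ψ((1 - σ (M + D))⁻¹ φ) = 1` has a unique solution. -/
theorem exists_root : ∃ σ₀ : ℂ, ‖σ₀ - 1‖ ≤ 5 * (C ^ 2 * δ) ∧
    ∀ σ : ℂ, ‖σ - 1‖ ≤ 1 / 2 → (σ * ψ (invOne (M + D) σ φ) = 1 ↔ σ = σ₀) := by
  -- The equation is the fixed-point equation σ = 1/g(σ). The function g is close to 1 and its
  -- divided differences are O(C⁴δ), so σ ↦ 1/g(σ) is a contraction of the disc |σ - 1| ≤ 1/2.
  set g : ℂ → ℂ := fun σ => ψ (invOne (M + D) σ φ) with hg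
  obtain ⟨h0, -, -, h2⟩ := h.small hD
  have hg0 : ∀ σ : ℂ, ‖σ - 1‖ ≤ 1 / 2 → g σ ≠ 0 := fun σ hσ e => by
    have := h.norm_pairing_ge hD hδ hσ
    change 4 / 5 ≤ ‖g σ‖ at this
    rw [e, norm_zero] at this; linarith
  have hF1 : ∀ σ : ℂ, ‖σ - 1‖ ≤ 1 / 2 → ‖(g σ)⁻¹ - 1‖ ≤ 5 * (C ^ 2 * δ) := fun σ hσ => by
    have e : (g σ)⁻¹ - 1 = -((g σ - 1) / g σ) := by field_simp [hg0 σ hσ]; ring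
    rw [e, norm_neg, norm_div, div_le_iff₀ (norm_pos_iff.2 (hg0 σ hσ))]
    have h3 := h.norm_pairing_ge hD hδ hσ
    have h4 := h.norm_pairing_sub hD hδ hσ
    have h5 : 0 ≤ C ^ 2 * δ := by positivity
    change 4 / 5 ≤ ‖g σ‖ at h3
    change ‖g σ - 1‖ ≤ _ at h4
    nlinarith
  have hLip : ∀ σ τ : ℂ, ‖σ - 1‖ ≤ 1 / 2 → ‖τ - 1‖ ≤ 1 / 2 →
      ‖(g σ)⁻¹ - (g τ)⁻¹‖ ≤ 1 / 2 * ‖σ - τ‖ := fun σ τ hσ hτ => by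
    have e : (g σ)⁻¹ - (g τ)⁻¹ = -((g σ - g τ) / (g σ * g τ)) := by
      field_simp [hg0 σ hσ, hg0 τ hτ]; ring
    have hpos : 0 < ‖g σ * g τ‖ := norm_pos_iff.2 (mul_ne_zero (hg0 σ hσ) (hg0 τ hτ))
    rw [e, norm_neg, norm_div, div_le_iff₀ hpos, norm_mul]
    have h3 := h.norm_pairing_ge hD hδ hσ
    have h4 := h.norm_pairing_ge hD hδ hτ
    have h5 := h.norm_pairing_quotient hD hδ hσ hτ
    change 4 / 5 ≤ ‖g σ‖ at h3
    change 4 / 5 ≤ ‖g τ‖ at h4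
    have h6 : ‖g σ - g τ‖ ≤ ‖σ - τ‖ * (12 * (C ^ 4 * δ)) := by
      rw [hg]; simp only
      rw [h.pairing_sub hD hδ hσ hτ, norm_mul]
      gcongr
    have h7 : (16 : ℝ) / 25 ≤ ‖g σ‖ * ‖g τ‖ := by nlinarith
    have h8 : ‖σ - τ‖ * (12 * (C ^ 4 * δ)) ≤ ‖σ - τ‖ * (12 / 100) := by gcongr; linarith
    have h9 := mul_le_mul_of_nonneg_left h7 (norm_nonneg (σ - τ))
    nlinarith [norm_nonneg (σ - τ)]
  have hmaps : MapsTo (fun σ => (g σ)⁻¹) (Metric.closedBall (1 : ℂ) (1 / 2))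
      (Metric.closedBall 1 (1 / 2)) := fun σ hσ => by
    rw [Metric.mem_closedBall, dist_eq_norm] at hσ ⊢
    have := hF1 σ hσ
    linarith
  have hK : ContractingWith (1 / 2) (hmaps.restrict _ _ _) := by
    refine ⟨by norm_num, LipschitzWith.of_dist_le_mul fun x y => ?_⟩
    have h1 := x.2; have h2 := y.2
    rw [Metric.mem_closedBall, dist_eq_norm] at h1 h2
    have := hLip x y h1 h2
    rw [Subtype.dist_eq, Subtype.dist_eq, dist_eq_norm, dist_eq_norm]
    simpa using this
  obtain ⟨σ₀, hm, hfix, -⟩ := hK.exists_fixedPoint'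
    (Metric.isClosed_closedBall.isComplete) hmaps (x := 1) (by simp) (edist_ne_top _ _)
  rw [Metric.mem_closedBall, dist_eq_norm] at hm
  have hfix' : (g σ₀)⁻¹ = σ₀ := hfix
  refine ⟨σ₀, ?_, fun σ hσ => ⟨fun e => ?_, ?_⟩⟩
  · have := hF1 σ₀ hm
    rwa [hfix'] at this
  · have e1 : (g σ)⁻¹ = σ := inv_eq_of_mul_eq_one_left e
    have := hLip σ σ₀ hσ hm
    rw [e1, hfix'] at this
    have h3 : ‖σ - σ₀‖ ≤ 0 := by linarith
    exact sub_eq_zero.1 (norm_le_zero_iff.1 h3)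
  · rintro rfl
    change σ * g σ = 1
    nth_rewrite 1 [← hfix']
    exact inv_mul_cancel₀ (hg0 σ hm)

end SimpleModel

end Perturbation

/-! ### Rank one update: Sherman-Morrison inversion, residue at the root, spectral projection -/

section Perturbation

variable {X : Type*} [NormedAddCommGroup X] [NormedSpace ℂ X] [CompleteSpace X]

namespace SimpleModel

variable {M D : X →L[ℂ] X} {φ : X} {ψ : X →L[ℂ] ℂ} {C δ : ℝ}

/-- The inverse of `1 - σ (M + D + φ ⊗ ψ)`, by the Sherman-Morrison formula. -/
def invRankOne (M D : X →L[ℂ] X) (φ : X) (ψ : X →L[ℂ] ℂ) (σ : ℂ) : X →L[ℂ] X :=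
  invOne (M + D) σ + (σ / (1 - σ * ψ (invOne (M + D) σ φ))) •
    (ψ.comp (invOne (M + D) σ)).smulRight (invOne (M + D) σ φ)

theorem invRankOne_spec (h : SimpleModel M φ ψ C) (hD : ‖D‖ ≤ δ) (hδ : 100 * C ^ 4 * δ ≤ 1)
    {σ : ℂ} (hσ : ‖σ - 1‖ ≤ 1 / 2) (hk : σ * ψ (invOne (M + D) σ φ) ≠ 1) :
    (1 - σ • (M + D + ψ.smulRight φ)) * invRankOne M D φ ψ σ = 1 ∧
      invRankOne M D φ ψ σ * (1 - σ • (M + D + ψ.smulRight φ)) = 1 := by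
  have e1 := h.mul_invOne hD hδ hσ
  have e2 := h.invOne_mul hD hδ hσ
  unfold invRankOne
  set V := invOne (M + D) σ
  set K := M + D
  have hk' : 1 - σ * ψ (V φ) ≠ 0 := fun e => hk (sub_eq_zero.1 e).symm
  have f1 : ∀ x, V x - σ • K (V x) = x := fun x => by simpa using DFunLike.congr_fun e1 x
  have f2 : ∀ x, V x - σ • V (K x) = x := fun x => by simpa using DFunLike.congr_fun e2 x
  -- The coefficient left in front of the rank one term on either side. It vanishes for exactly this
  -- choice of σ/(1 - σψ(Vφ)).
  have hc : ∀ a : ℂ, σ / (1 - σ * ψ (V φ)) * a - σ * (a + σ / (1 - σ * ψ (V φ)) * a * ψ (V φ))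
      = 0 := fun a => by field_simp; ring
  constructor
  · ext x
    simp only [mul_apply_eq_comp, sub_apply, one_apply_eq_self, smul_apply, add_apply,
      ContinuousLinearMap.smulRight_apply, ContinuousLinearMap.comp_apply, map_add, map_smul]
    have g1 := f1 x
    have g2 := f1 φ
    set t := σ / (1 - σ * ψ (V φ)) with ht
    refine Eq.trans (b := (V x - σ • K (V x)) + (t * ψ (V x)) • (V φ - σ • K (V φ))
          - (σ * (ψ (V x) + t * ψ (V x) * ψ (V φ))) • φ) (by module) ?_
    rw [g1, g2, add_sub_assoc, ← sub_smul, hc, zero_smul, add_zero]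
  · ext x
    simp only [mul_apply_eq_comp, sub_apply, one_apply_eq_self, smul_apply, add_apply,
      ContinuousLinearMap.smulRight_apply, ContinuousLinearMap.comp_apply, map_add, map_smul,
      map_sub]
    have g1 := f2 x
    have g2 : ψ (V x) = ψ x + σ * ψ (V (K x)) := by
      nth_rewrite 2 [← g1]; simp
    set t := σ / (1 - σ * ψ (V φ)) with ht
    rw [g2]
    refine Eq.trans (b := (V x - σ • V (K x)) +
      (t * ψ x - σ * (ψ x + t * ψ x * ψ (V φ))) • V φ) (by module) ?_
    rw [g1, hc, zero_smul, add_zero]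

/-- Since ρι = 1 and bιTρ is the operator K = M + D + φ ⊗ ψ on X, compressing the inverse of 1 - σK
by ρ and ι inverts 1 - σbT on Y. This transfers the model from L²(ℝ) to L²(I). -/
theorem resolventAt {Y : Type*} [NormedAddCommGroup Y] [NormedSpace ℂ Y]
    {ι : Y →L[ℂ] X} {ρ : X →L[ℂ] Y} (hρι : ∀ y, ρ (ι y) = y) {A : Y →ₗ.[ℂ] Y} {z₀ b : ℂ}
    {T : Y →L[ℂ] Y} (hT : IsResolventAt A z₀ T)
    (hTM : ∀ x, b • ι (T (ρ x)) = (M + D + ψ.smulRight φ) x)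
    (h : SimpleModel M φ ψ C) (hD : ‖D‖ ≤ δ) (hδ : 100 * C ^ 4 * δ ≤ 1)
    {σ : ℂ} (hσ : ‖σ - 1‖ ≤ 1 / 2) (hk : σ * ψ (invOne (M + D) σ φ) ≠ 1) :
    IsResolventAt A (z₀ + b * σ) (T * ρ.comp ((invRankOne M D φ ψ σ).comp ι)) := by
  obtain ⟨h1, h2⟩ := h.invRankOne_spec hD hδ hσ hk
  set B := invRankOne M D φ ψ σ
  set K := M + D + ψ.smulRight φ
  have f1 : ∀ x, B x - σ • K (B x) = x := fun x => by simpa using DFunLike.congr_fun h1 x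
  have f2 : ∀ x, B x - σ • B (K x) = x := fun x => by simpa using DFunLike.congr_fun h2 x
  refine hT.of_inverse ?_ ?_
  · ext y
    simp only [add_sub_cancel_left, mul_apply_eq_comp, sub_apply, one_apply_eq_self, smul_apply,
      ContinuousLinearMap.comp_apply]
    have := congrArg ρ (f1 (ι y))
    rw [map_sub, map_smul, ← hTM, map_smul, hρι, hρι, smul_smul, mul_comm σ b] at this
    exact this
  · ext y
    simp only [add_sub_cancel_left, mul_apply_eq_comp, sub_apply, one_apply_eq_self, smul_apply,
      ContinuousLinearMap.comp_apply, map_sub, map_smul]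
    have hK : K (ι y) = b • ι (T y) := by rw [← hTM, hρι]
    have := congrArg ρ (f2 (ι y))
    rw [hK, map_sub, map_smul, map_smul, map_smul, hρι, smul_smul, mul_comm σ b] at this
    exact this

/-- Minus the derivative of `1 - σ ψ((1 - σ (M + D))⁻¹ φ)` at one of its zeros. -/
def rootDeriv (M D : X →L[ℂ] X) (φ : X) (ψ : X →L[ℂ] ℂ) (σ : ℂ) : ℂ :=
  ψ (invOne (M + D) σ φ) + σ * ψ (invOne (M + D) σ ((M + D) (invOne (M + D) σ φ)))

section

variable (h : SimpleModel M φ ψ C) (hD : ‖D‖ ≤ δ) (hδ : 100 * C ^ 4 * δ ≤ 1)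
  {σ₀ : ℂ} (hσ₀ : ‖σ₀ - 1‖ ≤ 1 / 2)
include h hD hδ hσ₀

theorem norm_rootDeriv_sub :
    ‖rootDeriv M D φ ψ σ₀ - 1‖ ≤ 28 * (C ^ 4 * δ) := by
  obtain ⟨h0, -, -, hs2⟩ := h.small hD
  have h1 := h.norm_pairing_sub hD hδ hσ₀
  have h2 := h.norm_pairing_quotient hD hδ hσ₀ hσ₀
  have h3 := norm_le_two_of_near_one hσ₀
  rw [rootDeriv, add_sub_right_comm]
  refine (norm_add_le _ _).trans ?_
  rw [norm_mul]
  have := mul_le_mul h3 h2 (norm_nonneg _) (by norm_num)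
  linarith

theorem norm_rootDeriv_ge : 18 / 25 ≤ ‖rootDeriv M D φ ψ σ₀‖ := by
  have hm1 := h.norm_rootDeriv_sub hD hδ hσ₀
  have := norm_sub_norm_le (1 : ℂ) (1 - rootDeriv M D φ ψ σ₀)
  rw [sub_sub_cancel, norm_sub_rev 1 (rootDeriv M D φ ψ σ₀), norm_one] at this
  linarith

theorem rootDeriv_ne_zero : rootDeriv M D φ ψ σ₀ ≠ 0 := fun e => by
  have := h.norm_rootDeriv_ge hD hδ hσ₀
  rw [e, norm_zero] at this
  linarith

/-- The eigenvector equation. -/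
theorem vec_eq (hr : σ₀ * ψ (invOne (M + D) σ₀ φ) = 1) :
    σ₀ • (M + D + ψ.smulRight φ) (invOne (M + D) σ₀ φ) = invOne (M + D) σ₀ φ := by
  have := DFunLike.congr_fun (h.mul_invOne hD hδ hσ₀) φ
  set e := invOne (M + D) σ₀ φ with he
  rw [mul_apply_eq_comp, ← he, sub_apply, one_apply_eq_self, smul_apply, one_apply_eq_self,
    sub_eq_iff_eq_add'] at this
  rw [add_apply, smul_add, ContinuousLinearMap.smulRight_apply, smul_smul, hr, one_smul]
  exact this.symm

/-- The dual eigenvector equation. -/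
theorem func_eq (hr : σ₀ * ψ (invOne (M + D) σ₀ φ) = 1) (x : X) :
    ψ (invOne (M + D) σ₀ x) = σ₀ * ψ (invOne (M + D) σ₀ ((M + D + ψ.smulRight φ) x)) := by
  have := congrArg ψ (DFunLike.congr_fun (h.invOne_mul hD hδ hσ₀) x)
  rw [mul_apply_eq_comp, sub_apply, one_apply_eq_self, smul_apply, map_sub, map_smul, map_sub,
    map_smul, smul_eq_mul] at this
  change _ = ψ x at this
  rw [add_apply, map_add, map_add, ContinuousLinearMap.smulRight_apply, map_smul, map_smul,
    smul_eq_mul, mul_add, mul_left_comm, hr, ← this]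
  ring

theorem vec_ne_zero : invOne (M + D) σ₀ φ ≠ 0 := fun h2 => by
  have := DFunLike.congr_fun (h.mul_invOne hD hδ hσ₀) φ
  rw [mul_apply_eq_comp, h2, map_zero, one_apply_eq_self] at this
  have h3 := h.pairing
  rw [← this, map_zero] at h3
  exact zero_ne_one h3

/-- The only singular factor in the Sherman-Morrison formula is 1/(1 - σψ(V_σφ)), which has a simple
pole at σ₀ because `rootDeriv` does not vanish there. The limit is the residue. -/
theorem tendsto_invRankOne (hr : σ₀ * ψ (invOne (M + D) σ₀ φ) = 1)
    (hne : ∀ σ : ℂ, ‖σ - 1‖ ≤ 1 / 2 → σ ≠ σ₀ → σ * ψ (invOne (M + D) σ φ) ≠ 1)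
    (hσ₀' : ‖σ₀ - 1‖ < 1 / 2) :
    Tendsto (fun σ => (σ - σ₀) • invRankOne M D φ ψ σ) (𝓝[≠] σ₀)
      (𝓝 (-((σ₀ / rootDeriv M D φ ψ σ₀) •
        (ψ.comp (invOne (M + D) σ₀)).smulRight (invOne (M + D) σ₀ φ)))) := by
  have hm0 := h.rootDeriv_ne_zero hD hδ hσ₀
  have hVc := h.continuousAt_invOne hD hδ hσ₀
  have hps := fun {σ : ℂ} (hσ : ‖σ - 1‖ ≤ 1 / 2) => h.pairing_sub hD hδ hσ hσ₀
  rw [rootDeriv] at hm0 ⊢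
  unfold invRankOne
  generalize invOne (M + D) = V at *
  set e := V σ₀ φ with he
  set m : ℂ → ℂ := fun σ => ψ (V σ φ) + σ₀ * ψ (V σ ((M + D) e)) with hm
  -- Replace 1 by σ₀ψ(V_{σ₀}φ) and use the resolvent identity: the zero is factored out exactly,
  -- with a continuous cofactor m.
  have hkm : ∀ σ : ℂ, ‖σ - 1‖ ≤ 1 / 2 → 1 - σ * ψ (V σ φ) = -((σ - σ₀) * m σ) := fun σ hσ => by
    have h1 := hps hσ
    rw [hm, ← hr]; linear_combination -σ₀ * h1
  have hmc : ContinuousAt m σ₀ := by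
    rw [hm]; fun_prop
  have hsm : ContinuousAt (fun σ => (ψ.comp (V σ)).smulRight (V σ φ)) σ₀ := by
    have h1 : ContinuousAt (fun σ => ψ.comp (V σ)) σ₀ := by fun_prop
    have h2 : ContinuousAt (fun σ => V σ φ) σ₀ := by fun_prop
    exact ((ContinuousLinearMap.smulRightL ℂ X X).continuous₂.continuousAt
      (x := (ψ.comp (V σ₀), V σ₀ φ))).comp (f := fun σ => (ψ.comp (V σ), V σ φ))
      (h1.prodMk h2)
  have hc1 : ContinuousAt (fun σ : ℂ => σ - σ₀) σ₀ := by fun_prop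
  have hc2 : ContinuousAt (fun σ => -(σ / m σ)) σ₀ := (continuousAt_id.div hmc hm0).neg
  have hGc := (hc1.smul hVc).add (hc2.smul hsm)
  have hG0 : (fun σ => (σ - σ₀) • V σ + -(σ / m σ) • (ψ.comp (V σ)).smulRight (V σ φ)) σ₀ =
      -((σ₀ / m σ₀) • (ψ.comp (V σ₀)).smulRight e) := by
    simp only [sub_self, zero_smul, zero_add, neg_smul, he]
  have hlim := hGc.tendsto
  change Tendsto _ _ (𝓝 ((fun σ => (σ - σ₀) • V σ +
    -(σ / m σ) • (ψ.comp (V σ)).smulRight (V σ φ)) σ₀)) at hlim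
  rw [hG0] at hlim
  refine Tendsto.congr' ?_ (hlim.mono_left nhdsWithin_le_nhds)
  have hball : ∀ᶠ σ : ℂ in 𝓝 σ₀, ‖σ - 1‖ < 1 / 2 :=
    ContinuousAt.eventually_lt (by fun_prop) (by fun_prop) hσ₀'
  filter_upwards [hball.filter_mono nhdsWithin_le_nhds, self_mem_nhdsWithin] with σ hσ hn
  have hs0 : σ - σ₀ ≠ 0 := sub_ne_zero.2 hn
  have hk := hkm σ hσ.le
  have hk0 : m σ ≠ 0 := fun e => by
    rw [e, mul_zero, neg_zero, sub_eq_zero] at hk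
    exact hne σ hσ.le hn hk.symm
  rw [hk, smul_add, smul_smul]
  change (σ - σ₀) • V σ + -(σ / m σ) • (ψ.comp (V σ)).smulRight (V σ φ) = _
  congr 2
  field_simp

theorem norm_rankOne_sub (x : X) :
    ‖(rootDeriv M D φ ψ σ₀)⁻¹ • ψ (invOne (M + D) σ₀ x) • invOne (M + D) σ₀ φ - ψ x • φ‖ ≤
      200 * C ^ 7 * δ * ‖x‖ := by
  have hC := h.one_le
  obtain ⟨h0, -, -, hs2⟩ := h.small hD
  have hm1 := h.norm_rootDeriv_sub hD hδ hσ₀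
  have hm2 := h.norm_rootDeriv_ge hD hδ hσ₀
  have hm0 := h.rootDeriv_ne_zero hD hδ hσ₀
  set m := rootDeriv M D φ ψ σ₀
  have n3 : ‖invOne (M + D) σ₀ φ‖ ≤ 2 * C := h.norm_vec_le hD hδ hσ₀
  have n4 : ‖invOne (M + D) σ₀ φ - φ‖ ≤ 4 * (C * δ) := h.norm_vec_sub hD hδ hσ₀
  have n5 := h.norm_vec
  have n1 : ‖ψ (invOne (M + D) σ₀ x)‖ ≤ 2 * C ^ 2 * ‖x‖ :=
    (ψ.comp (invOne (M + D) σ₀)).le_of_opNorm_le (h.norm_func_le hD hδ hσ₀) x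
  have n2 : ‖ψ (invOne (M + D) σ₀ x) - ψ x‖ ≤ 4 * (C ^ 2 * δ) * ‖x‖ :=
    (ψ.comp (invOne (M + D) σ₀) - ψ).le_of_opNorm_le (h.norm_func_sub hD hδ hσ₀) x
  have hm3 : ‖m⁻¹ - 1‖ ≤ 40 * (C ^ 4 * δ) := by
    have e1 : m⁻¹ - 1 = -((m - 1) / m) := by field_simp; ring
    rw [e1, norm_neg, norm_div, div_le_iff₀ (by linarith)]
    have : 0 ≤ C ^ 4 * δ := by positivity
    nlinarith
  generalize invOne (M + D) σ₀ = V at *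
  set e := V φ
  have e0 : m⁻¹ • ψ (V x) • e - ψ x • φ =
      (m⁻¹ - 1) • ψ (V x) • e + ψ (V x) • (e - φ) + (ψ (V x) - ψ x) • φ := by module
  rw [e0]
  calc _ ≤ ‖m⁻¹ - 1‖ * (‖ψ (V x)‖ * ‖e‖) + ‖ψ (V x)‖ * ‖e - φ‖ + ‖ψ (V x) - ψ x‖ * ‖φ‖ := by
        refine (norm_add₃_le).trans ?_
        simp only [norm_smul]; rfl
    _ ≤ 40 * (C ^ 4 * δ) * (2 * C ^ 2 * ‖x‖ * (2 * C)) + 2 * C ^ 2 * ‖x‖ * (4 * (C * δ))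
          + 4 * (C ^ 2 * δ) * ‖x‖ * 1 := by gcongr
    _ = (160 * C ^ 7 + 8 * C ^ 3 + 4 * C ^ 2) * δ * ‖x‖ := by ring
    _ ≤ _ := by
        have p1 : C ^ 3 ≤ C ^ 7 := pow_le_pow_right₀ hC (by norm_num)
        have p2 : C ^ 2 ≤ C ^ 7 := pow_le_pow_right₀ hC (by norm_num)
        have p3 : 0 ≤ C ^ 7 := by positivity
        gcongr
        linarith

end

/-- Perturbation of a simple eigenvalue: the operator `A` on `Y` has resolvent `T` at `z₀` and, up
to the scaling factor `b`, `ι T ρ` is a small perturbation of `M + φ ⊗ ψ`. -/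
theorem perturbation {Y : Type*} [NormedAddCommGroup Y] [NormedSpace ℂ Y] [CompleteSpace Y]
    {ι : Y →L[ℂ] X} {ρ : X →L[ℂ] Y} (hρι : ∀ y, ρ (ι y) = y) (hι : ‖ι‖ ≤ 1) (hρ : ‖ρ‖ ≤ 1)
    {A : Y →ₗ.[ℂ] Y} {z₀ b : ℂ} (hb : b ≠ 0) {T : Y →L[ℂ] Y} (hT : IsResolventAt A z₀ T)
    (hTM : ∀ x, b • ι (T (ρ x)) = (M + D + ψ.smulRight φ) x)
    (h : SimpleModel M φ ψ C) (hD : ‖D‖ ≤ δ) (hδ : 100 * C ^ 4 * δ ≤ 1) :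
    ∃ l : ℂ, ‖l - (z₀ + b)‖ ≤ 5 * (C ^ 2 * δ) * ‖b‖ ∧
      (∀ z : ℂ, ‖z - (z₀ + b)‖ ≤ ‖b‖ / 2 → (IsEigenvalue A z ↔ z = l)) ∧
      IsAlgebraicallySimple A l ∧
      ‖spectralProjection A l - ρ.comp ((ψ.smulRight φ).comp ι)‖ ≤ 200 * C ^ 7 * δ := by
  have hC := h.one_le
  obtain ⟨h0, -, -, hs2⟩ := h.small hD
  have hbn : 0 < ‖b‖ := norm_pos_iff.2 hb
  obtain ⟨σ₀, hσ₀, hroot⟩ := h.exists_root hD hδ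
  have hσ₀1 : ‖σ₀ - 1‖ ≤ 1 / 20 := by linarith
  have hσ₀2 : ‖σ₀ - 1‖ ≤ 1 / 2 := by linarith
  have hr0 := (hroot σ₀ hσ₀2).2 rfl
  have hne : ∀ σ : ℂ, ‖σ - 1‖ ≤ 1 / 2 → σ ≠ σ₀ → σ * ψ (invOne (M + D) σ φ) ≠ 1 :=
    fun σ hσ hn e => hn ((hroot σ hσ).1 e)
  have hσ₀0 : σ₀ ≠ 0 := by
    rintro rfl; rw [zero_mul] at hr0; exact zero_ne_one hr0
  have hlim := h.tendsto_invRankOne hD hδ hσ₀2 hr0 hne (by linarith)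
  have hres : ∀ σ : ℂ, ‖σ - 1‖ ≤ 1 / 2 → σ ≠ σ₀ →
      IsResolventAt A (z₀ + b * σ) (T * ρ.comp ((invRankOne M D φ ψ σ).comp ι)) :=
    fun σ hσ hn => h.resolventAt hρι hT hTM hD hδ hσ (hne σ hσ hn)
  have he1 := h.vec_eq hD hδ hσ₀2 hr0
  have hη1 := h.func_eq hD hδ hσ₀2 hr0
  have he0 := h.vec_ne_zero hD hδ hσ₀2
  have hm0 := h.rootDeriv_ne_zero hD hδ hσ₀2
  have hest := h.norm_rankOne_sub hD hδ hσ₀2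
  generalize rootDeriv M D φ ψ σ₀ = m at *
  generalize invRankOne M D φ ψ = B at *
  clear hne hroot h
  generalize invOne (M + D) σ₀ = V at *
  generalize M + D + ψ.smulRight φ = K at *
  set e := V φ with he
  -- The eigenvector e of K on X descends to Y: ρe is an eigenvector of T, hence of A, with
  -- A-eigenvalue z₀ + bσ₀.
  have hρe : ρ e = (σ₀ * b) • T (ρ e) := by
    have := congrArg ρ he1
    rw [map_smul, ← hTM, map_smul, hρι, smul_smul] at this
    exact this.symm
  have hρe0 : ρ e ≠ 0 := fun h1 => he0 (by rw [← he1, ← hTM, h1]; simp)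
  -- The dual eigenfunctional cannot vanish on the range of ι. Otherwise the dual equation at φ,
  -- where Kφ lies in that range, would give ψ(Vφ) = 0, against the root equation. This keeps the
  -- rank from being 0.
  obtain ⟨y₀, hy₀⟩ : ∃ y, ψ (V (ι y)) ≠ 0 := by
    by_contra! h2
    have h4 := hη1 φ
    rw [← hTM, map_smul, map_smul, h2, smul_zero, mul_zero] at h4
    rw [h4, mul_zero] at hr0
    exact zero_ne_one hr0
  set l := z₀ + b * σ₀ with hl
  have hzσ : ∀ z : ℂ, z₀ + b * ((z - z₀) / b) = z := fun z => by field_simp; ring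
  have hnσ : ∀ z : ℂ, ‖(z - z₀) / b - 1‖ = ‖z - (z₀ + b)‖ / ‖b‖ := fun z => by
    rw [← norm_div]; congr 1; field_simp; ring
  have hneσ : ∀ z : ℂ, z ≠ l → (z - z₀) / b ≠ σ₀ := fun z hz e => hz (by rw [hl, ← e, hzσ])
  have hres' : ∀ z : ℂ, ‖z - (z₀ + b)‖ ≤ ‖b‖ / 2 → z ≠ l →
      IsResolventAt A z (T * ρ.comp ((B ((z - z₀) / b)).comp ι)) := fun z hz hn => by
    have h1 : ‖(z - z₀) / b - 1‖ ≤ 1 / 2 := by rw [hnσ, div_le_iff₀ hbn]; linarith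
    have := hres _ h1 (hneσ z hn)
    rwa [hzσ] at this
  have hlb : ‖l - (z₀ + b)‖ = ‖σ₀ - 1‖ * ‖b‖ := by
    rw [hl, ← norm_mul]; congr 1; ring
  have heig : IsEigenvalue A l := by
    obtain ⟨hm, e1⟩ := hT.1 ((σ₀ * b) • ρ e)
    refine ⟨⟨_, hm⟩, ?_, ?_⟩
    · simp only [map_smul]; rwa [← hρe]
    · rw [sub_eq_iff_eq_add] at e1
      rw [e1]
      simp only [map_smul]
      rw [← hρe, hl, ← add_smul, mul_comm b, add_comm]
  -- The eigenvalue l is within |b|/20 of z₀ + b, and 2/5 + 1/20 < 1/2, so this disc stays where the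
  -- resolvent is known.
  have hiso : IsolatingRadius A l (2 / 5 * ‖b‖) := by
    refine ⟨by positivity, fun w hw hwl => ⟨_, hres' w ?_ hw⟩⟩
    have := norm_sub_le_norm_sub_add_norm_sub w l (z₀ + b)
    rw [hlb] at this
    nlinarith
  set Q : Y →L[ℂ] Y := m⁻¹ • ((ψ.comp V).comp ι).smulRight (ρ e) with hQ
  have hproj : spectralProjection A l = Q := by
    refine spectralProjection_eq ⟨_, hiso⟩ ?_
    have hσt : Tendsto (fun w => (w - z₀) / b) (𝓝[≠] l) (𝓝[≠] σ₀) := by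
      have : Continuous (fun w : ℂ => (w - z₀) / b) := by fun_prop
      have h1 := this.tendsto l
      have h2 : (l - z₀) / b = σ₀ := by rw [hl]; field_simp; ring
      rw [h2] at h1
      exact tendsto_nhdsWithin_iff.2 ⟨h1.mono_left nhdsWithin_le_nhds,
        eventually_nhdsWithin_of_forall hneσ⟩
    have hJ : Continuous fun K : X →L[ℂ] X => b • (T * ρ.comp (K.comp ι)) := by fun_prop
    have hlim2 := (hJ.tendsto _).comp (hlim.comp hσt)
    -- The factor b comes from w - l = b(σ - σ₀), and T multiplies ρe by 1/(σ₀b). Together they turn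
    -- σ₀/m into 1/m.
    have hval : b • (T * ρ.comp ((-((σ₀ / m) • (ψ.comp V).smulRight e)).comp ι)) = -Q := by
      ext y
      simp only [hQ, mul_apply_eq_comp, ContinuousLinearMap.comp_apply, neg_apply, smul_apply,
        map_neg, map_smul, ContinuousLinearMap.smulRight_apply, smul_neg]
      have h5 : T (ρ e) = (σ₀ * b)⁻¹ • ρ e := by
        rw [eq_inv_smul_iff₀ (mul_ne_zero hσ₀0 hb)]; exact hρe.symm
      rw [h5, smul_smul, smul_smul, smul_smul, smul_smul]
      congr 2
      field_simp
    rw [hval] at hlim2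
    refine hlim2.congr' ?_
    have hball : ∀ᶠ w : ℂ in 𝓝 l, ‖w - (z₀ + b)‖ < ‖b‖ / 2 :=
      ContinuousAt.eventually_lt (by fun_prop) (by fun_prop) (by rw [hlb]; nlinarith)
    filter_upwards [hball.filter_mono nhdsWithin_le_nhds, self_mem_nhdsWithin] with w hw hwl
    rw [(hres' w hw.le hwl).resolvent_eq]
    have hwσ : w - l = b * ((w - z₀) / b - σ₀) := by
      rw [mul_sub, mul_div_cancel₀ _ hb, hl]; ring
    rw [hwσ]
    ext y
    simp only [Function.comp_apply, mul_apply_eq_comp, ContinuousLinearMap.comp_apply,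
      smul_apply, map_smul, smul_smul]
  refine ⟨l, ?_, fun z hz => ⟨fun hE => ?_, fun e => e ▸ heig⟩, ⟨⟨heig, _, hiso⟩, ?_⟩, ?_⟩
  · rw [hlb]
    gcongr
  · by_contra hn
    exact (hres' z hz hn).not_isEigenvalue hE
  · rw [hproj]
    have : LinearMap.range (Q : Y →ₗ[ℂ] Y) = Submodule.span ℂ {ρ e} := by
      ext y
      rw [Submodule.mem_span_singleton, LinearMap.mem_range]
      constructor
      · rintro ⟨x, rfl⟩
        exact ⟨m⁻¹ * ψ (V (ι x)), by simp [hQ, smul_smul]⟩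
      · rintro ⟨c, rfl⟩
        refine ⟨(c * m / ψ (V (ι y₀))) • y₀, ?_⟩
        simp only [hQ, ContinuousLinearMap.coe_coe, map_smul, smul_apply,
          ContinuousLinearMap.smulRight_apply, ContinuousLinearMap.comp_apply, smul_smul]
        congr 1
        field_simp
    rw [this]
    exact finrank_span_singleton hρe0
  · rw [hproj]
    refine ContinuousLinearMap.opNorm_le_bound _ (by positivity) fun y => ?_
    have e0 : (Q - ρ.comp ((ψ.smulRight φ).comp ι)) y =
        ρ (m⁻¹ • ψ (V (ι y)) • e - ψ (ι y) • φ) := by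
      simp only [hQ, sub_apply, smul_apply, ContinuousLinearMap.smulRight_apply,
        ContinuousLinearMap.comp_apply, map_smul, map_sub]
    rw [e0]
    refine (ρ.le_of_opNorm_le hρ _).trans ?_
    rw [one_mul]
    refine (hest _).trans ?_
    have h2 := ι.le_of_opNorm_le hι y
    rw [one_mul] at h2
    gcongr

end SimpleModel

end Perturbation

/-! ### Test functions as elements of `L²(ℝ)` -/

section Tests

variable {Ω : Set ℝ} {φ ψ : ℝ → ℂ}

theorem IsTest.mono {Ω' : Set ℝ} (h : IsTest Ω φ) (hΩ : Ω ⊆ Ω') : IsTest Ω' φ :=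
  ⟨h.1, h.2.1, h.2.2.trans hΩ⟩

theorem IsTest.continuous (h : IsTest Ω φ) : Continuous φ := h.1.continuous

theorem IsTest.mul_left {g : ℝ → ℂ} (hg : ContDiff ℝ ∞ g) (h : IsTest Ω φ) :
    IsTest Ω (fun x => g x * φ x) :=
  ⟨hg.mul h.1, h.2.1.mul_left, (tsupport_mul_subset_right).trans h.2.2⟩

theorem contDiff_ofReal : ContDiff ℝ ∞ (fun x : ℝ => (x : ℂ)) := Complex.ofRealCLM.contDiff

theorem IsTest.id_mul (h : IsTest Ω φ) : IsTest Ω (fun x => (x : ℂ) * φ x) :=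
  h.mul_left contDiff_ofReal

theorem IsTest.conj (h : IsTest Ω φ) : IsTest Ω (fun x => star (φ x)) := by
  refine ⟨?_, h.2.1.comp_left (g := star) (star_zero _), ?_⟩
  · exact (starL' ℝ : ℂ ≃L[ℝ] ℂ).contDiff.comp h.1
  · refine (closure_mono fun x hx => ?_).trans h.2.2
    simpa using hx

theorem IsTest.hasDerivAt (h : IsTest Ω φ) (x : ℝ) : HasDerivAt φ (_root_.deriv φ x) x :=
  (h.differentiable x).hasDerivAt

theorem IsTest.memLp (h : IsTest Ω φ) : MemLp φ 2 (volume : Measure ℝ) :=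
  h.continuous.memLp_of_hasCompactSupport h.2.1

theorem IsTest.integrable (h : IsTest Ω φ) : Integrable φ :=
  h.continuous.integrable_of_hasCompactSupport h.2.1

theorem IsTest.integral_deriv (h : IsTest Ω φ) : ∫ x, _root_.deriv φ x = 0 :=
  integral_eq_zero_of_hasDerivAt_of_integrable h.hasDerivAt h.deriv.integrable h.integrable

theorem IsTest.integral_eq_zero {f' : ℝ → ℂ} (h : IsTest Ω φ) (hf : ∀ x, HasDerivAt φ (f' x) x) :
    ∫ x, f' x = 0 := by
  rw [← h.integral_deriv]
  exact integral_congr_ae (ae_of_all _ fun x => (hf x).deriv.symm)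

/-- A test function as an element of `L²(ℝ)`. -/
def IsTest.toL2 (h : IsTest Ω φ) : L2R := h.memLp.toLp φ

theorem IsTest.coeFn_toL2 (h : IsTest Ω φ) : h.toL2 =ᵐ[volume] φ := h.memLp.coeFn_toLp

theorem inner_eq_integral {u f : L2R} {g : ℝ → ℂ} (hu : u =ᵐ[volume] g) :
    inner ℂ u f = ∫ x, f x * star (g x) := by
  rw [L2.inner_def]
  refine integral_congr_ae ?_
  filter_upwards [hu] with x hx
  rw [hx]
  rfl

theorem inner_eq_integral₂ {u f : L2R} {g k : ℝ → ℂ} (hu : u =ᵐ[volume] g)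
    (hf : f =ᵐ[volume] k) : inner ℂ u f = ∫ x, k x * star (g x) := by
  rw [inner_eq_integral hu]
  refine integral_congr_ae ?_
  filter_upwards [hf] with x hx
  rw [hx]

/-- Distributional identities use the bilinear pairing ∫ fφ. Writing it as an inner product makes
linearity and continuity in f immediate. -/
theorem IsTest.inner_conj (h : IsTest Ω φ) (f : L2R) :
    inner ℂ h.conj.toL2 f = ∫ x, f x * φ x := by
  rw [inner_eq_integral h.conj.coeFn_toL2]
  simp

end Tests

/-! ### The form domain -/

/-- The Hilbert space `L²(ℝ)³`. -/
abbrev E3 : Type := PiLp 2 (fun _ : Fin 3 => L2R)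

/-- An element of `L²(ℝ)³`, given by its components. -/
def mk3 (a b c : L2R) : E3 := WithLp.toLp 2 ![a, b, c]

@[simp] theorem mk3_zero (a b c : L2R) : mk3 a b c 0 = a := rfl
@[simp] theorem mk3_one (a b c : L2R) : mk3 a b c 1 = b := rfl
@[simp] theorem mk3_two (a b c : L2R) : mk3 a b c 2 = c := rfl

theorem E3.ext {u v : E3} (h0 : u 0 = v 0) (h1 : u 1 = v 1) (h2 : u 2 = v 2) : u = v := by
  ext1 i
  fin_cases i
  · exact h0
  · exact h1
  · exact h2

theorem E3.inner_eq (u v : E3) :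
    inner ℂ u v = inner ℂ (u 0) (v 0) + inner ℂ (u 1) (v 1) + inner ℂ (u 2) (v 2) := by
  rw [PiLp.inner_apply, Fin.sum_univ_three]

theorem E3.norm_sq (u : E3) : ‖u‖ ^ 2 = ‖u 0‖ ^ 2 + ‖u 1‖ ^ 2 + ‖u 2‖ ^ 2 := by
  rw [PiLp.norm_sq_eq_of_L2, Fin.sum_univ_three]

theorem E3.continuous_apply (i : Fin 3) : Continuous fun u : E3 => u i :=
  (PiLp.proj (𝕜 := ℂ) 2 (fun _ : Fin 3 => L2R) i).continuous

/-- The triples `(φ, φ', x φ)`, for `φ` a test function on `Ω`. -/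
def testTriples (Ω : Set ℝ) : Submodule ℂ E3 where
  carrier := {u | ∃ φ : ℝ → ℂ, IsTest Ω φ ∧ u 0 =ᵐ[volume] φ ∧ u 1 =ᵐ[volume] deriv φ ∧
    u 2 =ᵐ[volume] fun x => (x : ℂ) * φ x}
  zero_mem' := by
    refine ⟨0, IsTest.zero Ω, Lp.coeFn_zero _ _ _, ?_, ?_⟩
    · have : deriv (0 : ℝ → ℂ) = 0 := by ext x; simp
      rw [this]; exact Lp.coeFn_zero _ _ _
    · refine (Lp.coeFn_zero ℂ 2 volume).trans (ae_of_all _ fun x => ?_)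
      simp
  add_mem' := by
    rintro u v ⟨φ, hφ, h1, h2, h3⟩ ⟨ψ, hψ, k1, k2, k3⟩
    refine ⟨φ + ψ, hφ.add hψ, (Lp.coeFn_add _ _).trans (h1.add k1), ?_, ?_⟩
    · have : deriv (φ + ψ) = deriv φ + deriv ψ := by
        ext x; exact deriv_add (hφ.differentiable x) (hψ.differentiable x)
      rw [this]
      exact (Lp.coeFn_add _ _).trans (h2.add k2)
    · refine ((Lp.coeFn_add _ _).trans (h3.add k3)).trans (ae_of_all _ fun x => ?_)
      simp only [Pi.add_apply]; ring
  smul_mem' := by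
    rintro c u ⟨φ, hφ, h1, h2, h3⟩
    refine ⟨c • φ, hφ.smul c, (Lp.coeFn_smul _ _).trans (h1.const_smul c), ?_, ?_⟩
    · have : deriv (c • φ) = c • deriv φ := by
        ext x; exact deriv_const_smul c (hφ.differentiable x)
      rw [this]
      exact (Lp.coeFn_smul _ _).trans (h2.const_smul c)
    · refine ((Lp.coeFn_smul _ _).trans (h3.const_smul c)).trans (ae_of_all _ fun x => ?_)
      simp only [Pi.smul_apply, smul_eq_mul]; ring

/-- The form domain: the triples `(u, u', x u)` in `L²(ℝ)³`, with `u` in the closure of the test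
functions on `Ω`. -/
def formDomain (Ω : Set ℝ) : Submodule ℂ E3 := (testTriples Ω).topologicalClosure

instance (Ω : Set ℝ) : CompleteSpace (formDomain Ω) :=
  Submodule.topologicalClosure.completeSpace _

section FormDomain

variable {Ω : Set ℝ} {φ : ℝ → ℂ}

/-- The triple `(φ, φ', x φ)`. -/
def IsTest.triple (h : IsTest Ω φ) : E3 := mk3 h.toL2 h.deriv.toL2 h.id_mul.toL2

theorem IsTest.triple_mem_testTriples (h : IsTest Ω φ) : h.triple ∈ testTriples Ω :=
  ⟨φ, h, h.coeFn_toL2, h.deriv.coeFn_toL2, h.id_mul.coeFn_toL2⟩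

theorem IsTest.triple_mem (h : IsTest Ω φ) : h.triple ∈ formDomain Ω :=
  Submodule.le_topologicalClosure _ h.triple_mem_testTriples

theorem exists_eq_triple {u : E3} (hu : u ∈ testTriples Ω) :
    ∃ (φ : ℝ → ℂ) (h : IsTest Ω φ), u = h.triple := by
  obtain ⟨φ, hφ, h1, h2, h3⟩ := hu
  exact ⟨φ, hφ, E3.ext (Lp.ext (h1.trans hφ.coeFn_toL2.symm))
    (Lp.ext (h2.trans hφ.deriv.coeFn_toL2.symm)) (Lp.ext (h3.trans hφ.id_mul.coeFn_toL2.symm))⟩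

/-- A closed condition satisfied by the test functions holds on the form domain. -/
theorem formDomain_induction {p : E3 → Prop} (hp : IsClosed {u | p u})
    (ht : ∀ (φ : ℝ → ℂ) (h : IsTest Ω φ), p h.triple) {u : E3} (hu : u ∈ formDomain Ω) : p u := by
  refine closure_minimal (s := (testTriples Ω : Set E3)) ?_ hp hu
  intro v hv
  obtain ⟨φ, h, rfl⟩ := exists_eq_triple hv
  exact ht φ h

theorem formDomain_mono {Ω' : Set ℝ} (hΩ : Ω ⊆ Ω') : formDomain Ω ≤ formDomain Ω' :=
  fun _ hu => formDomain_induction (p := fun u => u ∈ formDomain Ω')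
    (Submodule.isClosed_topologicalClosure _)
    (fun _ h => (h.mono hΩ).triple_mem) hu

/-- Pairing with the triple associated with a test function. -/
theorem IsTest.inner_triple (h : IsTest Ω φ) (f : E3) :
    inner ℂ h.conj.triple f = (∫ x, f 0 x * φ x) + (∫ x, f 1 x * _root_.deriv φ x)
      + ∫ x, f 2 x * (x * φ x) := by
  rw [E3.inner_eq, IsTest.triple, mk3_zero, mk3_one, mk3_two, h.inner_conj,
    inner_eq_integral h.conj.deriv.coeFn_toL2, inner_eq_integral h.conj.id_mul.coeFn_toL2]
  congr 2
  · refine congrArg _ ?_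
    funext x
    rw [show _root_.deriv (fun x => star (φ x)) x = star (_root_.deriv φ x) from deriv.star .., star_star]
  · funext x
    simp

/-- The condition on `f` in `L²(ℝ)³` of being orthogonal to the form domain need only be checked on
test functions. -/
theorem inner_eq_zero_of_test {f : E3}
    (h : ∀ φ : ℝ → ℂ, IsTest Ω φ → (∫ x, f 0 x * φ x) + (∫ x, f 1 x * deriv φ x)
      + ∫ x, f 2 x * (x * φ x) = 0) {v : E3} (hv : v ∈ formDomain Ω) : inner ℂ v f = 0 := by
  refine formDomain_induction (p := fun v => inner ℂ v f = 0)
    (isClosed_eq (by fun_prop) continuous_const) (fun φ hφ => ?_) hv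
  have h1 := hφ.conj.inner_triple f
  rw [h _ hφ.conj] at h1
  convert h1 using 2
  simp only [star_star]

/-- The commutation relation `[∂ₓ, x] = 1`. -/
theorem formDomain_commutator {u v : E3} (hu : u ∈ formDomain Ω) (hv : v ∈ formDomain Ω) :
    inner ℂ (v 2) (u 1) + inner ℂ (v 1) (u 2) = -inner ℂ (v 0) (u 0) := by
  have c := E3.continuous_apply
  refine formDomain_induction
    (p := fun u => inner ℂ (v 2) (u 1) + inner ℂ (v 1) (u 2) = -inner ℂ (v 0) (u 0))
    (isClosed_eq ((continuous_const.inner (c 1)).add (continuous_const.inner (c 2)))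
      (continuous_const.inner (c 0)).neg) (fun φ hφ => ?_) hu
  refine formDomain_induction
    (p := fun v => inner ℂ (v 2) (hφ.triple 1) + inner ℂ (v 1) (hφ.triple 2)
      = -inner ℂ (v 0) (hφ.triple 0))
    (isClosed_eq (((c 2).inner continuous_const).add ((c 1).inner continuous_const))
      ((c 0).inner continuous_const).neg) (fun ψ hψ => ?_) hv
  simp only [IsTest.triple, mk3_zero, mk3_one, mk3_two]
  rw [inner_eq_integral₂ hψ.id_mul.coeFn_toL2 hφ.deriv.coeFn_toL2,
    inner_eq_integral₂ hψ.deriv.coeFn_toL2 hφ.id_mul.coeFn_toL2,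
    inner_eq_integral₂ hψ.coeFn_toL2 hφ.coeFn_toL2, eq_neg_iff_add_eq_zero]
  have t1 := (hψ.id_mul.conj.mul_left hφ.deriv.1).integrable
  have t2 := (hψ.deriv.conj.mul_left hφ.id_mul.1).integrable
  have t3 := (hψ.conj.mul_left hφ.1).integrable
  have t12 : Integrable (fun x => deriv φ x * star (↑x * ψ x) + ↑x * φ x * star (deriv ψ x)) :=
    t1.add t2
  rw [← integral_add t1 t2, ← integral_add t12 t3]
  refine (hψ.conj.mul_left hφ.id_mul.1).integral_eq_zero fun x => ?_
  have hx : HasDerivAt (fun x : ℝ => (x : ℂ)) 1 x := Complex.ofRealCLM.hasDerivAt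
  refine HasDerivAt.congr_deriv ((hx.mul (hφ.hasDerivAt x)).mul ((hψ.hasDerivAt x).star)) ?_
  simp
  ring

/-- Heisenberg's inequality. -/
theorem formDomain_heisenberg {u : E3} (hu : u ∈ formDomain Ω) :
    ‖u 0‖ ^ 2 ≤ 2 * (‖u 1‖ * ‖u 2‖) := by
  have h := formDomain_commutator hu hu
  have h1 := congrArg norm h
  rw [norm_neg, inner_self_eq_norm_sq_to_K] at h1
  have h2 : ‖((‖u 0‖ : ℂ)) ^ 2‖ = ‖u 0‖ ^ 2 := by simp
  change _ = ‖((‖u 0‖ : ℂ)) ^ 2‖ at h1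
  rw [h2] at h1
  rw [← h1]
  refine (norm_add_le _ _).trans ?_
  have a1 := norm_inner_le_norm (𝕜 := ℂ) (u 2) (u 1)
  have a2 := norm_inner_le_norm (𝕜 := ℂ) (u 1) (u 2)
  linarith

/-- The second component of an element of the form domain is the derivative of the first one. -/
theorem formDomain_deriv {u : E3} (hu : u ∈ formDomain Ω) {ψ : ℝ → ℂ} (hψ : IsTest univ ψ) :
    ∫ x, u 0 x * deriv ψ x = -∫ x, u 1 x * ψ x := by
  have c := E3.continuous_apply
  rw [← hψ.inner_conj, ← hψ.deriv.inner_conj]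
  refine formDomain_induction (p := fun u =>
    inner ℂ hψ.deriv.conj.toL2 (u 0) = -inner ℂ hψ.conj.toL2 (u 1))
    (isClosed_eq (continuous_const.inner (c 0)) (continuous_const.inner (c 1)).neg)
    (fun φ hφ => ?_) hu
  simp only [IsTest.triple, mk3_zero, mk3_one]
  rw [inner_eq_integral₂ hψ.deriv.conj.coeFn_toL2 hφ.coeFn_toL2,
    inner_eq_integral₂ hψ.conj.coeFn_toL2 hφ.deriv.coeFn_toL2, eq_neg_iff_add_eq_zero]
  simp only [star_star]
  rw [← integral_add (hψ.deriv.mul_left hφ.1).integrable (hψ.mul_left hφ.deriv.1).integrable]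
  refine (hψ.mul_left hφ.1).integral_eq_zero fun x => ?_
  refine HasDerivAt.congr_deriv ((hφ.hasDerivAt x).mul (hψ.hasDerivAt x)) ?_
  ring

/-- The third component of an element of the form domain is `x` times the first one. -/
theorem formDomain_id_mul {u : E3} (hu : u ∈ formDomain Ω) {ψ : ℝ → ℂ} (hψ : IsTest univ ψ) :
    ∫ x, u 2 x * ψ x = ∫ x, u 0 x * (x * ψ x) := by
  have c := E3.continuous_apply
  rw [← hψ.inner_conj, ← hψ.id_mul.inner_conj]
  refine formDomain_induction (p := fun u =>
    inner ℂ hψ.conj.toL2 (u 2) = inner ℂ hψ.id_mul.conj.toL2 (u 0))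
    (isClosed_eq (continuous_const.inner (c 2)) (continuous_const.inner (c 0)))
    (fun φ hφ => ?_) hu
  simp only [IsTest.triple, mk3_zero, mk3_two]
  rw [inner_eq_integral₂ hψ.conj.coeFn_toL2 hφ.id_mul.coeFn_toL2,
    inner_eq_integral₂ hψ.id_mul.conj.coeFn_toL2 hφ.coeFn_toL2]
  refine integral_congr_ae (ae_of_all _ fun x => ?_)
  simp only [star_star]
  rw [mul_comm (x : ℂ), mul_assoc]

end FormDomain

/-! ### Multiplication operators -/

/-- The operator of multiplication by a bounded function. -/
def mulOp (g : ℝ → ℂ) (hg : MemLp g ∞ (volume : Measure ℝ)) : L2R →L[ℂ] L2R :=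
  (ContinuousLinearMap.mul ℂ ℂ).holderL volume ∞ 2 2 (hg.toLp g)

section MulOp

variable {g : ℝ → ℂ} (hg : MemLp g ∞ (volume : Measure ℝ))

theorem coeFn_mulOp (f : L2R) : mulOp g hg f =ᵐ[volume] fun x => g x * f x := by
  rw [mulOp, ContinuousLinearMap.holderL_apply_apply]
  filter_upwards [(ContinuousLinearMap.mul ℂ ℂ).coeFn_holder (r := 2) (hg.toLp g) f,
    hg.coeFn_toLp] with x h1 h2
  rw [h1, h2]; rfl

theorem norm_mulOp_le {C : ℝ} (h : ∀ᵐ x, ‖g x‖ ≤ C) (f : L2R) : ‖mulOp g hg f‖ ≤ C * ‖f‖ := by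
  refine Lp.norm_le_mul_norm_of_ae_le_mul ?_
  filter_upwards [h, coeFn_mulOp hg f] with x h1 h2
  rw [h2, norm_mul]
  gcongr

theorem norm_mulOp_ge {C : ℝ} (hC : 0 < C) (h : ∀ᵐ x, C ≤ ‖g x‖) (f : L2R) :
    C * ‖f‖ ≤ ‖mulOp g hg f‖ := by
  rw [← le_inv_mul_iff₀ hC]
  refine Lp.norm_le_mul_norm_of_ae_le_mul ?_
  filter_upwards [h, coeFn_mulOp hg f] with x h1 h2
  rw [h2, norm_mul, le_inv_mul_iff₀ hC]
  gcongr

/-- Multiplication by a real function is a symmetric operator. -/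
theorem inner_mulOp (hr : ∀ x, star (g x) = g x) (u v : L2R) :
    inner ℂ u (mulOp g hg v) = inner ℂ (mulOp g hg u) v := by
  rw [L2.inner_def, L2.inner_def]
  refine integral_congr_ae ?_
  filter_upwards [coeFn_mulOp hg u, coeFn_mulOp hg v] with x h1 h2
  rw [h1, h2]
  change g x * v x * star (u x) = v x * star (g x * u x)
  rw [star_mul', hr]; ring

end MulOp

/-! ### The Lax-Milgram theorem -/

section LaxMilgram

variable {E : Type*} [NormedAddCommGroup E] [InnerProductSpace ℂ E]

/-- The solution operator `f ↦ u` of the variational problem `u ∈ W`, `⟨v, A u⟩ = ⟨v, f⟩` for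
all `v ∈ W`. -/
def solveForm (W : Submodule ℂ E) [W.HasOrthogonalProjection] (A : E →L[ℂ] E) : E →L[ℂ] E :=
  W.subtypeL ∘L Ring.inverse (W.orthogonalProjectionOnto ∘L A ∘L W.subtypeL) ∘L
    W.orthogonalProjectionOnto

variable {W : Submodule ℂ E} [CompleteSpace W] {A : E →L[ℂ] E}

theorem solveForm_mem (f : E) : solveForm W A f ∈ W := Submodule.coe_mem _

/-- Coercivity is assumed for the modulus of the form, not its real part. This avoids rotating the
form by the conjugate of ν beforehand. -/
theorem isUnit_compression (hA : ∃ c : ℝ, 0 < c ∧ ∀ u ∈ W, c * ‖u‖ ^ 2 ≤ ‖inner ℂ u (A u)‖) :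
    IsUnit (W.orthogonalProjectionOnto ∘L A ∘L W.subtypeL) := by
  obtain ⟨c, hc, h⟩ := hA
  refine ContinuousLinearMap.isUnit_of_forall_le_norm_inner_map _ (c := ⟨c, hc.le⟩) hc fun u => ?_
  rw [norm_inner_symm]
  simp only [ContinuousLinearMap.comp_apply, Submodule.subtypeL_apply]
  rw [Submodule.inner_orthogonalProjectionOnto_eq_of_mem_left, mul_comm]
  exact h u u.2

theorem inner_solveForm (hA : ∃ c : ℝ, 0 < c ∧ ∀ u ∈ W, c * ‖u‖ ^ 2 ≤ ‖inner ℂ u (A u)‖)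
    (f : E) {v : E} (hv : v ∈ W) : inner ℂ v (A (solveForm W A f)) = inner ℂ v f := by
  have h1 := DFunLike.congr_fun (Ring.mul_inverse_cancel _ (isUnit_compression hA))
    (W.orthogonalProjectionOnto f)
  simp only [mul_apply_eq_comp, one_apply_eq_self, ContinuousLinearMap.comp_apply,
    Submodule.subtypeL_apply] at h1
  have h2 := congrArg (inner ℂ (⟨v, hv⟩ : W)) h1
  rw [Submodule.inner_orthogonalProjectionOnto_eq_of_mem_left,
    Submodule.inner_orthogonalProjectionOnto_eq_of_mem_left] at h2
  exact h2

theorem eq_solveForm (hA : ∃ c : ℝ, 0 < c ∧ ∀ u ∈ W, c * ‖u‖ ^ 2 ≤ ‖inner ℂ u (A u)‖)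
    {u f : E} (hu : u ∈ W) (h : ∀ v ∈ W, inner ℂ v (A u) = inner ℂ v f) :
    u = solveForm W A f := by
  obtain ⟨c, hc, hc'⟩ := id hA
  have hm : u - solveForm W A f ∈ W := W.sub_mem hu (solveForm_mem f)
  have h1 := hc' _ hm
  rw [map_sub, inner_sub_right, h _ hm, inner_solveForm hA f hm, sub_self, norm_zero] at h1
  have h2 : ‖u - solveForm W A f‖ ^ 2 ≤ 0 := by nlinarith
  exact sub_eq_zero.1 (norm_eq_zero.1 (pow_eq_zero_iff (two_ne_zero) |>.1
    (le_antisymm h2 (by positivity))))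

end LaxMilgram

/-! ### The sesquilinear forms -/

/-- The operator `(u₀, u₁, u₂) ↦ (b u₀, u₁, ν² M² u₂)`. -/
def formOp (ν b : ℂ) (M : L2R →L[ℂ] L2R) : E3 →L[ℂ] E3 :=
  ((PiLp.continuousLinearEquiv 2 ℂ (fun _ : Fin 3 => L2R)).symm : (Fin 3 → L2R) →L[ℂ] E3) ∘L
    ContinuousLinearMap.pi ![b • PiLp.proj (𝕜 := ℂ) 2 (fun _ : Fin 3 => L2R) 0,
      PiLp.proj (𝕜 := ℂ) 2 (fun _ : Fin 3 => L2R) 1,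
      ν ^ 2 • (M ∘L M ∘L PiLp.proj (𝕜 := ℂ) 2 (fun _ : Fin 3 => L2R) 2)]

theorem inner_formOp (ν b : ℂ) (M : L2R →L[ℂ] L2R) (u v : E3) :
    inner ℂ v (formOp ν b M u) = b * inner ℂ (v 0) (u 0) + inner ℂ (v 1) (u 1)
      + ν ^ 2 * inner ℂ (v 2) (M (M (u 2))) := by
  rw [E3.inner_eq]
  simp only [formOp, ContinuousLinearMap.comp_apply]
  change inner ℂ (v 0) (b • u 0) + inner ℂ (v 1) (u 1) + inner ℂ (v 2) (ν ^ 2 • M (M (u 2))) = _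
  rw [inner_smul_right, inner_smul_right]

/-- The data of a form `‖u'‖² + ν² ‖M x u‖² + a ν t ‖u‖²` with `ν` in a sector. -/
structure FormData (ν : ℂ) (κ a c : ℝ) (M : L2R →L[ℂ] L2R) : Prop where
  norm_pos : 0 < ‖ν‖
  sector_pos : 0 < κ
  sector_le : κ * ‖ν‖ ≤ ν.re
  slope_pos : 0 < a
  lower_pos : 0 < c
  symm : ∀ u v : L2R, inner ℂ u (M v) = inner ℂ (M u) v
  lower : ∀ u : L2R, c * ‖u‖ ≤ ‖M u‖

namespace FormData

variable {ν : ℂ} {κ a c : ℝ} {M : L2R →L[ℂ] L2R} (h : FormData ν κ a c M) {Ω : Set ℝ}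
include h

/-- Multiply by the conjugate of ν: the derivative term gets the factor ν̄, the potential term |ν|²ν
and the shift a|ν|²t. Both ν and ν̄ have real part at least κ|ν|, so no cancellation between the
terms survives. -/
theorem energy_le (t : ℂ) (u : E3) :
    κ * (‖u 1‖ ^ 2 + ‖ν‖ ^ 2 * ‖M (u 2)‖ ^ 2) + a * ‖ν‖ * t.re * ‖u 0‖ ^ 2 ≤
      ‖inner ℂ u (formOp ν (a * ν * t) M u)‖ := by
  have hn := h.norm_pos
  have e : inner ℂ u (formOp ν (a * ν * t) M u) =
      a * ν * t * (‖u 0‖ : ℂ) ^ 2 + (‖u 1‖ : ℂ) ^ 2 + ν ^ 2 * (‖M (u 2)‖ : ℂ) ^ 2 := by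
    rw [inner_formOp, h.symm, inner_self_eq_norm_sq_to_K, inner_self_eq_norm_sq_to_K,
      inner_self_eq_norm_sq_to_K]
    rfl
  rw [← mul_le_mul_iff_right₀ hn]
  calc ‖ν‖ * (κ * (‖u 1‖ ^ 2 + ‖ν‖ ^ 2 * ‖M (u 2)‖ ^ 2) + a * ‖ν‖ * t.re * ‖u 0‖ ^ 2)
      = (κ * ‖ν‖) * (‖u 1‖ ^ 2 + ‖ν‖ ^ 2 * ‖M (u 2)‖ ^ 2) +
          a * ‖ν‖ ^ 2 * t.re * ‖u 0‖ ^ 2 := by ring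
    _ ≤ ν.re * (‖u 1‖ ^ 2 + ‖ν‖ ^ 2 * ‖M (u 2)‖ ^ 2) +
          a * ‖ν‖ ^ 2 * t.re * ‖u 0‖ ^ 2 := by
        have := h.sector_le
        gcongr
    _ = (star ν * inner ℂ u (formOp ν (a * ν * t) M u)).re := by
        have hν : star ν * ν = ((‖ν‖ ^ 2 : ℝ) : ℂ) := by
          rw [mul_comm]; exact (Complex.mul_conj ν).trans (by rw [Complex.normSq_eq_norm_sq])
        have e2 : star ν * inner ℂ u (formOp ν (a * ν * t) M u) =
            ((a * ‖ν‖ ^ 2 * ‖u 0‖ ^ 2 : ℝ) : ℂ) * t + ((‖u 1‖ ^ 2 : ℝ) : ℂ) * star ν +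
              ((‖ν‖ ^ 2 * ‖M (u 2)‖ ^ 2 : ℝ) : ℂ) * ν := by
          rw [e]
          push_cast at hν ⊢
          linear_combination (a * t * (‖u 0‖ : ℂ) ^ 2 + ν * (‖M (u 2)‖ : ℂ) ^ 2) * hν
        rw [e2, Complex.add_re, Complex.add_re, Complex.re_ofReal_mul, Complex.re_ofReal_mul,
          Complex.re_ofReal_mul]
        change _ = _ + _ * ν.re + _
        ring
    _ ≤ ‖star ν * inner ℂ u (formOp ν (a * ν * t) M u)‖ := Complex.re_le_norm _
    _ = _ := by rw [norm_mul, norm_star]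

/-- The zero order term is only known to have a nonnegative contribution, possibly 0. The norm of u
itself is recovered from those of u' and xu by Heisenberg's inequality. -/
theorem coercive {t : ℂ} (ht : 0 ≤ t.re) :
    ∃ m : ℝ, 0 < m ∧ ∀ u ∈ formDomain Ω,
      m * ‖u‖ ^ 2 ≤ ‖inner ℂ u (formOp ν (a * ν * t) M u)‖ := by
  have hn := h.norm_pos
  have hκ := h.sector_pos
  have hc := h.lower_pos
  have ha := h.slope_pos
  refine ⟨κ * min 1 (‖ν‖ ^ 2 * c ^ 2) / 2, by positivity, fun u hu => ?_⟩
  refine le_trans ?_ (h.energy_le t u)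
  set m := min 1 (‖ν‖ ^ 2 * c ^ 2)
  have hm0 : 0 < m := by positivity
  have hm1 : m ≤ 1 := min_le_left _ _
  have hm2 : m ≤ ‖ν‖ ^ 2 * c ^ 2 := min_le_right _ _
  have h1 : (c * ‖u 2‖) ^ 2 ≤ ‖M (u 2)‖ ^ 2 := by
    have := h.lower (u 2)
    gcongr
  have h2 : m * (‖u 1‖ ^ 2 + ‖u 2‖ ^ 2) ≤ ‖u 1‖ ^ 2 + ‖ν‖ ^ 2 * ‖M (u 2)‖ ^ 2 := by
    have e1 : m * ‖u 1‖ ^ 2 ≤ 1 * ‖u 1‖ ^ 2 := by gcongr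
    have e2 : m * ‖u 2‖ ^ 2 ≤ ‖ν‖ ^ 2 * c ^ 2 * ‖u 2‖ ^ 2 := by gcongr
    have e3 : ‖ν‖ ^ 2 * (c * ‖u 2‖) ^ 2 ≤ ‖ν‖ ^ 2 * ‖M (u 2)‖ ^ 2 := by gcongr
    linarith
  have h3 : ‖u‖ ^ 2 ≤ 2 * (‖u 1‖ ^ 2 + ‖u 2‖ ^ 2) := by
    rw [E3.norm_sq]
    have := formDomain_heisenberg hu
    nlinarith [sq_nonneg (‖u 1‖ - ‖u 2‖)]
  calc κ * m / 2 * ‖u‖ ^ 2 ≤ κ * m / 2 * (2 * (‖u 1‖ ^ 2 + ‖u 2‖ ^ 2)) := by gcongr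
    _ = κ * (m * (‖u 1‖ ^ 2 + ‖u 2‖ ^ 2)) := by ring
    _ ≤ κ * (‖u 1‖ ^ 2 + ‖ν‖ ^ 2 * ‖M (u 2)‖ ^ 2) := by gcongr
    _ ≤ _ := by
        have : 0 ≤ a * ‖ν‖ * t.re * ‖u 0‖ ^ 2 := by positivity
        linarith

end FormData

/-! ### Distributional equations on the line -/

section Distributions

variable {φ : ℝ → ℂ}

/-- A test function with vanishing integral is the derivative of a test function. -/
theorem IsTest.exists_primitive (h : IsTest univ φ) (h0 : ∫ x, φ x = 0) :
    ∃ η : ℝ → ℂ, IsTest univ η ∧ ∀ x, HasDerivAt η (φ x) x := by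
  obtain ⟨R, hR⟩ := (h.2.1.isCompact.isBounded).subset_ball 0
  have hsupp : ∀ x, φ x ≠ 0 → -R < x ∧ x < R := fun x hx => by
    have := hR (subset_tsupport _ hx)
    rw [Metric.mem_ball, dist_zero_right, Real.norm_eq_abs, abs_lt] at this
    exact this
  have hd : ∀ x, HasDerivAt (fun x => ∫ t in (-R)..x, φ t) (φ x) x := fun x =>
    intervalIntegral.integral_hasDerivAt_right (h.continuous.intervalIntegrable _ _)
      (h.continuous.stronglyMeasurableAtFilter _ _) h.continuous.continuousAt
  refine ⟨fun x => ∫ t in (-R)..x, φ t, ⟨?_, ?_, subset_univ _⟩, hd⟩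
  · rw [contDiff_infty_iff_deriv]
    refine ⟨fun x => (hd x).differentiableAt, ?_⟩
    rw [show _root_.deriv (fun x => ∫ t in (-R)..x, φ t) = φ from funext fun x => (hd x).deriv]
    exact h.1
  · refine HasCompactSupport.intro (isCompact_Icc (a := -R) (b := R)) fun x hx => ?_
    rw [mem_Icc, not_and_or, not_le, not_le] at hx
    rcases hx with hx | hx
    · rw [intervalIntegral.integral_congr (g := fun _ => (0 : ℂ)), intervalIntegral.integral_zero]
      intro t ht
      by_contra hne
      rw [uIcc_of_ge hx.le] at ht
      linarith [(hsupp t hne).1, ht.2]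
    · rw [← h0]
      refine intervalIntegral.integral_eq_integral_of_support_subset fun t ht => ?_
      exact ⟨(hsupp t ht).1, ((hsupp t ht).2.trans hx).le⟩

theorem exists_isTest_integral_eq_one : ∃ ρ : ℝ → ℂ, IsTest univ ρ ∧ ∫ x, ρ x = 1 := by
  let b : ContDiffBump (0 : ℝ) := ⟨1, 2, one_pos, one_lt_two⟩
  refine ⟨fun x => (b.normed volume x : ℂ), ⟨?_, ?_, subset_univ _⟩, ?_⟩
  · exact Complex.ofRealCLM.contDiff.comp b.contDiff_normed
  · exact b.hasCompactSupport_normed.comp_left (g := fun y : ℝ => (y : ℂ)) (by simp)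
  · rw [integral_complex_ofReal, b.integral_normed, Complex.ofReal_one]

theorem integrable_mul_test {m : ℝ → ℂ} (hm : LocallyIntegrable m) (h : IsTest univ φ) :
    Integrable (fun x => m x * φ x) := by
  have := hm.integrable_smul_left_of_hasCompactSupport h.continuous h.2.1
  exact this.congr (ae_of_all _ fun x => mul_comm _ _)

theorem ae_eq_zero_of_integral_test {m : ℝ → ℂ} (hm : LocallyIntegrable m)
    (h : ∀ φ : ℝ → ℂ, IsTest univ φ → ∫ x, m x * φ x = 0) : m =ᵐ[volume] 0 := by
  have key := isOpen_univ.ae_eq_zero_of_integral_contDiff_smul_eq_zero (μ := volume)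
    (hm.locallyIntegrableOn univ) (fun g hg hgs _ => by
      have := h (fun x => (g x : ℂ)) ⟨Complex.ofRealCLM.contDiff.comp hg,
        hgs.comp_left (g := fun y : ℝ => (y : ℂ)) (by simp), subset_univ _⟩
      rw [← this]
      exact integral_congr_ae (ae_of_all _ fun x => by
        simp only [Complex.real_smul]; ring))
  filter_upwards [key] with x hx using hx (mem_univ x)

/-- The du Bois-Reymond lemma: a distribution with vanishing derivative is constant. -/
theorem ae_eq_const_of_integral_deriv {m : ℝ → ℂ} (hm : LocallyIntegrable m)
    (h : ∀ φ : ℝ → ℂ, IsTest univ φ → ∫ x, m x * deriv φ x = 0) :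
    ∃ c : ℂ, m =ᵐ[volume] fun _ => c := by
  obtain ⟨ρ, hρ, hρ1⟩ := exists_isTest_integral_eq_one
  refine ⟨∫ x, m x * ρ x, ?_⟩
  set c := ∫ x, m x * ρ x
  have hc : LocallyIntegrable (fun x => m x - c) := hm.sub (locallyIntegrable_const c)
  have h0 := ae_eq_zero_of_integral_test hc fun φ hφ => by
    have t : IsTest univ (φ + (-∫ x, φ x) • ρ) := hφ.add (hρ.smul _)
    obtain ⟨η, hη, hd⟩ := t.exists_primitive (by
      simp only [Pi.add_apply, Pi.smul_apply, smul_eq_mul]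
      rw [integral_add hφ.integrable (hρ.integrable.const_mul _), integral_const_mul, hρ1]
      ring)
    have h1 := h η hη
    have e1 : ∀ x, m x * deriv η x = m x * φ x - (∫ x, φ x) * (m x * ρ x) := fun x => by
      rw [(hd x).deriv]; simp only [Pi.add_apply, Pi.smul_apply, smul_eq_mul]; ring
    simp only [e1] at h1
    rw [integral_sub (integrable_mul_test hm hφ) ((integrable_mul_test hm hρ).const_mul _),
      integral_const_mul] at h1
    simp only [sub_mul]
    rw [integral_sub (integrable_mul_test hm hφ) (hφ.integrable.const_mul _), integral_const_mul,
      ← h1]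
    ring
  filter_upwards [h0] with x hx
  exact sub_eq_zero.1 hx

/-- The function `exp (c x²)`. -/
def gexp (c : ℂ) (x : ℝ) : ℂ := Complex.exp (c * (x : ℂ) ^ 2)

theorem contDiff_gexp (c : ℂ) : ContDiff ℝ ∞ (gexp c) :=
  (contDiff_const.mul (contDiff_ofReal.pow 2)).cexp

theorem hasDerivAt_gexp (c : ℂ) (x : ℝ) : HasDerivAt (gexp c) (2 * c * x * gexp c x) x := by
  have hx : HasDerivAt (fun x : ℝ => (x : ℂ)) 1 x := Complex.ofRealCLM.hasDerivAt
  refine HasDerivAt.congr_deriv (((hx.pow 2).const_mul c).cexp) ?_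
  simp only [gexp, Pi.pow_apply]
  push_cast
  ring

theorem gexp_mul (c d : ℂ) (x : ℝ) : gexp c x * gexp d x = gexp (c + d) x := by
  rw [gexp, gexp, gexp, ← Complex.exp_add]; ring_nf

theorem gexp_zero (x : ℝ) : gexp 0 x = 1 := by simp [gexp]

theorem norm_gexp (c : ℂ) (x : ℝ) : ‖gexp c x‖ = Real.exp (c.re * x ^ 2) := by
  rw [gexp, Complex.norm_exp, ← Complex.ofReal_pow, Complex.re_mul_ofReal]

theorem gexp_ne_zero (c : ℂ) (x : ℝ) : gexp c x ≠ 0 := Complex.exp_ne_zero _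

theorem locallyIntegrable_mul {g : ℝ → ℂ} (hg : Continuous g) (u : L2R) :
    LocallyIntegrable (fun x => g x * u x) := by
  have hu : LocallyIntegrable (u : ℝ → ℂ) volume :=
    (Lp.memLp u).locallyIntegrable (by norm_num)
  have := (locallyIntegrableOn_univ.2 hu).continuousOn_smul
    isOpen_univ.isLocallyClosed hg.continuousOn
  exact locallyIntegrableOn_univ.1 this

/-- The solutions of `u' + β x u = 0`. -/
theorem ae_eq_gaussian_of_lowering {β : ℂ} {u : L2R}
    (h : ∀ φ : ℝ → ℂ, IsTest univ φ → ∫ x, u x * (-deriv φ x + β * x * φ x) = 0) :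
    ∃ c : ℂ, u =ᵐ[volume] fun x => c * gexp (-β / 2) x := by
  -- Integrating factor: testing with exp(βx²/2)η shows that exp(βx²/2)u has zero derivative.
  obtain ⟨c, hc⟩ := ae_eq_const_of_integral_deriv
    (locallyIntegrable_mul (contDiff_gexp (β / 2)).continuous u) fun η hη => by
      have t := hη.mul_left (contDiff_gexp (β / 2))
      have h1 := h _ t
      rw [← neg_eq_zero, ← integral_neg, ← h1]
      refine integral_congr_ae (ae_of_all _ fun x => ?_)
      have hd : deriv (fun x => gexp (β / 2) x * η x) x = _ :=
        ((hasDerivAt_gexp (β / 2) x).mul (hη.hasDerivAt x)).deriv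
      simp only
      rw [hd]
      ring
  refine ⟨c, ?_⟩
  filter_upwards [hc] with x hx
  rw [← hx, mul_right_comm, gexp_mul]
  rw [show β / 2 + -β / 2 = 0 by ring, gexp_zero, one_mul]

theorem false_of_norm_ge {u : L2R} {f : ℝ → ℂ} (hu : u =ᵐ[volume] f) {r : ℝ} (hr : 0 < r)
    {s : Set ℝ} (hs : volume s = (⊤ : ℝ≥0∞)) (h : ∀ x ∈ s, r ≤ ‖f x‖) : False := by
  have h1 : MemLp f 2 (volume : Measure ℝ) := (memLp_congr_ae hu).1 (Lp.memLp u)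
  have h2 := h1.meas_ge_lt_top (by norm_num) (by norm_num) (ε := ⟨r, hr.le⟩)
    (by exact fun e => hr.ne' (congrArg NNReal.toReal e))
  refine absurd (measure_mono_top (s₂ := {x | (⟨r, hr.le⟩ : NNReal) ≤ ‖f x‖₊}) ?_ hs) h2.ne
  exact fun x hx => h x hx

/-- The primitive of the Gaussian `exp (-β x²)`. -/
def erfPrimitive (β : ℂ) (x : ℝ) : ℂ := ∫ t in (0 : ℝ)..x, gexp (-β) t

theorem hasDerivAt_erfPrimitive (β : ℂ) (x : ℝ) :
    HasDerivAt (erfPrimitive β) (gexp (-β) x) x := by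
  have hc := (contDiff_gexp (-β)).continuous
  exact intervalIntegral.integral_hasDerivAt_right (hc.intervalIntegrable _ _)
      (hc.stronglyMeasurableAtFilter _ _) hc.continuousAt

theorem contDiff_erfPrimitive (β : ℂ) : ContDiff ℝ ∞ (erfPrimitive β) := by
  rw [contDiff_infty_iff_deriv]
  refine ⟨fun x => (hasDerivAt_erfPrimitive β x).differentiableAt, ?_⟩
  rw [show deriv (erfPrimitive β) = gexp (-β) from
    funext fun x => (hasDerivAt_erfPrimitive β x).deriv]
  exact contDiff_gexp _

theorem erfPrimitive_neg (β : ℂ) (x : ℝ) : erfPrimitive β (-x) = -erfPrimitive β x := by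
  have h := intervalIntegral.integral_comp_neg (a := 0) (b := x) (fun t => gexp (-β) t)
  have h2 : ∀ t : ℝ, gexp (-β) (-t) = gexp (-β) t := fun t => by simp [gexp]
  simp only [h2, neg_zero] at h
  rw [erfPrimitive, intervalIntegral.integral_symm, ← h, erfPrimitive]

theorem tendsto_erfPrimitive {β : ℂ} (hβ : 0 < β.re) :
    ∃ J : ℂ, J ≠ 0 ∧ Tendsto (erfPrimitive β) atTop (𝓝 J) := by
  refine ⟨∫ x in Ioi (0 : ℝ), gexp (-β) x, ?_, ?_⟩
  · have := integral_gaussian_complex_Ioi hβ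
    change ∫ x in Ioi (0 : ℝ), gexp (-β) x = _ at this
    rw [this]
    have hβ0 : β ≠ 0 := fun e => by rw [e] at hβ; simp at hβ
    refine div_ne_zero ?_ two_ne_zero
    rw [Complex.cpow_ne_zero_iff]
    exact Or.inl (div_ne_zero (by exact_mod_cast Real.pi_ne_zero) hβ0)
  · have hi : Integrable (gexp (-β)) := integrable_cexp_neg_mul_sq hβ
    exact intervalIntegral_tendsto_integral_Ioi 0 hi.integrableOn tendsto_id

/-- As exp(βx²/2) has modulus at least 1, square-integrability forces the limits C - cJ and C + cJ
of the other factor at +∞ and -∞ to vanish, and J ≠ 0. -/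
theorem growth_eq_zero {β C c : ℂ} (hβ : 0 < β.re) {u : L2R}
    (hu : u =ᵐ[volume] fun x => gexp (β / 2) x * (C - c * erfPrimitive β x)) :
    C = 0 ∧ c = 0 := by
  obtain ⟨J, hJ, hlim⟩ := tendsto_erfPrimitive hβ
  have hE : ∀ x, 1 ≤ ‖gexp (β / 2) x‖ := fun x => by
    rw [norm_gexp, Real.one_le_exp_iff]
    have : (β / 2).re = β.re / 2 := by simp
    rw [this]; positivity
  have hl1 : Tendsto (fun x => C - c * erfPrimitive β x) atTop (𝓝 (C - c * J)) :=
    tendsto_const_nhds.sub (hlim.const_mul c)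
  have hl2 : Tendsto (fun x => C - c * erfPrimitive β (-x)) atTop (𝓝 (C + c * J)) := by
    have := (hlim.const_mul c).const_add C
    refine this.congr fun x => ?_
    rw [erfPrimitive_neg]; ring
  have e1 : C - c * J = 0 := by
    by_contra hne
    have hpos := norm_pos_iff.2 hne
    obtain ⟨x₀, hx₀⟩ := eventually_atTop.1 (hl1.norm.eventually_const_lt
      (half_lt_self hpos))
    refine false_of_norm_ge hu (half_pos hpos) (s := Ici x₀) Real.volume_Ici fun x hx => ?_
    rw [norm_mul]
    nlinarith [hx₀ x hx, hE x, norm_nonneg (C - c * erfPrimitive β x)]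
  have e2 : C + c * J = 0 := by
    by_contra hne
    have hpos := norm_pos_iff.2 hne
    obtain ⟨x₀, hx₀⟩ := eventually_atTop.1 (hl2.norm.eventually_const_lt
      (half_lt_self hpos))
    refine false_of_norm_ge hu (half_pos hpos) (s := Iic (-x₀)) Real.volume_Iic fun x hx => ?_
    rw [norm_mul]
    have := hx₀ (-x) (by rw [mem_Iic] at hx; linarith)
    rw [neg_neg] at this
    nlinarith [hE x, norm_nonneg (C - c * erfPrimitive β x)]
  have e3 : C = 0 := by linear_combination (e1 + e2) / 2
  refine ⟨e3, ?_⟩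
  have e4 : c * J = 0 := by linear_combination (e2 - e1) / 2
  exact (mul_eq_zero.1 e4).resolve_right hJ

/-- The operator `-∂ₓ² + β² x² + β` is injective on `L²(ℝ)`, in the sense of distributions. -/
theorem eq_zero_of_oscillator {β : ℂ} (hβ : 0 < β.re) {u : L2R}
    (h : ∀ φ : ℝ → ℂ, IsTest univ φ → ∫ x, u x * (formalOsc β φ x + β * φ x) = 0) : u = 0 := by
  have hm := locallyIntegrable_mul (contDiff_gexp (-β / 2)).continuous u
  -- With m = exp(-βx²/2)u, the equation reads (exp(βx²)m')' = 0. Testing with exp(βx²/2)η, where η'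
  -- = exp(-βx²)ξ, removes one derivative. The integral condition is what makes η compactly
  -- supported.
  have key : ∀ ξ : ℝ → ℂ, IsTest univ ξ → ∫ x, gexp (-β) x * ξ x = 0 →
      ∫ x, gexp (-β / 2) x * u x * deriv ξ x = 0 := fun ξ hξ h0 => by
    obtain ⟨η, hη, hd⟩ := (hξ.mul_left (contDiff_gexp (-β))).exists_primitive h0
    have t := hη.mul_left (contDiff_gexp (β / 2))
    rw [← neg_eq_zero, ← integral_neg, ← h _ t]
    refine integral_congr_ae (ae_of_all _ fun x => ?_)
    have d1 : deriv (fun x => gexp (β / 2) x * η x) = fun x : ℝ =>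
        β * (x * (gexp (β / 2) x * η x)) + gexp (-β / 2) x * ξ x := by
      funext y
      refine (HasDerivAt.congr_deriv ((hasDerivAt_gexp (β / 2) y).mul (hd y)) ?_).deriv
      rw [← mul_assoc (gexp (β / 2) y), gexp_mul, show β / 2 + -β = -β / 2 by ring]
      ring
    have hx : HasDerivAt (fun x : ℝ => (x : ℂ)) 1 x := Complex.ofRealCLM.hasDerivAt
    have d2 : deriv (deriv (fun x => gexp (β / 2) x * η x)) x =
        β * (gexp (β / 2) x * η x + x * (β * (x * (gexp (β / 2) x * η x))
          + gexp (-β / 2) x * ξ x)) + (-β * x * gexp (-β / 2) x * ξ x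
          + gexp (-β / 2) x * deriv ξ x) := by
      have d0 : HasDerivAt (fun x => gexp (β / 2) x * η x)
          (β * (x * (gexp (β / 2) x * η x)) + gexp (-β / 2) x * ξ x) x := by
        have := t.hasDerivAt x
        rwa [d1] at this
      rw [d1]
      refine (HasDerivAt.congr_deriv (((hx.mul d0).const_mul β).add
        ((hasDerivAt_gexp (-β / 2) x).mul (hξ.hasDerivAt x))) ?_).deriv
      ring
    simp only [formalOsc]
    rw [d2]
    ring
  obtain ⟨ρ, hρ, hρ1⟩ := exists_isTest_integral_eq_one
  have hρ₀ := hρ.mul_left (contDiff_gexp β)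
  set ρ₀ : ℝ → ℂ := fun x => gexp β x * ρ x with hρ₀d
  have hρ₀1 : ∫ x, gexp (-β) x * ρ₀ x = 1 := by
    rw [← hρ1]
    refine integral_congr_ae (ae_of_all _ fun x => ?_)
    simp only [hρ₀d]
    rw [← mul_assoc, gexp_mul, neg_add_cancel, gexp_zero, one_mul]
  set c := ∫ x, gexp (-β / 2) x * u x * deriv ρ₀ x with hc
  have hM := contDiff_erfPrimitive β
  have hmM : LocallyIntegrable (fun x => gexp (-β / 2) x * u x + c * erfPrimitive β x) :=
    hm.add (continuous_const.mul hM.continuous).locallyIntegrable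
  -- A general ξ is corrected by a multiple of ρ₀, whose integral against exp(-βx²) is 1. The
  -- correction says m' = -c exp(-βx²), that is, m + c·erf is constant.
  obtain ⟨C, hC⟩ := ae_eq_const_of_integral_deriv hmM fun ξ hξ => by
    set k := ∫ x, gexp (-β) x * ξ x with hk
    have i1 := (hξ.mul_left (contDiff_gexp (-β))).integrable
    have i2 := (hρ₀.mul_left (contDiff_gexp (-β))).integrable
    have t : IsTest univ (ξ + (-k) • ρ₀) := hξ.add (hρ₀.smul _)
    have h1 := key _ t (by
      have : ∀ x, gexp (-β) x * (ξ + (-k) • ρ₀) x =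
          gexp (-β) x * ξ x + (-k) * (gexp (-β) x * ρ₀ x) := fun x => by
        simp only [Pi.add_apply, Pi.smul_apply, smul_eq_mul]; ring
      simp only [this]
      rw [integral_add i1 (i2.const_mul _), integral_const_mul, hρ₀1]
      ring)
    have j1 := integrable_mul_test hm hξ.deriv
    have j2 := integrable_mul_test hm hρ₀.deriv
    have e1 : ∀ x, gexp (-β / 2) x * u x * deriv (ξ + (-k) • ρ₀) x =
        gexp (-β / 2) x * u x * deriv ξ x +
          (-k) * (gexp (-β / 2) x * u x * deriv ρ₀ x) := fun x => by
      have : deriv (ξ + (-k) • ρ₀) x = deriv ξ x + (-k) • deriv ρ₀ x :=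
        ((hξ.hasDerivAt x).add ((hρ₀.hasDerivAt x).const_smul (-k))).deriv
      rw [this, smul_eq_mul]; ring
    simp only [e1] at h1
    rw [integral_add j1 (j2.const_mul _), integral_const_mul, ← hc] at h1
    have i3 := (hξ.deriv.mul_left hM).integrable
    have h2 : (∫ x, gexp (-β) x * ξ x) + ∫ x, erfPrimitive β x * deriv ξ x = 0 := by
      rw [← integral_add i1 i3]
      exact (hξ.mul_left hM).integral_eq_zero fun x =>
        (hasDerivAt_erfPrimitive β x).mul (hξ.hasDerivAt x)
    have e2 : ∀ x, (gexp (-β / 2) x * u x + c * erfPrimitive β x) * deriv ξ x =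
        gexp (-β / 2) x * u x * deriv ξ x + c * (erfPrimitive β x * deriv ξ x) := fun x => by ring
    simp only [e2]
    rw [integral_add j1 (i3.const_mul _), integral_const_mul]
    rw [← hk] at h2
    linear_combination h1 + c * h2
  have hu : u =ᵐ[volume] fun x => gexp (β / 2) x * (C - c * erfPrimitive β x) := by
    filter_upwards [hC] with x hx
    rw [← hx, add_sub_cancel_right, ← mul_assoc, gexp_mul, show β / 2 + -β / 2 = 0 by ring,
      gexp_zero, one_mul]
  obtain ⟨rfl, h2⟩ := growth_eq_zero hβ hu
  refine (Lp.eq_zero_iff_ae_eq_zero).2 ?_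
  filter_upwards [hu] with x hx
  rw [hx, h2]
  simp

end Distributions

/-- A criterion, in terms of the graph, for an operator to be the resolvent. -/
theorem isResolventAt_of_graph {H : Type*} [NormedAddCommGroup H] [NormedSpace ℂ H]
    {A : H →ₗ.[ℂ] H} {G : Submodule ℂ (H × H)} (hG : A.graph = G) {z : ℂ} {R : H →L[ℂ] H}
    (h1 : ∀ f, (R f, f + z • R f) ∈ G) (h2 : ∀ u g, (u, g) ∈ G → R (g - z • u) = u) :
    IsResolventAt A z R := by
  refine ⟨fun f => ?_, fun u => h2 _ _ (hG ▸ A.mem_graph u)⟩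
  have h := h1 f
  rw [← hG, LinearPMap.mem_graph_iff] at h
  obtain ⟨y, hy1, hy2⟩ := h
  have hm : R f ∈ A.domain := by
    rw [show R f = (y : H) from hy1.symm]
    exact y.2
  have hy : y = ⟨R f, hm⟩ := Subtype.ext hy1
  refine ⟨hm, ?_⟩
  rw [← hy, hy2, add_sub_cancel_right]

/-! ### The harmonic oscillator -/

/-- The embedding `f ↦ (c₀ f, c₁ f, c₂ f)`. -/
def embL (c₀ c₁ c₂ : ℂ) : L2R →L[ℂ] E3 :=
  ((PiLp.continuousLinearEquiv 2 ℂ (fun _ : Fin 3 => L2R)).symm : (Fin 3 → L2R) →L[ℂ] E3) ∘L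
    ContinuousLinearMap.pi ![c₀ • ContinuousLinearMap.id ℂ L2R, c₁ • ContinuousLinearMap.id ℂ L2R,
      c₂ • ContinuousLinearMap.id ℂ L2R]

/-- The map `u ↦ d₀ u₀ + d₁ u₁ + d₂ u₂`. -/
def outL (d₀ d₁ d₂ : ℂ) : E3 →L[ℂ] L2R :=
  d₀ • PiLp.proj (𝕜 := ℂ) 2 (fun _ : Fin 3 => L2R) 0 +
    d₁ • PiLp.proj (𝕜 := ℂ) 2 (fun _ : Fin 3 => L2R) 1 +
    d₂ • PiLp.proj (𝕜 := ℂ) 2 (fun _ : Fin 3 => L2R) 2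

theorem embL_apply (c₀ c₁ c₂ : ℂ) (f : L2R) :
    embL c₀ c₁ c₂ f = mk3 (c₀ • f) (c₁ • f) (c₂ • f) :=
  E3.ext rfl rfl rfl

theorem outL_apply (d₀ d₁ d₂ : ℂ) (u : E3) :
    outL d₀ d₁ d₂ u = d₀ • u 0 + d₁ • u 1 + d₂ • u 2 := rfl

theorem inner_embL (c₀ c₁ c₂ : ℂ) (v : E3) (f : L2R) :
    inner ℂ v (embL c₀ c₁ c₂ f) =
      c₀ * inner ℂ (v 0) f + c₁ * inner ℂ (v 1) f + c₂ * inner ℂ (v 2) f := by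
  rw [embL_apply, E3.inner_eq, mk3_zero, mk3_one, mk3_two, inner_smul_right, inner_smul_right,
    inner_smul_right]

/-- The variational solution of `-w'' + β² x² w + β t w = F`. -/
def oscSol (β t : ℂ) : E3 →L[ℂ] E3 := solveForm (formDomain univ) (formOp β (β * t) 1)

/-- The resolvent of the harmonic oscillator at `-β t`. -/
def oscRes (β t : ℂ) : L2R →L[ℂ] L2R := outL 1 0 0 ∘L oscSol β t ∘L embL 1 0 0

/-- The operator `(-∂ₓ + β x) (H_β + 3 β)⁻¹`. -/
def oscRaise (β : ℂ) : L2R →L[ℂ] L2R := outL 0 (-1) β ∘L oscSol β 3 ∘L embL 1 0 0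

/-- The operator `(H_β + β)⁻¹ (∂ₓ + β x)`. -/
def oscLower (β : ℂ) : L2R →L[ℂ] L2R := outL 1 0 0 ∘L oscSol β 1 ∘L embL 0 (-1) β

/-- The projection `(-∂ₓ + β x) (H_β + β)⁻¹ (∂ₓ + β x)`. -/
def oscRange (β : ℂ) : L2R →L[ℂ] L2R := outL 0 (-1) β ∘L oscSol β 1 ∘L embL 0 (-1) β

/-- The sectoriality conditions for `H_β`. -/
abbrev SectorData (β : ℂ) (κ : ℝ) : Prop := FormData β κ 1 1 1

namespace SectorData

theorem of_le {β : ℂ} {κ : ℝ} (h0 : 0 < ‖β‖) (hκ : 0 < κ) (h : κ * ‖β‖ ≤ β.re) :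
    SectorData β κ :=
  ⟨h0, hκ, h, one_pos, one_pos, fun _ _ => rfl, fun u => by simp⟩

variable {β t : ℂ} {κ : ℝ} (h : SectorData β κ)
include h

theorem coercive' (ht : 0 ≤ t.re) : ∃ m : ℝ, 0 < m ∧ ∀ u ∈ formDomain univ,
    m * ‖u‖ ^ 2 ≤ ‖inner ℂ u (formOp β (β * t) 1 u)‖ := by
  have := FormData.coercive h ht (Ω := univ)
  rwa [Complex.ofReal_one, one_mul] at this

theorem re_pos : 0 < β.re := lt_of_lt_of_le (mul_pos h.sector_pos h.norm_pos) h.sector_le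

theorem ne_zero : β ≠ 0 := norm_pos_iff.1 h.norm_pos

theorem le_one : κ ≤ 1 := by
  have := h.sector_le.trans (Complex.re_le_norm β)
  nlinarith [h.norm_pos]

theorem inner_oscSol (ht : 0 ≤ t.re) (F : E3) {v : E3} (hv : v ∈ formDomain univ) :
    β * t * inner ℂ (v 0) (oscSol β t F 0) + inner ℂ (v 1) (oscSol β t F 1) +
      β ^ 2 * inner ℂ (v 2) (oscSol β t F 2) = inner ℂ v F := by
  have := inner_solveForm (coercive' h ht) F hv
  rwa [inner_formOp] at this

theorem eq_oscSol (ht : 0 ≤ t.re) {u F : E3} (hu : u ∈ formDomain univ)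
    (hF : ∀ v ∈ formDomain univ, β * t * inner ℂ (v 0) (u 0) + inner ℂ (v 1) (u 1) +
      β ^ 2 * inner ℂ (v 2) (u 2) = inner ℂ v F) : u = oscSol β t F := by
  refine eq_solveForm (coercive' h ht) hu fun v hv => ?_
  rw [inner_formOp]
  exact hF v hv

omit h in
theorem oscSol_mem (β t : ℂ) (F : E3) : oscSol β t F ∈ formDomain univ := solveForm_mem F

-- Weak form of H_β + β = (∂ + βx)(-∂ + βx). Expanding the product leaves the cross terms between u'
-- and xu, which the commutation relation turns into the zero order term.
omit h in
theorem inner_factor {u v : E3} (hu : u ∈ formDomain univ) (hv : v ∈ formDomain univ) :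
    β * inner ℂ (v 0) (u 0) + inner ℂ (v 1) (u 1) + β ^ 2 * inner ℂ (v 2) (u 2) =
      inner ℂ v (embL 0 (-1) β (outL 0 (-1) β u)) := by
  have hc := formDomain_commutator hu hv
  rw [inner_embL, outL_apply]
  simp only [zero_smul, zero_add, inner_add_right, inner_smul_right]
  linear_combination β * hc

theorem eq_oscSol_factor {u : E3} (hu : u ∈ formDomain univ) :
    u = oscSol β 1 (embL 0 (-1) β (outL 0 (-1) β u)) := by
  refine eq_oscSol h (by simp) hu fun v hv => ?_
  rw [mul_one]
  exact inner_factor hu hv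

/-- Here (H_β + β)⁻¹ cancels the product (∂ + βx)(-∂ + βx) standing between the two resolvents. -/
theorem lower_comp_raise (f : L2R) : oscLower β (oscRaise β f) = oscRes β 3 f := by
  have := eq_oscSol_factor h (oscSol_mem β 3 (embL 1 0 0 f))
  simp only [oscLower, oscRaise, oscRes, ContinuousLinearMap.comp_apply]
  rw [← this]

theorem range_comp_raise (f : L2R) : oscRange β (oscRaise β f) = oscRaise β f := by
  have := eq_oscSol_factor h (oscSol_mem β 3 (embL 1 0 0 f))
  simp only [oscRange, oscRaise, ContinuousLinearMap.comp_apply]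
  rw [← this]

/-- Applying ∂ + βx to `oscRange β f` gives (∂ + βx)f by the factorization. The complement therefore
lies in the kernel of ∂ + βx, which consists of Gaussians. -/
theorem inner_compl_range (f : L2R) {v : E3} (hv : v ∈ formDomain univ) :
    inner ℂ v (embL 0 (-1) β (f - oscRange β f)) = 0 := by
  have h1 := inner_oscSol h (t := 1) (by simp) (embL 0 (-1) β f) hv
  rw [mul_one, inner_factor (oscSol_mem _ _ _) hv] at h1
  rw [map_sub, inner_sub_right, ← h1]
  simp only [oscRange, ContinuousLinearMap.comp_apply, sub_self]

end SectorData

/-! ### Ladder identities in the sense of distributions -/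

section Tests

variable {φ : ℝ → ℂ} {β t : ℂ} {κ : ℝ}

/-- The annihilation operator preserves test functions. -/
theorem IsTest.lower {Ω : Set ℝ} (hφ : IsTest Ω φ) (β : ℂ) :
    IsTest Ω (fun x => _root_.deriv φ x + β * (x * φ x)) :=
  hφ.deriv.add (hφ.id_mul.smul β)

theorem integral_mul_add {u : L2R} {f g : ℝ → ℂ} (hf : IsTest univ f) (hg : IsTest univ g) (c : ℂ) :
    ∫ x, u x * (f x + c * g x) = (∫ x, u x * f x) + c * ∫ x, u x * g x := by
  have hu : LocallyIntegrable (u : ℝ → ℂ) volume :=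
    (Lp.memLp u).locallyIntegrable (by norm_num)
  rw [← integral_const_mul, ← integral_add (integrable_mul_test hu hf)
    ((integrable_mul_test hu hg).const_mul c)]
  refine integral_congr_ae (ae_of_all _ fun x => ?_)
  ring

theorem integral_outL (hφ : IsTest univ φ) (d₀ d₁ d₂ : ℂ) (w : E3) :
    ∫ x, outL d₀ d₁ d₂ w x * φ x =
      d₀ * (∫ x, w 0 x * φ x) + d₁ * (∫ x, w 1 x * φ x) + d₂ * ∫ x, w 2 x * φ x := by
  rw [← hφ.inner_conj, ← hφ.inner_conj, ← hφ.inner_conj, ← hφ.inner_conj, outL_apply,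
    inner_add_right, inner_add_right, inner_smul_right, inner_smul_right, inner_smul_right]

theorem integral_raise {w : E3} (hw : w ∈ formDomain univ) (hφ : IsTest univ φ) :
    ∫ x, outL 0 (-1) β w x * φ x = ∫ x, w 0 x * (deriv φ x + β * (x * φ x)) := by
  rw [integral_outL hφ, integral_mul_add hφ.deriv hφ.id_mul, formDomain_deriv hw hφ,
    formDomain_id_mul hw hφ]
  ring

theorem integral_formalOsc {w : E3} (hw : w ∈ formDomain univ) (hφ : IsTest univ φ) (b : ℂ) :
    ∫ x, w 0 x * (formalOsc β φ x + b * φ x) =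
      b * (∫ x, w 0 x * φ x) + (∫ x, w 1 x * deriv φ x) + β ^ 2 * ∫ x, w 2 x * (x * φ x) := by
  have h1 := formDomain_deriv hw hφ.deriv
  have h2 := formDomain_id_mul hw hφ.id_mul
  have e : ∀ x, w 0 x * (formalOsc β φ x + b * φ x) =
      w 0 x * ((((-1 : ℂ) • deriv (deriv φ)) x + β ^ 2 * (x * (x * φ x))) + b * φ x) := fun x => by
    simp only [formalOsc, Pi.smul_apply, smul_eq_mul]
    ring
  simp only [e]
  have e2 : ∫ x, w 0 x * ((-1 : ℂ) • deriv (deriv φ)) x = - ∫ x, w 0 x * deriv (deriv φ) x := by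
    rw [← integral_neg]
    refine integral_congr_ae (ae_of_all _ fun x => ?_)
    simp only [Pi.smul_apply, smul_eq_mul]
    ring
  rw [integral_mul_add (f := fun x => ((-1 : ℂ) • deriv (deriv φ)) x + β ^ 2 * (x * (x * φ x)))
      ((hφ.deriv.deriv.smul (-1)).add (hφ.id_mul.id_mul.smul (β ^ 2))) hφ,
    integral_mul_add (hφ.deriv.deriv.smul (-1)) hφ.id_mul.id_mul, e2, h1, h2]
  ring

theorem SectorData.integral_oscSol (h : SectorData β κ) (ht : 0 ≤ t.re) (hφ : IsTest univ φ)
    (F : E3) : ∫ x, oscSol β t F 0 x * (formalOsc β φ x + β * t * φ x) =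
      (∫ x, F 0 x * φ x) + (∫ x, F 1 x * deriv φ x) + ∫ x, F 2 x * (x * φ x) := by
  rw [integral_formalOsc (oscSol_mem _ _ _) hφ, ← hφ.inner_triple,
    ← h.inner_oscSol ht F hφ.conj.triple_mem]
  have e : inner ℂ hφ.conj.triple (oscSol β t F) = inner ℂ (hφ.conj.triple 0) (oscSol β t F 0) +
    inner ℂ (hφ.conj.triple 1) (oscSol β t F 1) + inner ℂ (hφ.conj.triple 2) (oscSol β t F 2) :=
    E3.inner_eq _ _
  rw [← hφ.inner_conj, show inner ℂ hφ.conj.toL2 (oscSol β t F 0) =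
    inner ℂ (hφ.conj.triple 0) (oscSol β t F 0) from rfl]
  have e1 : ∫ x, oscSol β t F 1 x * deriv φ x = inner ℂ (hφ.conj.triple 1) (oscSol β t F 1) := by
    rw [IsTest.triple, mk3_one, inner_eq_integral hφ.conj.deriv.coeFn_toL2]
    refine integral_congr_ae (ae_of_all _ fun x => ?_)
    simp only
    rw [show deriv (fun x => star (φ x)) x = star (deriv φ x) from deriv.star .., star_star]
  have e2 : ∫ x, oscSol β t F 2 x * (x * φ x) = inner ℂ (hφ.conj.triple 2) (oscSol β t F 2) := by
    rw [IsTest.triple, mk3_two, inner_eq_integral hφ.conj.id_mul.coeFn_toL2]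
    refine integral_congr_ae (ae_of_all _ fun x => ?_)
    simp
  rw [e1, e2]

theorem integral_coeFn_smul (c : ℂ) (f : L2R) (φ : ℝ → ℂ) :
    ∫ x, (c • f : L2R) x * φ x = c * ∫ x, f x * φ x := by
  rw [← integral_const_mul]
  refine integral_congr_ae ((Lp.coeFn_smul c f).mono fun x hx => ?_)
  simp only [hx, Pi.smul_apply, smul_eq_mul]; ring

theorem SectorData.integral_oscRes (h : SectorData β κ) (ht : 0 ≤ t.re) (hφ : IsTest univ φ)
    (f : L2R) :
    ∫ x, oscRes β t f x * (formalOsc β φ x + β * t * φ x) = ∫ x, f x * φ x := by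
  have e : oscRes β t f = oscSol β t (embL 1 0 0 f) 0 := by
    simp only [oscRes, ContinuousLinearMap.comp_apply, outL_apply, one_smul, zero_smul, add_zero]
  rw [e, h.integral_oscSol ht hφ, embL_apply, mk3_zero, mk3_one, mk3_two]
  rw [integral_coeFn_smul, integral_coeFn_smul, integral_coeFn_smul]
  ring

/-- Transposed, this intertwining relation is why raising changes the shift: H_β + β applied after
-∂ + βx is -∂ + βx applied after H_β + 3β. -/
theorem lower_formalOsc (hφ : IsTest univ φ) (x : ℝ) :
    deriv (fun y => formalOsc β φ y + β * φ y) x + β * (x * (formalOsc β φ x + β * φ x)) =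
      formalOsc β (fun x => deriv φ x + β * (x * φ x)) x +
        β * 3 * (deriv φ x + β * (x * φ x)) := by
  have hx : ∀ x, HasDerivAt (fun x : ℝ => (x : ℂ)) 1 x := fun x => Complex.ofRealCLM.hasDerivAt
  have d0 := hφ.hasDerivAt
  have d1 := hφ.deriv.hasDerivAt
  have d2 := hφ.deriv.deriv.hasDerivAt
  have e1 : deriv (fun x => deriv φ x + β * (x * φ x)) =
      fun x => deriv (deriv φ) x + β * (φ x + x * deriv φ x) := by
    funext y
    refine (HasDerivAt.congr_deriv ((d1 y).add (((hx y).mul (d0 y)).const_mul β)) ?_).deriv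
    ring
  have e2 : deriv (fun x => deriv (deriv φ) x + β * (φ x + x * deriv φ x)) x =
      deriv (deriv (deriv φ)) x + β * (deriv φ x + (deriv φ x + x * deriv (deriv φ) x)) := by
    refine (HasDerivAt.congr_deriv ((d2 x).add (((d0 x).add ((hx x).mul (d1 x))).const_mul β))
      ?_).deriv
    ring
  have e3 : deriv (fun y => formalOsc β φ y + β * φ y) x =
      -deriv (deriv (deriv φ)) x + β ^ 2 * (2 * x * φ x + x ^ 2 * deriv φ x) + β * deriv φ x := by
    unfold formalOsc
    refine (HasDerivAt.congr_deriv (((d2 x).neg.add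
      ((((hx x).pow 2).const_mul (β ^ 2)).mul (d0 x))).add ((d0 x).const_mul β)) ?_).deriv
    simp only [Pi.pow_apply]
    push_cast
    ring
  rw [e3]
  simp only [formalOsc]
  rw [e1, e2]
  ring

/-- The other order of the factors shifts by -β instead of β. Hence the kernel of ∂ + βx is made of
eigenfunctions of H_β for β. -/
theorem raise_lower (hφ : IsTest univ φ) (x : ℝ) :
    -deriv (fun x => deriv φ x + β * (x * φ x)) x + β * x * (deriv φ x + β * (x * φ x)) =
      formalOsc β φ x + -β * φ x := by
  have hx : ∀ x, HasDerivAt (fun x : ℝ => (x : ℂ)) 1 x := fun x => Complex.ofRealCLM.hasDerivAt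
  have e1 : deriv (fun x => deriv φ x + β * (x * φ x)) x =
      deriv (deriv φ) x + β * (φ x + x * deriv φ x) := by
    refine (HasDerivAt.congr_deriv ((hφ.deriv.hasDerivAt x).add
      (((hx x).mul (hφ.hasDerivAt x)).const_mul β)) ?_).deriv
    ring
  rw [e1, formalOsc]
  ring

end Tests

theorem IsTest.formalOsc_add {φ : ℝ → ℂ} (hφ : IsTest univ φ) (β b : ℂ) :
    IsTest univ (fun x => formalOsc β φ x + b * φ x) := by
  have t := ((hφ.deriv.deriv.smul (-1)).add (hφ.id_mul.id_mul.smul (β ^ 2))).add (hφ.smul b)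
  convert t using 1
  funext x
  simp only [formalOsc, Pi.add_apply, Pi.smul_apply, smul_eq_mul]
  ring

/-- The Gaussian `exp (-β x² / 2)` is square-integrable. -/
theorem memLp_gexp {β : ℂ} (hβ : 0 < β.re) : MemLp (gexp (-β / 2)) 2 (volume : Measure ℝ) := by
  rw [memLp_two_iff_integrable_sq_norm (contDiff_gexp _).continuous.aestronglyMeasurable]
  refine (integrable_exp_neg_mul_sq hβ).congr (ae_of_all _ fun x => ?_)
  simp only [norm_gexp]
  rw [← Real.exp_nat_mul]
  congr 1
  have : (-β / 2).re = -β.re / 2 := by simp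
  rw [this]
  push_cast
  ring

/-! ### Ground state, uniform energy bounds and the simple model for H_β -/

namespace SectorData

variable {β t : ℂ} {κ : ℝ} (h : SectorData β κ)
include h

theorem integral_compl_range (f : L2R) {ψ : ℝ → ℂ} (hψ : IsTest univ ψ) :
    ∫ x, (f - oscRange β f) x * (-deriv ψ x + β * x * ψ x) = 0 := by
  have h1 := inner_compl_range h f hψ.conj.triple_mem
  rw [hψ.inner_triple, embL_apply, mk3_zero, mk3_one, mk3_two, integral_coeFn_smul,
    integral_coeFn_smul, integral_coeFn_smul] at h1
  have e : ∀ x, (f - oscRange β f) x * (-deriv ψ x + β * x * ψ x) =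
      (f - oscRange β f) x * (((-1 : ℂ) • deriv ψ) x + β * (x * ψ x)) := fun x => by
    simp only [Pi.smul_apply, smul_eq_mul]
    ring
  simp only [e]
  rw [integral_mul_add (hψ.deriv.smul (-1)) hψ.id_mul]
  rw [← h1, zero_mul, zero_add]
  congr 1
  rw [← integral_const_mul]
  refine integral_congr_ae (ae_of_all _ fun x => ?_)
  simp only [Pi.smul_apply, smul_eq_mul]
  ring

/-- Apply H_β + β to both sides as distributions. The product of ladder operators gives `oscRange β
f`, and the last term gives f - `oscRange β f`, since H_β + β is 2β on the Gaussians. Injectivity of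
H_β + β on L²(ℝ) concludes. -/
theorem oscRes_one_eq (f : L2R) :
    oscRes β 1 f = oscRaise β (oscLower β f) + (2 * β)⁻¹ • (f - oscRange β f) := by
  rw [← sub_eq_zero]
  refine eq_zero_of_oscillator h.re_pos fun φ hφ => ?_
  have T := hφ.formalOsc_add β β
  have hχ := hφ.lower β
  have a1 := h.integral_oscRes (t := 1) (by simp) hφ f
  rw [mul_one] at a1
  have a2 : ∫ x, oscRaise β (oscLower β f) x * (formalOsc β φ x + β * φ x) =
      ∫ x, oscRange β f x * φ x := by
    have b1 := integral_raise (β := β) (oscSol_mem β 3 (embL 1 0 0 (oscLower β f))) T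
    have b2 := h.integral_oscRes (t := 3) (by norm_num) hχ (oscLower β f)
    have b3 := integral_raise (β := β) (oscSol_mem β 1 (embL 0 (-1) β f)) hφ
    simp only [← lower_formalOsc hφ] at b2
    have e1 : oscRes β 3 (oscLower β f) = oscSol β 3 (embL 1 0 0 (oscLower β f)) 0 := by
      simp only [oscRes, ContinuousLinearMap.comp_apply, outL_apply, one_smul, zero_smul, add_zero]
    have e2 : oscLower β f = oscSol β 1 (embL 0 (-1) β f) 0 := by
      simp only [oscLower, ContinuousLinearMap.comp_apply, outL_apply, one_smul, zero_smul,
        add_zero]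
    rw [e1] at b2
    refine b1.trans (b2.trans (Eq.trans ?_ b3.symm))
    rw [e2]
  have a3 : ∫ x, (f - oscRange β f) x * (formalOsc β φ x + β * φ x) =
      2 * β * ∫ x, (f - oscRange β f) x * φ x := by
    have b1 := h.integral_compl_range f hχ
    simp only [raise_lower hφ] at b1
    rw [integral_mul_add (hφ.formalOsc_add β (-β) |> fun t => by
      convert t.add (hφ.smul β) using 1
      funext x
      simp only [Pi.add_apply, Pi.smul_apply, smul_eq_mul]
      ring) hφ]
    have e : ∀ x, (f - oscRange β f) x * (formalOsc β φ x + -β * φ x) =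
      (f - oscRange β f) x * (formalOsc β φ x + (-β) * φ x) := fun _ => rfl
    have b2 := integral_mul_add (u := f - oscRange β f) (hφ.formalOsc_add β 0) hφ (-β)
    simp only [zero_mul, add_zero] at b2
    rw [b1] at b2
    linear_combination -b2
  rw [← T.inner_conj] at a1 a2 a3 ⊢
  rw [← hφ.inner_conj] at a1 a2 a3
  rw [inner_sub_right, inner_add_right, inner_smul_right, a1, a2, a3, inner_sub_right]
  have := h.ne_zero
  field_simp
  ring

/-- The domain is the maximal one, so its elements are not known to lie in the form domain.
Uniqueness of L² distributional solutions, `eq_zero_of_oscillator`, is what gives the left inverse.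
-/
theorem isResolventAt_oscillator : IsResolventAt (oscillator β) (-β) (oscRes β 1) := by
  refine isResolventAt_of_graph (oscillator_graph β) (fun f φ hφ => ?_) fun u g hu => ?_
  · have a1 := h.integral_oscRes (t := 1) (by simp) hφ f
    rw [mul_one] at a1
    have b1 := integral_mul_add (u := oscRes β 1 f) (hφ.formalOsc_add β 0) hφ β
    simp only [zero_mul, add_zero] at b1
    rw [a1] at b1
    have b2 : ∫ x, (f + -β • oscRes β 1 f : L2R) x * φ x =
        (∫ x, f x * φ x) + -β * ∫ x, oscRes β 1 f x * φ x := by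
      rw [← hφ.inner_conj, ← hφ.inner_conj, ← hφ.inner_conj, inner_add_right, inner_smul_right]
    refine Eq.trans ?_ b2.symm
    linear_combination -b1
  · rw [← sub_eq_zero]
    refine eq_zero_of_oscillator h.re_pos fun φ hφ => ?_
    have T := hφ.formalOsc_add β β
    have a1 := h.integral_oscRes (t := 1) (by simp) hφ (g - -β • u)
    rw [mul_one] at a1
    have a2 := hu φ hφ
    have b1 := integral_mul_add (u := u) (hφ.formalOsc_add β 0) hφ β
    simp only [zero_mul, add_zero] at b1
    rw [show ∫ x, u x * formalOsc β φ x = ∫ x, g x * φ x from a2] at b1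
    rw [← T.inner_conj] at a1 b1 ⊢
    rw [← hφ.inner_conj] at a1 b1
    rw [inner_sub_right, a1, b1, ← hφ.inner_conj, inner_sub_right, inner_smul_right]
    ring

/-- The normalized Gaussian spans the range of `1 - oscRange β`. -/
theorem exists_gaussian : ∃ e : L2R, ‖e‖ = 1 ∧ oscLower β e = 0 ∧ oscRange β e = 0 ∧
    ∀ f, f - oscRange β f = (inner ℂ e (f - oscRange β f) : ℂ) • e := by
  have hm := memLp_gexp h.re_pos
  set G : L2R := hm.toLp _ with hG
  have hGc : G =ᵐ[volume] gexp (-β / 2) := hm.coeFn_toLp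
  have hG0 : G ≠ 0 := fun e => by
    have : ∀ᵐ x : ℝ, False := by
      filter_upwards [hGc, (Lp.eq_zero_iff_ae_eq_zero).1 e] with x h1 h2
      rw [h1] at h2
      exact gexp_ne_zero _ _ h2
    exact (this.exists).elim fun _ => id
  have hn : ‖G‖ ≠ 0 := norm_ne_zero_iff.2 hG0
  have hv : ∀ v ∈ formDomain univ, inner ℂ v (embL 0 (-1) β G) = 0 := fun v hv => by
    refine inner_eq_zero_of_test (fun φ hφ => ?_) hv
    rw [embL_apply, mk3_zero, mk3_one, mk3_two, integral_coeFn_smul, integral_coeFn_smul,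
      integral_coeFn_smul, zero_mul, zero_add]
    have e1 : ∀ (ψ : ℝ → ℂ), ∫ x, G x * ψ x = ∫ x, gexp (-β / 2) x * ψ x := fun ψ => by
      refine integral_congr_ae ?_
      filter_upwards [hGc] with x hx
      rw [hx]
    rw [e1, e1, ← integral_const_mul, ← integral_const_mul]
    have hc := (contDiff_gexp (-β / 2))
    rw [← integral_add (((hφ.deriv.mul_left hc).integrable).const_mul _)
      (((hφ.id_mul.mul_left hc).integrable).const_mul _), ← neg_eq_zero, ← integral_neg]
    refine (hφ.mul_left hc).integral_eq_zero fun x => ?_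
    refine HasDerivAt.congr_deriv ((hasDerivAt_gexp (-β / 2) x).mul (hφ.hasDerivAt x)) ?_
    ring
  have hsol : oscSol β 1 (embL 0 (-1) β G) = 0 := by
    symm
    refine eq_oscSol h (by simp) (Submodule.zero_mem _) fun v hv' => ?_
    rw [hv v hv']
    simp
  have hY : oscLower β G = 0 := by
    simp only [oscLower, ContinuousLinearMap.comp_apply, hsol, map_zero]
  have hZ : oscRange β G = 0 := by
    simp only [oscRange, ContinuousLinearMap.comp_apply, hsol, map_zero]
  refine ⟨((‖G‖⁻¹ : ℝ) : ℂ) • G, ?_, by rw [map_smul, hY, smul_zero],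
    by rw [map_smul, hZ, smul_zero], fun f => ?_⟩
  · rw [norm_smul, Complex.norm_real, norm_inv, norm_norm, inv_mul_cancel₀ hn]
  · obtain ⟨c, hc⟩ := ae_eq_gaussian_of_lowering fun φ hφ => h.integral_compl_range f hφ
    have e : f - oscRange β f = c • G := by
      refine Lp.ext ?_
      filter_upwards [hc, hGc, Lp.coeFn_smul c G] with x h1 h2 h3
      rw [h1, h3, Pi.smul_apply, h2, smul_eq_mul]
    rw [e, inner_smul_left, inner_smul_right, inner_self_eq_norm_sq_to_K, smul_smul]
    congr 1
    have : ((‖G‖ : ℝ) : ℂ) ≠ 0 := by exact_mod_cast hn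
    rw [Complex.conj_ofReal, Complex.ofReal_inv]
    change c = _ * (_ * ((‖G‖ : ℝ) : ℂ) ^ 2) * _
    field_simp

/-- The energy estimate. -/
theorem energy (ht : 0 ≤ t.re) (F : E3) :
    κ * (‖oscSol β t F 1‖ ^ 2 + ‖β‖ ^ 2 * ‖oscSol β t F 2‖ ^ 2) ≤ ‖inner ℂ (oscSol β t F) F‖ := by
  have h1 := FormData.energy_le h t (oscSol β t F)
  have h2 := inner_solveForm (coercive' h ht) F (oscSol_mem β t F)
  rw [Complex.ofReal_one, one_mul, one_mul] at h1
  rw [show inner ℂ (oscSol β t F) (formOp β (β * t) 1 (oscSol β t F)) = _ from h2] at h1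
  refine le_trans ?_ h1
  have : 0 ≤ ‖β‖ * t.re * ‖oscSol β t F 0‖ ^ 2 := by positivity
  rw [one_apply_eq_self]
  linarith

omit h in
theorem heisenberg (β t : ℂ) (F : E3) :
    ‖β‖ * ‖oscSol β t F 0‖ ^ 2 ≤ ‖oscSol β t F 1‖ ^ 2 + ‖β‖ ^ 2 * ‖oscSol β t F 2‖ ^ 2 := by
  have h1 := formDomain_heisenberg (oscSol_mem β t F)
  nlinarith [sq_nonneg (‖oscSol β t F 1‖ - ‖β‖ * ‖oscSol β t F 2‖), norm_nonneg β]

omit h in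
theorem norm_outL_sq_le (β : ℂ) (w : E3) :
    ‖outL 0 (-1) β w‖ ^ 2 ≤ 2 * (‖w 1‖ ^ 2 + ‖β‖ ^ 2 * ‖w 2‖ ^ 2) := by
  have h1 : ‖outL 0 (-1) β w‖ ≤ ‖w 1‖ + ‖β‖ * ‖w 2‖ := by
    rw [outL_apply, zero_smul, zero_add]
    refine (norm_add_le _ _).trans ?_
    rw [norm_smul, norm_smul, norm_neg, norm_one, one_mul]
  have h2 := norm_nonneg (outL 0 (-1) β w)
  nlinarith [sq_nonneg (‖w 1‖ - ‖β‖ * ‖w 2‖)]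

/-- The energy is at most the norm of u times that of f, divided by κ, while Heisenberg's inequality
bounds |β| times the squared norm of u by the energy. Combining them gives sizes |β|⁻¹ for u,
|β|^(-1/2) for u' and |β|^(-3/2) for xu. -/
theorem energy_res (ht : 0 ≤ t.re) (f : L2R) :
    κ * ‖β‖ * ‖oscSol β t (embL 1 0 0 f) 0‖ ≤ ‖f‖ ∧
      κ ^ 2 * ‖β‖ * (‖oscSol β t (embL 1 0 0 f) 1‖ ^ 2 +
        ‖β‖ ^ 2 * ‖oscSol β t (embL 1 0 0 f) 2‖ ^ 2) ≤ ‖f‖ ^ 2 := by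
  have h1 := h.energy ht (embL 1 0 0 f)
  have h2 := heisenberg β t (embL 1 0 0 f)
  have h3 : ‖inner ℂ (oscSol β t (embL 1 0 0 f)) (embL 1 0 0 f)‖ ≤
      ‖oscSol β t (embL 1 0 0 f) 0‖ * ‖f‖ := by
    rw [inner_embL, one_mul, zero_mul, zero_mul, add_zero, add_zero]
    exact norm_inner_le_norm _ _
  have hκ := h.sector_pos
  have hβ := h.norm_pos
  set w := oscSol β t (embL 1 0 0 f)
  set E := ‖w 1‖ ^ 2 + ‖β‖ ^ 2 * ‖w 2‖ ^ 2
  have h4 : κ * ‖β‖ * ‖w 0‖ ≤ ‖f‖ := by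
    rcases (norm_nonneg (w 0)).eq_or_lt with h0 | h0
    · rw [← h0, mul_zero]; exact norm_nonneg _
    · refine le_of_mul_le_mul_left ?_ h0
      calc ‖w 0‖ * (κ * ‖β‖ * ‖w 0‖) = κ * (‖β‖ * ‖w 0‖ ^ 2) := by ring
        _ ≤ κ * E := by gcongr
        _ ≤ _ := h1.trans h3
  refine ⟨h4, ?_⟩
  calc κ ^ 2 * ‖β‖ * E = κ * ‖β‖ * (κ * E) := by ring
    _ ≤ κ * ‖β‖ * (‖w 0‖ * ‖f‖) :=
        mul_le_mul_of_nonneg_left (h1.trans h3) (by positivity)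
    _ = (κ * ‖β‖ * ‖w 0‖) * ‖f‖ := by ring
    _ ≤ ‖f‖ * ‖f‖ := by gcongr
    _ = _ := by ring

theorem energy_lower (f : L2R) :
    κ ^ 2 * (‖oscSol β 1 (embL 0 (-1) β f) 1‖ ^ 2 +
        ‖β‖ ^ 2 * ‖oscSol β 1 (embL 0 (-1) β f) 2‖ ^ 2) ≤ 2 * ‖f‖ ^ 2 := by
  have h1 := h.energy (t := 1) (by simp) (embL 0 (-1) β f)
  set w := oscSol β 1 (embL 0 (-1) β f)
  have h3 : ‖inner ℂ w (embL 0 (-1) β f)‖ ≤ (‖w 1‖ + ‖β‖ * ‖w 2‖) * ‖f‖ := by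
    rw [inner_embL, zero_mul, zero_add]
    refine (norm_add_le _ _).trans ?_
    rw [norm_mul, norm_mul, norm_neg, norm_one, one_mul, add_mul, mul_assoc]
    gcongr <;> exact norm_inner_le_norm _ _
  have hκ := h.sector_pos
  have hβ := h.norm_pos
  set E := ‖w 1‖ ^ 2 + ‖β‖ ^ 2 * ‖w 2‖ ^ 2 with hE
  have hE0 : 0 ≤ E := by positivity
  have h5 : (‖w 1‖ + ‖β‖ * ‖w 2‖) ^ 2 ≤ 2 * E := by
    rw [hE]; nlinarith [sq_nonneg (‖w 1‖ - ‖β‖ * ‖w 2‖)]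
  have h6 : (κ * E) ^ 2 ≤ ((‖w 1‖ + ‖β‖ * ‖w 2‖) * ‖f‖) ^ 2 := by
    have := h1.trans h3
    gcongr
  rcases hE0.eq_or_lt with h0 | h0
  · rw [← h0, mul_zero]; positivity
  · refine le_of_mul_le_mul_left ?_ h0
    calc E * (κ ^ 2 * E) = (κ * E) ^ 2 := by ring
      _ ≤ _ := h6
      _ = (‖w 1‖ + ‖β‖ * ‖w 2‖) ^ 2 * ‖f‖ ^ 2 := by ring
      _ ≤ 2 * E * ‖f‖ ^ 2 := by gcongr
      _ = _ := by ring

theorem norm_oscRes_le (ht : 0 ≤ t.re) : ‖oscRes β t‖ ≤ 1 / (κ * ‖β‖) := by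
  have hκ := h.sector_pos
  have hβ := h.norm_pos
  refine ContinuousLinearMap.opNorm_le_bound _ (by positivity) fun f => ?_
  have := (h.energy_res ht f).1
  rw [div_mul_eq_mul_div, one_mul, le_div_iff₀ (by positivity), mul_comm]
  simpa only [oscRes, ContinuousLinearMap.comp_apply, outL_apply, one_smul, zero_smul,
    add_zero] using this

omit h in
theorem opNorm_le_sqrt {A : L2R →L[ℂ] L2R} {K : ℝ} (hK : 0 ≤ K)
    (hA : ∀ f, ‖A f‖ ^ 2 ≤ K * ‖f‖ ^ 2) : ‖A‖ ≤ √K := by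
  refine ContinuousLinearMap.opNorm_le_bound _ (Real.sqrt_nonneg _) fun f => ?_
  refine abs_le_of_sq_le_sq' ?_ (by positivity) |>.2
  rw [mul_pow, Real.sq_sqrt hK]
  exact hA f

theorem norm_oscRaise_le : ‖oscRaise β‖ ≤ √(2 / (κ ^ 2 * ‖β‖)) := by
  have hκ := h.sector_pos
  have hβ := h.norm_pos
  refine opNorm_le_sqrt (by positivity) fun f => ?_
  have := (h.energy_res (t := 3) (by norm_num) f).2
  have h2 := norm_outL_sq_le β (oscSol β 3 (embL 1 0 0 f))
  rw [div_mul_eq_mul_div, le_div_iff₀ (by positivity)]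
  simp only [oscRaise, ContinuousLinearMap.comp_apply]
  nlinarith [mul_pos (pow_pos hκ 2) hβ]

theorem norm_oscLower_le : ‖oscLower β‖ ≤ √(2 / (κ ^ 2 * ‖β‖)) := by
  have hκ := h.sector_pos
  have hβ := h.norm_pos
  refine opNorm_le_sqrt (by positivity) fun f => ?_
  have h1 := h.energy_lower f
  have h2 := heisenberg β 1 (embL 0 (-1) β f)
  rw [div_mul_eq_mul_div, le_div_iff₀ (by positivity)]
  simp only [oscLower, ContinuousLinearMap.comp_apply, outL_apply, one_smul, zero_smul,
    add_zero]
  nlinarith [pow_pos hκ 2]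

theorem norm_oscRange_le : ‖oscRange β‖ ≤ 2 / κ := by
  have hκ := h.sector_pos
  have e : 2 / κ = √(4 / κ ^ 2) := by
    rw [show 4 / κ ^ 2 = (2 / κ) ^ 2 by ring, Real.sqrt_sq (by positivity)]
  rw [e]
  refine opNorm_le_sqrt (by positivity) fun f => ?_
  have h1 := h.energy_lower f
  have h2 := norm_outL_sq_le β (oscSol β 1 (embL 0 (-1) β f))
  rw [div_mul_eq_mul_div, le_div_iff₀ (by positivity)]
  simp only [oscRange, ContinuousLinearMap.comp_apply]
  nlinarith [pow_pos hκ 2]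

/-- Each factor is of size |β|^(-1/2). The reduced part 2βXY is therefore bounded uniformly in β. -/
theorem norm_raise_mul_lower : ‖oscRaise β‖ * ‖oscLower β‖ ≤ 2 / (κ ^ 2 * ‖β‖) := by
  have hκ := h.sector_pos
  have hβ := h.norm_pos
  refine (mul_le_mul h.norm_oscRaise_le h.norm_oscLower_le (norm_nonneg _)
    (Real.sqrt_nonneg _)).trans ?_
  rw [Real.mul_self_sqrt (by positivity)]

/-- The resolvent identity. -/
theorem oscRes_resolvent (ht : 0 ≤ t.re) (f : L2R) :
    oscRes β t f - oscRes β 3 f = (β * (3 - t)) • oscRes β 3 (oscRes β t f) ∧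
    oscRes β t f - oscRes β 3 f = (β * (3 - t)) • oscRes β t (oscRes β 3 f) := by
  -- The variational solution with shift s also solves the problem with shift r, for the right-hand
  -- side f - β(s - r)u. Both identities follow by exchanging the roles of t and 3.
  have aux : ∀ {s r : ℂ}, 0 ≤ s.re → 0 ≤ r.re → ∀ f,
      oscRes β r (f - (β * (s - r)) • oscRes β s f) = oscRes β s f := fun {s r} hs hr f => by
    have e : ∀ (t : ℂ) f, oscRes β t f = oscSol β t (embL 1 0 0 f) 0 := fun t f => by
      simp only [oscRes, ContinuousLinearMap.comp_apply, outL_apply, one_smul, zero_smul, add_zero]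
    rw [e r, e s]
    refine congrArg (fun u : E3 => u 0) ?_
    symm
    refine eq_oscSol h hr (oscSol_mem _ _ _) fun v hv => ?_
    have h1 := inner_oscSol h hs (embL 1 0 0 f) hv
    simp only [inner_embL, inner_sub_right, inner_smul_right] at h1 ⊢
    linear_combination h1
  have h3 : (0 : ℝ) ≤ (3 : ℂ).re := by norm_num
  constructor
  · have := aux ht h3 f
    rw [map_sub, map_smul] at this
    linear_combination (norm := module) (-1 : ℂ) • this
  · have := aux h3 ht f
    rw [map_sub, map_smul] at this
    linear_combination (norm := module) (1 : ℂ) • this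

/-- The resolvent of the harmonic oscillator is, up to the factor `2 β`, the sum of the spectral
projection on the ground state and of an operator for which `1` is far from the spectrum. -/
theorem exists_simpleModel : ∃ (φ : L2R) (ψ : L2R →L[ℂ] ℂ),
    SimpleModel ((2 * β) • (oscRaise β ∘L oscLower β)) φ ψ (25 / κ ^ 3) ∧
      ∀ f, (2 * β) • oscRes β 1 f =
        ((2 * β) • (oscRaise β ∘L oscLower β) + ψ.smulRight φ) f := by
  have hκ := h.sector_pos
  have hκ1 := h.le_one
  have hβ := h.norm_pos
  have k1 : 1 ≤ 1 / κ := by rw [le_div_iff₀ hκ]; linarith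
  have kE : 25 / κ ^ 3 = 25 * (1 / κ) ^ 3 := by ring
  have kE2 : 2 / (κ ^ 2 * ‖β‖) = 2 * (1 / κ) ^ 2 / ‖β‖ := by field_simp
  have k2 : (1 / κ) ≤ (1 / κ) ^ 3 := le_self_pow₀ k1 (by norm_num)
  have k3 : (1 / κ) ^ 2 ≤ (1 / κ) ^ 3 := pow_le_pow_right₀ k1 (by norm_num)
  obtain ⟨e, he1, he2, he3, he4⟩ := h.exists_gaussian
  have hXY := h.norm_raise_mul_lower
  rw [kE2] at hXY
  have hR := h.norm_oscRange_le
  rw [show 2 / κ = 2 * (1 / κ) by ring] at hR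
  have hT : ∀ t : ℂ, 0 ≤ t.re → ‖oscRes β t‖ ≤ (1 / κ) / ‖β‖ := fun t ht => by
    refine (h.norm_oscRes_le ht).trans (le_of_eq ?_)
    field_simp
  set k := 1 / κ
  -- The functional must kill the range of `oscRaise β`. The plain inner product with e does not
  -- when β is not real: the spectral projection is oblique.
  refine ⟨e, (innerSL ℂ e) ∘L (1 - oscRange β), ⟨?_, he1.le, ?_, ?_, ?_, fun x => ?_, ?_,
    fun σ hσ => ?_⟩, fun f => ?_⟩
  · rw [kE]; nlinarith
  · refine (ContinuousLinearMap.opNorm_comp_le _ _).trans ?_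
    rw [innerSL_apply_norm, he1, one_mul, kE]
    refine (norm_sub_le _ _).trans ?_
    have := ContinuousLinearMap.norm_id_le (𝕜 := ℂ) (E := L2R)
    have h1 : ‖(1 : L2R →L[ℂ] L2R)‖ ≤ 1 := this
    nlinarith
  · rw [norm_smul, norm_mul, kE]
    have h1 := ContinuousLinearMap.opNorm_comp_le (oscRaise β) (oscLower β)
    have h2 : ‖(2 : ℂ)‖ = 2 := by simp
    rw [h2]
    calc 2 * ‖β‖ * ‖oscRaise β ∘L oscLower β‖ ≤ 2 * ‖β‖ * (2 * k ^ 2 / ‖β‖) := by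
          gcongr; exact h1.trans hXY
      _ = 4 * k ^ 2 := by field_simp; norm_num
      _ ≤ _ := by nlinarith
  · simp [he2]
  · simp only [smul_apply, ContinuousLinearMap.comp_apply, map_smul, sub_apply,
      one_apply_eq_self, h.range_comp_raise, sub_self, map_zero, smul_zero]
  · simp only [ContinuousLinearMap.comp_apply, sub_apply, one_apply_eq_self, he3, sub_zero]
    change inner ℂ e e = (1 : ℂ)
    rw [inner_self_eq_norm_sq_to_K, he1]
    simp
  -- With s = 2βσ, one has H_β + 3β - s = H_β + βt. The condition |σ - 1| ≤ 1/2 gives Re t ≥ 0, the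
  -- range of validity of the energy estimate.
  · set t : ℂ := 3 - 2 * σ with ht
    have ht0 : 0 ≤ t.re := by
      have h1 := (abs_le.1 ((Complex.abs_re_le_norm (σ - 1)).trans hσ)).2
      simp [ht] at h1 ⊢
      linarith
    have hσn : ‖σ‖ ≤ 3 / 2 := by
      calc ‖σ‖ = ‖(σ - 1) + 1‖ := by rw [sub_add_cancel]
        _ ≤ ‖σ - 1‖ + ‖(1 : ℂ)‖ := norm_add_le _ _
        _ ≤ 3 / 2 := by rw [norm_one]; linarith
    set s : ℂ := 2 * β * σ with hs
    have hsn : ‖s‖ ≤ 3 * ‖β‖ := by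
      rw [hs, norm_mul, norm_mul]
      have h2 : ‖(2 : ℂ)‖ = 2 := by simp
      rw [h2]
      nlinarith
    have hr := h.oscRes_resolvent ht0
    have est : β * (3 - t) = s := by rw [ht, hs]; ring
    rw [est] at hr
    have hss : σ • (2 * β) • (oscRaise β ∘L oscLower β) = s • (oscRaise β ∘L oscLower β) := by
      rw [smul_smul, hs]; congr 1; ring
    rw [hss]
    -- This is (1 - sXY)⁻¹ = 1 + sX(1 - sYX)⁻¹Y, where YX = (H_β + 3β)⁻¹ and hence (1 - sYX)⁻¹ = 1 +
    -- s(H_β + βt)⁻¹.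
    refine ⟨1 + s • (oscRaise β ∘L (1 + s • oscRes β t) ∘L oscLower β), ?_, ?_, ?_⟩
    · ext1 f
      have h1 := (hr (oscLower β f)).1
      have h2 : oscRes β t (oscLower β f) = oscRes β 3 (oscLower β f) +
        s • oscRes β 3 (oscRes β t (oscLower β f)) := by rw [← h1]; abel
      simp only [mul_apply_eq_comp, sub_apply, add_apply, smul_apply, one_apply_eq_self,
        ContinuousLinearMap.comp_apply, map_add, map_smul, h.lower_comp_raise]
      have h3 := congrArg (oscRaise β) h2
      rw [map_add, map_smul] at h3
      rw [h3]
      module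
    · ext1 f
      have h1 := (hr (oscLower β f)).2
      simp only [mul_apply_eq_comp, sub_apply, add_apply, smul_apply, one_apply_eq_self,
        ContinuousLinearMap.comp_apply, map_add, map_sub, map_smul, h.lower_comp_raise]
      have h3 := congrArg (oscRaise β) h1
      rw [map_sub, map_smul] at h3
      rw [← sub_eq_zero] at h3 ⊢
      linear_combination (norm := module) (s ^ 2) • h3
    · have h1 : ‖(1 : L2R →L[ℂ] L2R)‖ ≤ 1 := ContinuousLinearMap.norm_id_le
      have h2 : ‖1 + s • oscRes β t‖ ≤ 1 + 3 * k := by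
        refine (norm_add_le _ _).trans ?_
        rw [norm_smul]
        have : ‖s‖ * ‖oscRes β t‖ ≤ 3 * ‖β‖ * (k / ‖β‖) :=
          mul_le_mul hsn (hT t ht0) (norm_nonneg _) (by positivity)
        have e : 3 * ‖β‖ * (k / ‖β‖) = 3 * k := by field_simp
        linarith
      have h3 : ‖oscRaise β ∘L (1 + s • oscRes β t) ∘L oscLower β‖ ≤
          2 * k ^ 2 / ‖β‖ * (1 + 3 * k) := by
        calc _ ≤ ‖oscRaise β‖ * (‖1 + s • oscRes β t‖ * ‖oscLower β‖) :=
              (ContinuousLinearMap.opNorm_comp_le _ _).trans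
                (mul_le_mul_of_nonneg_left (ContinuousLinearMap.opNorm_comp_le _ _)
                  (norm_nonneg _))
          _ = (‖oscRaise β‖ * ‖oscLower β‖) * ‖1 + s • oscRes β t‖ := by ring
          _ ≤ _ := mul_le_mul hXY h2 (norm_nonneg _) (by positivity)
      refine (norm_add_le _ _).trans ?_
      rw [norm_smul]
      have h4 : ‖s‖ * ‖oscRaise β ∘L (1 + s • oscRes β t) ∘L oscLower β‖ ≤
          3 * ‖β‖ * (2 * k ^ 2 / ‖β‖ * (1 + 3 * k)) :=
        mul_le_mul hsn h3 (norm_nonneg _) (by positivity)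
      -- Adding the norm of the identity gives 1 + 6k² + 18k³ ≤ 25k³, as k ≥ 1: the origin of the
      -- constant 25/κ³.
      have e : 3 * ‖β‖ * (2 * k ^ 2 / ‖β‖ * (1 + 3 * k)) = 6 * k ^ 2 + 18 * k ^ 3 := by
        field_simp; ring
      rw [kE]
      nlinarith
  · rw [h.oscRes_one_eq]
    simp only [add_apply, smul_apply, ContinuousLinearMap.comp_apply,
      ContinuousLinearMap.smulRight_apply, sub_apply, one_apply_eq_self]
    rw [smul_add, smul_smul, mul_inv_cancel₀ (mul_ne_zero two_ne_zero h.ne_zero), one_smul]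
    congr 1
    exact he4 f

end SectorData

/-! ### Extension and restriction -/

section Extension

variable {L₁ L₂ : ℝ}

theorem restrict_coeFn (u : L2R) :
    restrict L₁ L₂ u =ᵐ[volume.restrict (interval L₁ L₂)] u :=
  LpToLpRestrictCLM_coeFn ℂ (interval L₁ L₂) u

theorem restrict_extendZero (u : L2 (interval L₁ L₂)) :
    restrict L₁ L₂ (extendZero L₁ L₂ u) = u := by
  refine Lp.ext ?_
  filter_upwards [restrict_coeFn (L₁ := L₁) (L₂ := L₂) (extendZero L₁ L₂ u),
    ae_restrict_of_ae (extendZero_coeFn L₁ L₂ u),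
    ae_restrict_mem (s := interval L₁ L₂) measurableSet_Ioo] with x h1 h2 h3
  rw [h1, h2, indicator_of_mem h3]

theorem norm_extendZero_le : ‖extendZero L₁ L₂‖ ≤ 1 :=
  LinearMap.mkContinuous_norm_le _ zero_le_one _

theorem norm_restrict_le : ‖restrict L₁ L₂‖ ≤ 1 := by
  refine ContinuousLinearMap.opNorm_le_bound _ zero_le_one fun u => ?_
  rw [one_mul]
  exact norm_Lp_toLp_restrict_le _ _

theorem extendZero_restrict_coeFn (u : L2R) :
    extendZero L₁ L₂ (restrict L₁ L₂ u) =ᵐ[volume] (interval L₁ L₂).indicator u := by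
  filter_upwards [extendZero_coeFn L₁ L₂ (restrict L₁ L₂ u),
    (ae_restrict_iff' (s := interval L₁ L₂) measurableSet_Ioo).1 (restrict_coeFn u)] with x h1 h2
  rw [h1]
  by_cases hx : x ∈ interval L₁ L₂
  · rw [indicator_of_mem hx, indicator_of_mem hx, h2 hx]
  · rw [indicator_of_notMem hx, indicator_of_notMem hx]

theorem inner_extendZero_restrict (u f : L2R) :
    inner ℂ u (extendZero L₁ L₂ (restrict L₁ L₂ f)) =
      inner ℂ (extendZero L₁ L₂ (restrict L₁ L₂ u)) f := by
  rw [L2.inner_def, L2.inner_def]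
  refine integral_congr_ae ?_
  filter_upwards [extendZero_restrict_coeFn (L₁ := L₁) (L₂ := L₂) u,
    extendZero_restrict_coeFn (L₁ := L₁) (L₂ := L₂) f] with x h1 h2
  rw [h1, h2]
  by_cases hx : x ∈ interval L₁ L₂
  · rw [indicator_of_mem hx, indicator_of_mem hx]
  · rw [indicator_of_notMem hx, indicator_of_notMem hx, inner_zero_left, inner_zero_right]

theorem integral_extendZero (u : L2 (interval L₁ L₂)) (φ : ℝ → ℂ) :
    ∫ x, extendZero L₁ L₂ u x * φ x = ∫ x in interval L₁ L₂, u x * φ x := by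
  rw [← integral_indicator (s := interval L₁ L₂) measurableSet_Ioo]
  refine integral_congr_ae ?_
  filter_upwards [extendZero_coeFn L₁ L₂ u] with x h1
  rw [h1]
  by_cases hx : x ∈ interval L₁ L₂
  · rw [indicator_of_mem hx, indicator_of_mem hx]
  · rw [indicator_of_notMem hx, indicator_of_notMem hx, zero_mul]

theorem IsTest.eq_zero_of_notMem {Ω : Set ℝ} {φ : ℝ → ℂ} (hφ : IsTest Ω φ) {x : ℝ} (hx : x ∉ Ω) :
    φ x = 0 :=
  image_eq_zero_of_notMem_tsupport fun h => hx (hφ.2.2 h)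

theorem integral_restrict (u : L2R) {φ : ℝ → ℂ} (hφ : IsTest (interval L₁ L₂) φ) :
    ∫ x in interval L₁ L₂, restrict L₁ L₂ u x * φ x = ∫ x, u x * φ x := by
  rw [← setIntegral_eq_integral_of_forall_compl_eq_zero (s := interval L₁ L₂) (E := ℂ)
    (f := fun x => u x * φ x) (fun x hx => by rw [hφ.eq_zero_of_notMem hx, mul_zero])]
  refine integral_congr_ae ?_
  filter_upwards [restrict_coeFn (L₁ := L₁) (L₂ := L₂) u] with x hx
  rw [hx]

theorem extendZero_restrict_toL2 {φ : ℝ → ℂ} (hφ : IsTest (interval L₁ L₂) φ) :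
    extendZero L₁ L₂ (restrict L₁ L₂ hφ.toL2) = hφ.toL2 := by
  refine Lp.ext ?_
  filter_upwards [extendZero_restrict_coeFn (L₁ := L₁) (L₂ := L₂) hφ.toL2, hφ.coeFn_toL2]
    with x h1 h2
  rw [h1]
  by_cases hx : x ∈ interval L₁ L₂
  · rw [indicator_of_mem hx]
  · rw [indicator_of_notMem hx, h2, hφ.eq_zero_of_notMem hx]

theorem formDomain_extendZero_restrict {u : E3} (hu : u ∈ formDomain (interval L₁ L₂)) :
    extendZero L₁ L₂ (restrict L₁ L₂ (u 0)) = u 0 :=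
  formDomain_induction (p := fun u => extendZero L₁ L₂ (restrict L₁ L₂ (u 0)) = u 0)
    (isClosed_eq (((extendZero L₁ L₂).continuous.comp (restrict L₁ L₂).continuous).comp
      (E3.continuous_apply 0)) (E3.continuous_apply 0))
    (fun _ h => extendZero_restrict_toL2 h) hu

theorem formDomain_coeFn_two {Ω : Set ℝ} {u : E3} (hu : u ∈ formDomain Ω) :
    u 2 =ᵐ[volume] fun x : ℝ => (x : ℂ) * u 0 x := by
  have hl : LocallyIntegrable (u 2 : ℝ → ℂ) volume :=
    (Lp.memLp (u 2)).locallyIntegrable (by norm_num)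
  have hl0 : LocallyIntegrable (fun x : ℝ => (x : ℂ) * u 0 x) volume :=
    locallyIntegrable_mul contDiff_ofReal.continuous (u 0)
  have := ae_eq_zero_of_integral_test (hl.sub hl0) fun φ hφ => by
    have h1 := formDomain_id_mul hu hφ
    simp only [Pi.sub_apply, sub_mul]
    rw [integral_sub (integrable_mul_test hl hφ) (integrable_mul_test hl0 hφ), h1, sub_eq_zero]
    refine integral_congr_ae (ae_of_all _ fun x => ?_)
    ring
  filter_upwards [this] with x hx
  exact sub_eq_zero.1 hx

theorem memLp_indicator_id (L₁ L₂ : ℝ) :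
    MemLp ((interval L₁ L₂).indicator fun x : ℝ => (x : ℂ)) ∞ (volume : Measure ℝ) := by
  refine memLp_top_of_bound (contDiff_ofReal.continuous.aestronglyMeasurable.indicator
    measurableSet_Ioo) (|L₁| + |L₂|) (ae_of_all _ fun x => ?_)
  by_cases hx : x ∈ interval L₁ L₂
  · rw [indicator_of_mem hx, Complex.norm_real, Real.norm_eq_abs, abs_le]
    have := abs_nonneg L₁
    have := abs_nonneg L₂
    constructor
    · linarith [hx.1, le_abs_self L₁]
    · linarith [hx.2, le_abs_self L₂]
  · rw [indicator_of_notMem hx, norm_zero]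
    positivity

/-- The operator of multiplication by `x` on `I`. -/
def mulId (L₁ L₂ : ℝ) : L2R →L[ℂ] L2R := mulOp _ (memLp_indicator_id L₁ L₂)

theorem coeFn_mulId (f : L2R) : mulId L₁ L₂ f =ᵐ[volume]
    fun x => (interval L₁ L₂).indicator (fun x : ℝ => (x : ℂ)) x * f x := coeFn_mulOp _ f

theorem integral_mulId (f : L2R) {φ : ℝ → ℂ} (hφ : IsTest (interval L₁ L₂) φ) :
    ∫ x, mulId L₁ L₂ f x * φ x = ∫ x, f x * (x * φ x) := by
  refine integral_congr_ae ?_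
  filter_upwards [coeFn_mulId (L₁ := L₁) (L₂ := L₂) f] with x hx
  rw [hx]
  by_cases hm : x ∈ interval L₁ L₂
  · rw [indicator_of_mem hm]; ring
  · rw [hφ.eq_zero_of_notMem hm]; ring

/-- Restriction of the form domain to `H¹₀`. -/
theorem restrict_mem_H10 {u : E3} (hu : u ∈ formDomain (interval L₁ L₂)) :
    (restrict L₁ L₂ (u 0), restrict L₁ L₂ (u 1)) ∈ H10 (interval L₁ L₂) := by
  refine formDomain_induction
    (p := fun u => (restrict L₁ L₂ (u 0), restrict L₁ L₂ (u 1)) ∈ H10 (interval L₁ L₂))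
    ((Submodule.isClosed_topologicalClosure _).preimage
      (((restrict L₁ L₂).continuous.comp (E3.continuous_apply 0)).prodMk
        ((restrict L₁ L₂).continuous.comp (E3.continuous_apply 1)))) (fun φ hφ => ?_) hu
  refine Submodule.le_topologicalClosure _ ⟨φ, hφ, ?_, ?_⟩
  · exact (restrict_coeFn _).trans (ae_restrict_of_ae hφ.coeFn_toL2)
  · exact (restrict_coeFn _).trans (ae_restrict_of_ae hφ.deriv.coeFn_toL2)

/-- Extension of `H¹₀` to the form domain. -/
theorem extendZero_mem_formDomain {p : L2 (interval L₁ L₂) × L2 (interval L₁ L₂)}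
    (hp : p ∈ H10 (interval L₁ L₂)) :
    mk3 (extendZero L₁ L₂ p.1) (extendZero L₁ L₂ p.2) (mulId L₁ L₂ (extendZero L₁ L₂ p.1)) ∈
      formDomain (interval L₁ L₂) := by
  have hcl : IsClosed {p : L2 (interval L₁ L₂) × L2 (interval L₁ L₂) |
      mk3 (extendZero L₁ L₂ p.1) (extendZero L₁ L₂ p.2) (mulId L₁ L₂ (extendZero L₁ L₂ p.1)) ∈
        formDomain (interval L₁ L₂)} := by
    refine (Submodule.isClosed_topologicalClosure _).preimage ?_
    refine (PiLp.continuous_toLp 2 _).comp (continuous_pi fun i => ?_)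
    fin_cases i
    · exact (extendZero L₁ L₂).continuous.comp continuous_fst
    · exact (extendZero L₁ L₂).continuous.comp continuous_snd
    · exact ((mulId L₁ L₂).continuous.comp (extendZero L₁ L₂).continuous).comp continuous_fst
  refine closure_minimal (s := (testPairs (interval L₁ L₂) :
    Set (L2 (interval L₁ L₂) × L2 (interval L₁ L₂)))) ?_ hcl hp
  rintro ⟨u, u'⟩ ⟨φ, hφ, h1, h2⟩
  have e : ∀ (v : L2 (interval L₁ L₂)) (ψ : ℝ → ℂ), IsTest (interval L₁ L₂) ψ →
      v =ᵐ[volume.restrict (interval L₁ L₂)] ψ → extendZero L₁ L₂ v =ᵐ[volume] ψ :=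
    fun v ψ hψ hv => by
      filter_upwards [extendZero_coeFn L₁ L₂ v,
        (ae_restrict_iff' (s := interval L₁ L₂) measurableSet_Ioo).1 hv] with x k1 k2
      rw [k1]
      by_cases hx : x ∈ interval L₁ L₂
      · rw [indicator_of_mem hx, k2 hx]
      · rw [indicator_of_notMem hx, hψ.eq_zero_of_notMem hx]
  refine Submodule.le_topologicalClosure _ ⟨φ, hφ, e _ _ hφ h1, e _ _ hφ.deriv h2, ?_⟩
  filter_upwards [coeFn_mulId (L₁ := L₁) (L₂ := L₂) (extendZero L₁ L₂ u), e _ _ hφ h1] with x k1 k2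
  rw [mk3_two, k1, k2]
  by_cases hx : x ∈ interval L₁ L₂
  · rw [indicator_of_mem hx]
  · rw [indicator_of_notMem hx, hφ.eq_zero_of_notMem hx, mul_zero, mul_zero]

end Extension

/-! ### The Dirichlet problem on the interval -/

/-- A continuous function, bounded from above and from below in modulus. -/
structure Profile (p : ℝ → ℝ) (c B : ℝ) : Prop where
  cont : Continuous p
  lower_pos : 0 < c
  lower : ∀ x, c ≤ |p x|
  upper : ∀ x, |p x| ≤ B

/-- The quotient `q(x) / x`, extended by continuity. -/
theorem exists_profile {L₁ L₂ : ℝ} (hL₁ : 0 < L₁) (hL₂ : 0 < L₂) {q : ℝ → ℝ}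
    (hq : ContDiffOn ℝ 2 q (Icc (-L₁) L₂)) (hq0 : q 0 = 0) (hq0' : 0 < deriv q 0)
    (hqne : ∀ x ∈ Icc (-L₁) L₂, x ≠ 0 → q x ≠ 0) :
    ∃ (p : ℝ → ℝ) (c B : ℝ), Profile p c B ∧ p 0 = deriv q 0 ∧
      ∀ x ∈ interval L₁ L₂, q x = x * p x := by
  have hle : -L₁ ≤ L₂ := by linarith
  have h0 : Icc (-L₁) L₂ ∈ 𝓝 (0 : ℝ) := Icc_mem_nhds (by linarith) hL₂
  have hd : DifferentiableAt ℝ q 0 := differentiableAt_of_deriv_ne_zero hq0'.ne'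
  have hc : ContinuousOn (dslope q 0) (Icc (-L₁) L₂) :=
    (continuousOn_dslope h0).2 ⟨hq.continuousOn, hd⟩
  have hs : ∀ x, x ≠ 0 → x * dslope q 0 x = q x := fun x hx => by
    rw [dslope_of_ne _ hx, slope_def_field, hq0, sub_zero, sub_zero, mul_div_cancel₀ _ hx]
  have hne : ∀ x ∈ Icc (-L₁) L₂, dslope q 0 x ≠ 0 := fun x hx e => by
    by_cases hx0 : x = 0
    · rw [hx0, dslope_same] at e
      exact hq0'.ne' e
    · refine hqne x hx hx0 ?_
      rw [← hs x hx0, e, mul_zero]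
  have hcomp : IsCompact (Icc (-L₁) L₂) := isCompact_Icc
  have hnon : (Icc (-L₁) L₂).Nonempty := nonempty_Icc.2 hle
  obtain ⟨x₁, hx₁, hm⟩ := hcomp.exists_isMinOn hnon hc.abs
  obtain ⟨x₂, -, hM⟩ := hcomp.exists_isMaxOn hnon hc.abs
  -- Outside the interval the quotient is continued by its end values. The two-sided bounds then
  -- hold on all of ℝ and p acts on L²(ℝ). Only continuity of q and differentiability at 0 enter.
  refine ⟨IccExtend hle (domRestrict (Icc (-L₁) L₂) (dslope q 0)), |dslope q 0 x₁|,
    |dslope q 0 x₂|, ⟨?_, abs_pos.2 (hne _ hx₁), fun x => ?_, fun x => ?_⟩, ?_, fun x hx => ?_⟩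
  · exact (continuousOn_iff_continuous_domRestrict.1 hc).Icc_extend'
  · exact hm (projIcc _ _ hle x).2
  · exact hM (projIcc _ _ hle x).2
  · rw [IccExtend_of_mem _ _ (mem_of_mem_nhds h0), Set.domRestrict_apply, dslope_same]
  · rw [IccExtend_of_mem _ _ (Ioo_subset_Icc_self hx), Set.domRestrict_apply]
    change q x = x * dslope q 0 x
    by_cases hx0 : x = 0
    · rw [hx0, hq0, zero_mul]
    · rw [hs x hx0]

section Dirichlet

variable {p : ℝ → ℝ} {c B : ℝ}

theorem Profile.memLp (hp : Profile p c B) :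
    MemLp (fun x => (p x : ℂ)) ∞ (volume : Measure ℝ) := by
  refine memLp_top_of_bound (Complex.continuous_ofReal.comp hp.cont).aestronglyMeasurable B
    (ae_of_all _ fun x => ?_)
  rw [Complex.norm_real]
  exact hp.upper x

/-- The operator of multiplication by `p`. -/
def Profile.op (hp : Profile p c B) : L2R →L[ℂ] L2R := mulOp _ hp.memLp

theorem Profile.coeFn_op (hp : Profile p c B) (f : L2R) :
    hp.op f =ᵐ[volume] fun x => (p x : ℂ) * f x := coeFn_mulOp _ f

theorem Profile.formData (hp : Profile p c B) {ν : ℂ} {κ a : ℝ} (h0 : 0 < ‖ν‖) (hκ : 0 < κ)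
    (hν : κ * ‖ν‖ ≤ ν.re) (ha : 0 < a) : FormData ν κ a c hp.op :=
  ⟨h0, hκ, hν, ha, hp.lower_pos, inner_mulOp _ fun x => Complex.conj_ofReal _,
    norm_mulOp_ge _ hp.lower_pos (ae_of_all _ fun x => by
      rw [Complex.norm_real]; exact hp.lower x)⟩

/-- The variational solution of `-w'' + ν² p² x² w + a ν w = F` with Dirichlet conditions. -/
def Profile.sol (hp : Profile p c B) (L₁ L₂ a : ℝ) (ν : ℂ) : E3 →L[ℂ] E3 :=
  solveForm (formDomain (interval L₁ L₂)) (formOp ν (a * ν) hp.op)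

/-- The resolvent of `P_ν` at `-a ν`, extended to `L²(ℝ)`. -/
def Profile.res (hp : Profile p c B) (L₁ L₂ a : ℝ) (ν : ℂ) : L2R →L[ℂ] L2R :=
  outL 1 0 0 ∘L hp.sol L₁ L₂ a ν ∘L embL 1 0 0

theorem Profile.res_apply (hp : Profile p c B) (L₁ L₂ a : ℝ) (ν : ℂ) (f : L2R) :
    hp.res L₁ L₂ a ν f = hp.sol L₁ L₂ a ν (embL 1 0 0 f) 0 := by
  simp only [Profile.res, ContinuousLinearMap.comp_apply, outL_apply, one_smul, zero_smul,
    add_zero]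

namespace FormData

variable {hp : Profile p c B} {ν : ℂ} {κ a L₁ L₂ : ℝ} (h : FormData ν κ a c hp.op)
include h

theorem coercive_one : ∃ m : ℝ, 0 < m ∧ ∀ u ∈ formDomain (interval L₁ L₂),
    m * ‖u‖ ^ 2 ≤ ‖inner ℂ u (formOp ν (a * ν) hp.op u)‖ := by
  have := h.coercive (t := 1) (by simp) (Ω := interval L₁ L₂)
  rwa [mul_one] at this

omit h in
theorem sol_mem (F : E3) : hp.sol L₁ L₂ a ν F ∈ formDomain (interval L₁ L₂) := solveForm_mem F

theorem inner_sol (F : E3) {v : E3} (hv : v ∈ formDomain (interval L₁ L₂)) :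
    a * ν * inner ℂ (v 0) (hp.sol L₁ L₂ a ν F 0) + inner ℂ (v 1) (hp.sol L₁ L₂ a ν F 1) +
      ν ^ 2 * inner ℂ (v 2) (hp.op (hp.op (hp.sol L₁ L₂ a ν F 2))) = inner ℂ v F := by
  have := inner_solveForm h.coercive_one F hv
  rwa [inner_formOp] at this

theorem eq_sol {u F : E3} (hu : u ∈ formDomain (interval L₁ L₂))
    (hF : ∀ v ∈ formDomain (interval L₁ L₂), a * ν * inner ℂ (v 0) (u 0) +
      inner ℂ (v 1) (u 1) + ν ^ 2 * inner ℂ (v 2) (hp.op (hp.op (u 2))) = inner ℂ v F) :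
    u = hp.sol L₁ L₂ a ν F := by
  refine eq_solveForm h.coercive_one hu fun v hv => ?_
  rw [inner_formOp]
  exact hF v hv

theorem integral_sol (F : E3) {φ : ℝ → ℂ} (hφ : IsTest (interval L₁ L₂) φ) :
    a * ν * (∫ x, hp.sol L₁ L₂ a ν F 0 x * φ x) + (∫ x, hp.sol L₁ L₂ a ν F 1 x * deriv φ x) +
      ν ^ 2 * (∫ x, hp.op (hp.op (hp.sol L₁ L₂ a ν F 2)) x * (x * φ x)) =
    (∫ x, F 0 x * φ x) + (∫ x, F 1 x * deriv φ x) + ∫ x, F 2 x * (x * φ x) := by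
  rw [← hφ.inner_triple, ← h.inner_sol F hφ.conj.triple_mem]
  have e := hφ.inner_triple (mk3 ((a * ν) • hp.sol L₁ L₂ a ν F 0) (hp.sol L₁ L₂ a ν F 1)
    (ν ^ 2 • hp.op (hp.op (hp.sol L₁ L₂ a ν F 2))))
  rw [E3.inner_eq] at e
  simp only [mk3_zero, mk3_one, mk3_two, inner_smul_right, integral_coeFn_smul] at e
  rw [e]

/-- Only the restriction of the right-hand side to the interval matters. -/
theorem sol_extendZero_restrict (f : L2R) :
    hp.sol L₁ L₂ a ν (embL 1 0 0 (extendZero L₁ L₂ (restrict L₁ L₂ f))) =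
      hp.sol L₁ L₂ a ν (embL 1 0 0 f) := by
  refine h.eq_sol (sol_mem _) fun v hv => ?_
  rw [h.inner_sol _ hv, inner_embL, inner_embL, inner_extendZero_restrict,
    formDomain_extendZero_restrict hv]
  ring

/-- The resolvent on the line is the extension of the one on the interval. -/
theorem extendZero_res_restrict (f : L2R) :
    extendZero L₁ L₂ (((restrict L₁ L₂).comp ((hp.res L₁ L₂ a ν).comp (extendZero L₁ L₂)))
      (restrict L₁ L₂ f)) = hp.res L₁ L₂ a ν f := by
  simp only [ContinuousLinearMap.comp_apply]
  rw [hp.res_apply, hp.res_apply, h.sol_extendZero_restrict,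
    formDomain_extendZero_restrict (sol_mem _)]

/-- A variational solution belongs to H² because the equation itself exhibits its second derivative
in L². Conversely an element of the graph, extended by zero, solves the variational problem, whose
solution is unique. -/
theorem isResolventAt_P {q : ℝ → ℝ} (hq : ∀ x ∈ interval L₁ L₂, q x = x * p x) :
    IsResolventAt (P L₁ L₂ q ν) (-(a * ν))
      ((restrict L₁ L₂).comp ((hp.res L₁ L₂ a ν).comp (extendZero L₁ L₂))) := by
  have hmeas : MeasurableSet (interval L₁ L₂) := measurableSet_Ioo
  refine isResolventAt_of_graph (P_graph L₁ L₂ q ν) (fun f => ?_) fun u g hu => ?_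
  · simp only [ContinuousLinearMap.comp_apply, hp.res_apply]
    set w := hp.sol L₁ L₂ a ν (embL 1 0 0 (extendZero L₁ L₂ f)) with hw
    have hwm : w ∈ formDomain (interval L₁ L₂) := sol_mem _
    -- The candidate for w'', solved from the equation. The product x p² (xw) is formed with the
    -- truncated multiplication, since x is unbounded on ℝ.
    set k : L2R := ν ^ 2 • mulId L₁ L₂ (hp.op (hp.op (w 2))) + (a * ν) • w 0 - extendZero L₁ L₂ f
      with hk
    refine ⟨restrict L₁ L₂ (w 1), restrict L₁ L₂ k, fun φ hφ => ?_, fun φ hφ => ?_,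
      restrict_mem_H10 hwm, ?_⟩
    · rw [integral_restrict _ hφ.deriv, integral_restrict _ hφ,
        formDomain_deriv hwm (hφ.mono (subset_univ _))]
    · rw [integral_restrict _ hφ.deriv, integral_restrict _ hφ]
      have h1 := h.integral_sol (embL 1 0 0 (extendZero L₁ L₂ f)) hφ
      rw [← hw, embL_apply, mk3_zero, mk3_one, mk3_two, integral_coeFn_smul, integral_coeFn_smul,
        integral_coeFn_smul, ← integral_mulId _ hφ, ← integral_mulId _ hφ] at h1
      have h2 : ∫ x, k x * φ x = ν ^ 2 * (∫ x, mulId L₁ L₂ (hp.op (hp.op (w 2))) x * φ x) +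
          a * ν * (∫ x, w 0 x * φ x) - ∫ x, extendZero L₁ L₂ f x * φ x := by
        rw [← hφ.inner_conj, ← hφ.inner_conj, ← hφ.inner_conj, ← hφ.inner_conj, hk,
          inner_sub_right, inner_add_right, inner_smul_right, inner_smul_right]
      rw [h2]
      linear_combination h1
    · have e1 := ae_restrict_of_ae (s := interval L₁ L₂) (formDomain_coeFn_two hwm)
      have e2 := ae_restrict_of_ae (s := interval L₁ L₂) (hp.coeFn_op (w 2))
      have e3 := ae_restrict_of_ae (s := interval L₁ L₂) (hp.coeFn_op (hp.op (w 2)))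
      have e4 := ae_restrict_of_ae (s := interval L₁ L₂)
        (coeFn_mulId (L₁ := L₁) (L₂ := L₂) (hp.op (hp.op (w 2))))
      have e5 := ae_restrict_of_ae (s := interval L₁ L₂) (Lp.coeFn_sub
        (ν ^ 2 • mulId L₁ L₂ (hp.op (hp.op (w 2))) + (a * ν) • w 0) (extendZero L₁ L₂ f))
      have e6 := ae_restrict_of_ae (s := interval L₁ L₂) (Lp.coeFn_add
        (ν ^ 2 • mulId L₁ L₂ (hp.op (hp.op (w 2)))) ((a * ν) • w 0))
      have e7 := ae_restrict_of_ae (s := interval L₁ L₂) (Lp.coeFn_smul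
        (ν ^ 2) (mulId L₁ L₂ (hp.op (hp.op (w 2)))))
      have e8 := ae_restrict_of_ae (s := interval L₁ L₂) (Lp.coeFn_smul (a * ν) (w 0))
      have e9 := ae_restrict_of_ae (s := interval L₁ L₂) (extendZero_coeFn L₁ L₂ f)
      filter_upwards [e1, e2, e3, e4, e5, e6, e7, e8, e9, restrict_coeFn (L₁ := L₁) (L₂ := L₂) k,
        restrict_coeFn (L₁ := L₁) (L₂ := L₂) (w 0), ae_restrict_mem hmeas,
        Lp.coeFn_add f (-(a * ν) • restrict L₁ L₂ (w 0)),
        Lp.coeFn_smul (-(a * ν)) (restrict L₁ L₂ (w 0))] with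
        x e1 e2 e3 e4 e5 e6 e7 e8 e9 e10 e11 hx e12 e13
      rw [e12, Pi.add_apply, e13, Pi.smul_apply, e11, e10, hk, e5, Pi.sub_apply, e6, Pi.add_apply,
        e7, Pi.smul_apply, e8, Pi.smul_apply, e4, e3, e2, e1, e9, indicator_of_mem hx,
        indicator_of_mem hx, hq x hx, smul_eq_mul, smul_eq_mul, smul_eq_mul]
      push_cast
      ring
  · obtain ⟨u', u'', h1, h2, h3, h4⟩ := hu
    have hwm := extendZero_mem_formDomain h3
    simp only at h1 h3 h4 hwm
    set w := mk3 (extendZero L₁ L₂ u) (extendZero L₁ L₂ u') (mulId L₁ L₂ (extendZero L₁ L₂ u))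
      with hw
    simp only [ContinuousLinearMap.comp_apply, hp.res_apply]
    have key : w = hp.sol L₁ L₂ a ν (embL 1 0 0 (extendZero L₁ L₂ (g - -(a * ν) • u))) := by
      refine h.eq_sol hwm fun v hv => ?_
      rw [← sub_eq_zero]
      have h5 : inner ℂ v (mk3 ((a * ν) • w 0 - extendZero L₁ L₂ (g - -(a * ν) • u)) (w 1)
          (ν ^ 2 • hp.op (hp.op (w 2)))) = 0 := by
        refine inner_eq_zero_of_test (fun φ hφ => ?_) hv
        rw [mk3_zero, mk3_one, mk3_two, integral_coeFn_smul]
        have k1 : (a * ν) • w 0 - extendZero L₁ L₂ (g - -(a * ν) • u) = -extendZero L₁ L₂ g := by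
          rw [hw, mk3_zero, map_sub, map_smul]
          module
        have k2 : ∫ x, w 1 x * deriv φ x = -∫ x, extendZero L₁ L₂ u'' x * φ x := by
          rw [hw, mk3_one, integral_extendZero, integral_extendZero]
          exact h2 φ hφ
        have k3 : ν ^ 2 • mulId L₁ L₂ (hp.op (hp.op (w 2))) =
            extendZero L₁ L₂ g + extendZero L₁ L₂ u'' := by
          refine Lp.ext ?_
          filter_upwards [hp.coeFn_op (w 2), hp.coeFn_op (hp.op (w 2)),
            coeFn_mulId (L₁ := L₁) (L₂ := L₂) (hp.op (hp.op (w 2))),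
            Lp.coeFn_smul (ν ^ 2) (mulId L₁ L₂ (hp.op (hp.op (w 2)))),
            coeFn_mulId (L₁ := L₁) (L₂ := L₂) (extendZero L₁ L₂ u),
            extendZero_coeFn L₁ L₂ u, extendZero_coeFn L₁ L₂ g, extendZero_coeFn L₁ L₂ u'',
            Lp.coeFn_add (extendZero L₁ L₂ g) (extendZero L₁ L₂ u''),
            (ae_restrict_iff' hmeas).1 h4] with x e1 e2 e3 e4 e5 e6 e7 e8 e9 e10
          rw [e4, Pi.smul_apply, e3, e2, e1, hw, mk3_two, e5, e6, e9, Pi.add_apply, e7, e8]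
          by_cases hx : x ∈ interval L₁ L₂
          · rw [indicator_of_mem hx, indicator_of_mem hx, indicator_of_mem hx,
              indicator_of_mem hx, e10 hx, hq x hx, smul_eq_mul]
            push_cast
            ring
          · simp only [indicator_of_notMem hx, zero_mul, add_zero, smul_zero]
        have k4 : ν ^ 2 * ∫ x, hp.op (hp.op (w 2)) x * (x * φ x) =
            (∫ x, extendZero L₁ L₂ g x * φ x) + ∫ x, extendZero L₁ L₂ u'' x * φ x := by
          rw [← integral_mulId _ hφ, ← integral_coeFn_smul, k3, ← hφ.inner_conj, ← hφ.inner_conj,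
            ← hφ.inner_conj, inner_add_right]
        rw [k1, k2, k4]
        have k5 : ∫ x, (-extendZero L₁ L₂ g : L2R) x * φ x =
            -∫ x, extendZero L₁ L₂ g x * φ x := by
          rw [← hφ.inner_conj, ← hφ.inner_conj, inner_neg_right]
        rw [k5]
        ring
      rw [E3.inner_eq, mk3_zero, mk3_one, mk3_two, inner_sub_right, inner_smul_right,
        inner_smul_right] at h5
      rw [inner_embL]
      linear_combination h5
    rw [← key, hw, mk3_zero, restrict_extendZero]

end FormData

end Dirichlet

/-! ### Comparison of the two resolvents -/

/-- Multiplication by a cut-off function `χ` on `I` equal to `1` near `0`: the operators `X`, `X'`,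
`G` and `Q` are the multiplications by `χ`, `χ'`, `(1 - χ) / x` and `(p² - a²) χ`. -/
structure CutoffData {p : ℝ → ℝ} {c B : ℝ} (hp : Profile p c B) (L₁ L₂ a η K : ℝ)
    (X X' G Q : L2R →L[ℂ] L2R) : Prop where
  symm : ∀ u v : L2R, inner ℂ u (X v) = inner ℂ (X u) v
  mem : ∀ z ∈ formDomain univ, mk3 (X (z 0)) (X (z 1) + X' (z 0)) (X (z 2)) ∈
    formDomain (interval L₁ L₂)
  compl : ∀ z ∈ formDomain univ, z 0 - X (z 0) = G (z 2)
  defect : ∀ f, hp.op (hp.op (X f)) = (a : ℂ) ^ 2 • X f + Q f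
  norm_deriv : ∀ f, ‖X' f‖ ≤ K * ‖f‖
  norm_compl : ∀ f, ‖G f‖ ≤ K * ‖f‖
  norm_defect : ∀ f, ‖Q f‖ ≤ η * ‖f‖
  nonneg : 0 ≤ K
  pos : 0 < η

/-- Leibniz' rule on test functions, extended by density. It makes χu admissible in the Dirichlet
problem and χw in the oscillator problem. -/
theorem formDomain_cutoff {Ω Ω' : Set ℝ} {χ : ℝ → ℂ} (h : IsTest Ω' χ)
    (h0 : MemLp χ ∞ (volume : Measure ℝ)) (h1 : MemLp (deriv χ) ∞ (volume : Measure ℝ)) {z : E3}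
    (hz : z ∈ formDomain Ω) :
    mk3 (mulOp χ h0 (z 0)) (mulOp χ h0 (z 1) + mulOp _ h1 (z 0)) (mulOp χ h0 (z 2)) ∈
      formDomain Ω' := by
  have c := E3.continuous_apply
  refine formDomain_induction (p := fun z => mk3 (mulOp χ h0 (z 0))
    (mulOp χ h0 (z 1) + mulOp _ h1 (z 0)) (mulOp χ h0 (z 2)) ∈ formDomain Ω')
    ((Submodule.isClosed_topologicalClosure _).preimage ((PiLp.continuous_toLp 2 _).comp
      (continuous_pi fun i => ?_))) (fun φ hφ => ?_) hz
  · fin_cases i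
    · exact (mulOp χ h0).continuous.comp (c 0)
    · exact ((mulOp χ h0).continuous.comp (c 1)).add ((mulOp _ h1).continuous.comp (c 0))
    · exact (mulOp χ h0).continuous.comp (c 2)
  · have t : IsTest Ω' (fun x => χ x * φ x) :=
      ⟨h.1.mul hφ.1, h.2.1.mul_right, (tsupport_mul_subset_left).trans h.2.2⟩
    refine Submodule.le_topologicalClosure _ ⟨_, t, ?_, ?_, ?_⟩
    · filter_upwards [coeFn_mulOp h0 hφ.toL2, hφ.coeFn_toL2] with x e1 e2
      rw [mk3_zero]
      exact e1.trans (by rw [e2])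
    · filter_upwards [coeFn_mulOp h0 hφ.deriv.toL2, hφ.deriv.coeFn_toL2,
        coeFn_mulOp h1 hφ.toL2, hφ.coeFn_toL2,
        Lp.coeFn_add (mulOp χ h0 hφ.deriv.toL2) (mulOp _ h1 hφ.toL2)] with x e1 e2 e3 e4 e5
      rw [mk3_one]
      refine e5.trans ?_
      rw [Pi.add_apply, e1, e2, e3, e4]
      exact ((((h.hasDerivAt x).mul (hφ.hasDerivAt x)).deriv).trans (by ring)).symm
    · filter_upwards [coeFn_mulOp h0 hφ.id_mul.toL2, hφ.id_mul.coeFn_toL2] with x e1 e2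
      rw [mk3_two]
      refine e1.trans ?_
      rw [e2]
      ring

/-- Given η, continuity of p² at 0 dictates how small the support of χ must be. The bounds on χ' and
(1 - χ)/x then deteriorate with η, which is why K is produced after η. -/
theorem exists_cutoffData {p : ℝ → ℝ} {c B L₁ L₂ η : ℝ} (hp : Profile p c B) (hL₁ : 0 < L₁)
    (hL₂ : 0 < L₂) (hη : 0 < η) :
    ∃ (K : ℝ) (X X' G Q : L2R →L[ℂ] L2R), CutoffData hp L₁ L₂ (p 0) η K X X' G Q := by
  have hI : interval L₁ L₂ ∈ 𝓝 (0 : ℝ) := Ioo_mem_nhds (by linarith) hL₂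
  have hη' : {x | |p x ^ 2 - p 0 ^ 2| < η} ∈ 𝓝 (0 : ℝ) := by
    have hcont : Continuous fun x => |p x ^ 2 - p 0 ^ 2| := by
      have := hp.cont
      fun_prop
    refine hcont.continuousAt.eventually_lt continuousAt_const ?_
    simpa using hη
  obtain ⟨ε, hε, hball⟩ := Metric.mem_nhds_iff.1 (inter_mem hI hη')
  -- The cut-off is 1 for |x| ≤ δ and 0 for |x| ≥ 2δ, and 2δ < ε keeps its support in the good ball.
  set δ := ε / 3 with hδ
  have hδ0 : 0 < δ := by positivity
  let b : ContDiffBump (0 : ℝ) := ⟨δ, 2 * δ, hδ0, by linarith⟩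
  have hb1 : ∀ x, |x| ≤ δ → b x = 1 := fun x hx => b.one_of_mem_closedBall (by
    rw [Metric.mem_closedBall, dist_zero_right]; exact hx)
  have hb0 : ∀ x, 2 * δ ≤ |x| → b x = 0 := fun x hx => b.zero_of_le_dist (by
    rw [dist_zero_right]; exact hx)
  have hbn : ∀ x, 0 ≤ b x := fun x => b.nonneg
  have hble : ∀ x, b x ≤ 1 := fun x => b.le_one
  set χ : ℝ → ℂ := fun x => (b x : ℂ) with hχ
  have hsmall : ∀ x : ℝ, |x| ≤ 2 * δ → x ∈ interval L₁ L₂ ∧ |p x ^ 2 - p 0 ^ 2| < η := fun x hx =>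
    hball (by rw [Metric.mem_ball, dist_zero_right, Real.norm_eq_abs]; linarith)
  have ht : IsTest (interval L₁ L₂) χ := by
    refine ⟨Complex.ofRealCLM.contDiff.comp b.contDiff,
      b.hasCompactSupport.comp_left (g := fun y : ℝ => (y : ℂ)) (by simp), ?_⟩
    refine (closure_mono (t := Function.support b) fun x hx => by simpa [hχ] using hx).trans ?_
    rw [← tsupport, b.tsupport_eq]
    intro x hx
    rw [Metric.mem_closedBall, dist_zero_right, Real.norm_eq_abs] at hx
    exact (hsmall x hx).1
  obtain ⟨K₁, hK₁⟩ := ht.deriv.2.1.exists_bound_of_continuous ht.deriv.continuous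
  have h0 : MemLp χ ∞ (volume : Measure ℝ) :=
    memLp_top_of_bound ht.continuous.aestronglyMeasurable 1 (ae_of_all _ fun x => by
      rw [hχ, Complex.norm_real, Real.norm_eq_abs, abs_of_nonneg (hbn x)]; exact hble x)
  have h1 : MemLp (deriv χ) ∞ (volume : Measure ℝ) :=
    memLp_top_of_bound ht.deriv.continuous.aestronglyMeasurable K₁ (ae_of_all _ hK₁)
  have hgb : ∀ x : ℝ, ‖(((1 - b x) / x : ℝ) : ℂ)‖ ≤ 1 / δ := fun x => by
    rw [Complex.norm_real, Real.norm_eq_abs, abs_div]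
    rcases le_or_gt |x| δ with hx | hx
    · rw [hb1 x hx, sub_self, abs_zero, zero_div]; positivity
    · rw [abs_of_nonneg (by linarith [hble x])]
      have := hbn x
      gcongr
      linarith
  have h2 : MemLp (fun x : ℝ => (((1 - b x) / x : ℝ) : ℂ)) ∞ (volume : Measure ℝ) := by
    refine memLp_top_of_bound (Measurable.aestronglyMeasurable ?_) (1 / δ) (ae_of_all _ hgb)
    have := b.continuous.measurable
    fun_prop
  have hqb : ∀ x : ℝ, ‖(((p x ^ 2 - p 0 ^ 2) * b x : ℝ) : ℂ)‖ ≤ η := fun x => by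
    rw [Complex.norm_real, Real.norm_eq_abs, abs_mul, abs_of_nonneg (hbn x)]
    rcases le_or_gt |x| (2 * δ) with hx | hx
    · have := (hsmall x hx).2
      nlinarith [hbn x, hble x, abs_nonneg (p x ^ 2 - p 0 ^ 2)]
    · rw [hb0 x hx.le, mul_zero]; exact hη.le
  have h3 : MemLp (fun x : ℝ => (((p x ^ 2 - p 0 ^ 2) * b x : ℝ) : ℂ)) ∞
      (volume : Measure ℝ) := by
    refine memLp_top_of_bound (Measurable.aestronglyMeasurable ?_) η (ae_of_all _ hqb)
    have := b.continuous.measurable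
    have := hp.cont.measurable
    fun_prop
  refine ⟨max K₁ (1 / δ), mulOp _ h0, mulOp _ h1, mulOp _ h2, mulOp _ h3,
    ⟨inner_mulOp _ fun x => Complex.conj_ofReal _, fun z hz => formDomain_cutoff ht h0 h1 hz,
      fun z hz => ?_, fun f => ?_, ?_, ?_, ?_, ?_, hη⟩⟩
  · refine Lp.ext ?_
    filter_upwards [Lp.coeFn_sub (z 0) (mulOp _ h0 (z 0)), coeFn_mulOp h0 (z 0),
      coeFn_mulOp h2 (z 2), formDomain_coeFn_two hz] with x e1 e2 e3 e4
    rw [e1, Pi.sub_apply, e2, e3, e4]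
    by_cases hx : x = 0
    · rw [hx, hχ]
      simp only
      rw [hb1 0 (by simpa using hδ0.le)]
      simp
    · have : (x : ℂ) ≠ 0 := by exact_mod_cast hx
      rw [hχ]
      push_cast
      field_simp
  · refine Lp.ext ?_
    filter_upwards [hp.coeFn_op (hp.op (mulOp _ h0 f)), hp.coeFn_op (mulOp _ h0 f),
      coeFn_mulOp h0 f, coeFn_mulOp h3 f,
      Lp.coeFn_add ((p 0 : ℂ) ^ 2 • mulOp _ h0 f) (mulOp _ h3 f),
      Lp.coeFn_smul ((p 0 : ℂ) ^ 2) (mulOp _ h0 f)] with x e1 e2 e3 e4 e5 e6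
    rw [e1, e2, e5, Pi.add_apply, e6, Pi.smul_apply, e3, e4, smul_eq_mul, hχ]
    push_cast
    ring
  · exact norm_mulOp_le _ (ae_of_all _ fun x => (hK₁ x).trans (le_max_left _ _))
  · exact norm_mulOp_le _ (ae_of_all _ fun x => (hgb x).trans (le_max_right _ _))
  · exact norm_mulOp_le _ (ae_of_all _ hqb)
  · exact le_max_of_le_right (by positivity)

/-- Here s = √|ν|. Let e be the square root of the energy: w₁ ≤ e, w₂ ≤ e/s² and, by Heisenberg, w₀
≤ e/s. The right-hand side is then linear in e, of order e(K/s² + η/s)N. Dividing by e bounds e, and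
w₀ ≤ e/s gains one more power of s. -/
theorem energy_estimate {s N K η m A w₀ w₁ w₂ u₀ u₁ u₂ : ℝ} (hs : 0 < s) (hN : 0 ≤ N)
    (hK : 0 ≤ K) (hη : 0 ≤ η) (hm : 0 < m) (hA : 1 ≤ A) (hu₀' : 0 ≤ u₀) (hu₁' : 0 ≤ u₁) (hu₂' : 0 ≤ u₂) (hH : w₀ ^ 2 ≤ 2 * (w₁ * w₂)) (hu₀ : u₀ ≤ A * N / s ^ 2) (hu₁ : u₁ ≤ A * N / s)
    (hu₂ : u₂ ≤ A * N / s ^ 3)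
    (hE : m * (w₁ ^ 2 + s ^ 4 * w₂ ^ 2) ≤
      K * w₂ * N + K * w₀ * u₁ + K * w₁ * u₀ + s ^ 4 * (η * w₂ * u₂)) :
    s ^ 2 * w₀ ≤ 3 * A / m * (η + K / s) * N := by
  set e := √(w₁ ^ 2 + s ^ 4 * w₂ ^ 2) with he
  have he2 : e ^ 2 = w₁ ^ 2 + s ^ 4 * w₂ ^ 2 := Real.sq_sqrt (by positivity)
  have he0 : 0 ≤ e := Real.sqrt_nonneg _
  have b1 : w₁ ≤ e := abs_le_of_sq_le_sq' (by rw [he2]; nlinarith [sq_nonneg (s ^ 2 * w₂)]) he0 |>.2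
  have b2 : w₂ ≤ e / s ^ 2 := by
    rw [le_div_iff₀ (by positivity)]
    exact (abs_le_of_sq_le_sq' (by rw [he2]; nlinarith [sq_nonneg w₁]) he0).2
  have b0 : w₀ ≤ e / s := by
    rw [le_div_iff₀ hs]
    refine (abs_le_of_sq_le_sq' ?_ he0).2
    rw [he2]
    have : s ^ 2 * w₀ ^ 2 ≤ s ^ 2 * (2 * (w₁ * w₂)) := by gcongr
    nlinarith [sq_nonneg (w₁ - s ^ 2 * w₂)]
  have key : m * e ^ 2 ≤ e * (N * A * (3 * K / s ^ 2 + η / s)) := by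
    rw [he2]
    calc _ ≤ _ := hE
      _ ≤ K * (e / s ^ 2) * N + K * (e / s) * (A * N / s) + K * e * (A * N / s ^ 2) +
          s ^ 4 * (η * (e / s ^ 2) * (A * N / s ^ 3)) := by gcongr
      _ = e * (N * (1 * (K / s ^ 2) + A * (2 * K / s ^ 2) + A * (η / s))) := by
          field_simp
          ring
      _ ≤ e * (N * (A * (K / s ^ 2) + A * (2 * K / s ^ 2) + A * (η / s))) := by gcongr
      _ = _ := by ring
  have k2 : m * e ≤ N * A * (3 * K / s ^ 2 + η / s) := by
    rcases he0.eq_or_lt with h0 | h0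
    · rw [← h0, mul_zero]; positivity
    · refine le_of_mul_le_mul_left ?_ h0
      linarith
  calc s ^ 2 * w₀ ≤ s ^ 2 * (e / s) := by gcongr
    _ = s / m * (m * e) := by field_simp
    _ ≤ s / m * (N * A * (3 * K / s ^ 2 + η / s)) := by gcongr
    _ = A / m * (3 * (K / s) + η) * N := by field_simp
    _ ≤ A / m * (3 * (K / s) + 3 * η) * N := by gcongr; linarith
    _ = _ := by ring

/-- With |β| = r²s², the oscillator bounds are converted into powers of s alone, the dependence on κ
and a = r² being put into A. -/
theorem energy_scaling {κ r s N A u₀ u₁ u₂ : ℝ} (hκ : 0 < κ) (hr : 0 < r) (hs : 0 < s) (hN : 0 ≤ N)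
    (hA₁ : 1 / (κ * r) ≤ A) (hA₂ : 1 / (κ * r ^ 2) ≤ A)
    (hA₃ : 1 / (κ * r ^ 3) ≤ A) (q0 : κ * (r ^ 2 * s ^ 2) * u₀ ≤ N)
    (q1 : κ ^ 2 * (r ^ 2 * s ^ 2) * (u₁ ^ 2 + (r ^ 2 * s ^ 2) ^ 2 * u₂ ^ 2) ≤ N ^ 2) :
    u₀ ≤ A * N / s ^ 2 ∧ u₁ ≤ A * N / s ∧ u₂ ≤ A * N / s ^ 3 := by
  refine ⟨?_, ?_, ?_⟩
  · rw [le_div_iff₀ (by positivity)]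
    calc u₀ * s ^ 2 = 1 / (κ * r ^ 2) * (κ * (r ^ 2 * s ^ 2) * u₀) := by field_simp
      _ ≤ 1 / (κ * r ^ 2) * N := by gcongr
      _ ≤ A * N := by gcongr
  · rw [le_div_iff₀ (by positivity)]
    have h : κ * r * s * u₁ ≤ N := by
      refine (abs_le_of_sq_le_sq' (le_trans ?_ q1) hN).2
      have : 0 ≤ κ ^ 2 * (r ^ 2 * s ^ 2) * ((r ^ 2 * s ^ 2) ^ 2 * u₂ ^ 2) := by positivity
      linarith
    calc u₁ * s = 1 / (κ * r) * (κ * r * s * u₁) := by field_simp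
      _ ≤ 1 / (κ * r) * N := by gcongr
      _ ≤ A * N := by gcongr
  · rw [le_div_iff₀ (by positivity)]
    have h : κ * r ^ 3 * s ^ 3 * u₂ ≤ N := by
      refine (abs_le_of_sq_le_sq' (le_trans ?_ q1) hN).2
      have : 0 ≤ κ ^ 2 * (r ^ 2 * s ^ 2) * u₁ ^ 2 := by positivity
      linarith
    calc u₂ * s ^ 3 = 1 / (κ * r ^ 3) * (κ * r ^ 3 * s ^ 3 * u₂) := by field_simp
      _ ≤ 1 / (κ * r ^ 3) * N := by gcongr
      _ ≤ A * N := by gcongr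

theorem SectorData.of_sector {ν : ℂ} {κ a : ℝ} (h0 : 0 < ‖ν‖) (hκ : 0 < κ) (hν : κ * ‖ν‖ ≤ ν.re)
    (ha : 0 < a) : SectorData (a * ν) κ := by
  have e : ‖(a : ℂ) * ν‖ = a * ‖ν‖ := by
    rw [norm_mul, Complex.norm_real, Real.norm_eq_abs, abs_of_pos ha]
  refine SectorData.of_le ?_ hκ ?_
  · rw [e]; positivity
  · rw [e, Complex.re_ofReal_mul]
    nlinarith

/-- The comparison of the resolvents of `P_ν` and of the harmonic oscillator. -/
theorem norm_res_sub_oscRes_le {p : ℝ → ℝ} {c B κ a : ℝ} (hp : Profile p c B) (hκ : 0 < κ)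
    (ha : 0 < a) : ∃ A : ℝ, 0 < A ∧ ∀ (L₁ L₂ η K : ℝ) (X X' G Q : L2R →L[ℂ] L2R),
      CutoffData hp L₁ L₂ a η K X X' G Q → ∀ ν : ℂ, 0 < ‖ν‖ → κ * ‖ν‖ ≤ ν.re →
      ‖ν‖ * ‖hp.res L₁ L₂ a ν - oscRes (a * ν) 1‖ ≤ A * (η + K / √‖ν‖) := by
  have hc := hp.lower_pos
  set r := √a with hr
  have hr0 : 0 < r := Real.sqrt_pos.2 ha
  have hra : r ^ 2 = a := Real.sq_sqrt ha.le
  set A₀ := 1 + 1 / (κ * r) + 1 / (κ * r ^ 2) + 1 / (κ * r ^ 3) with hA₀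
  have p1 : 0 < 1 / (κ * r) := by positivity
  have p2 : 0 < 1 / (κ * r ^ 2) := by positivity
  have p3 : 0 < 1 / (κ * r ^ 3) := by positivity
  have hA1 : 1 ≤ A₀ := by linarith
  have hA₁ : 1 / (κ * r) ≤ A₀ := by linarith
  have hA₂ : 1 / (κ * r ^ 2) ≤ A₀ := by linarith
  have hA₃ : 1 / (κ * r ^ 3) ≤ A₀ := by linarith
  clear_value A₀
  set m := κ * min 1 (c ^ 2) with hm
  have hm0 : 0 < m := by positivity
  -- The constant depends on κ, a and c only, not on the cut-off, so that η can later be chosen in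
  -- terms of it.
  refine ⟨3 * A₀ / m + A₀, by positivity, fun L₁ L₂ η K X X' G Q hX ν hν0 hν => ?_⟩
  have hK := hX.nonneg
  have hη := hX.pos
  have h := hp.formData hν0 hκ hν ha
  have hs := SectorData.of_sector hν0 hκ hν ha
  have hna : ‖(a : ℂ) * ν‖ = a * ‖ν‖ := by
    rw [norm_mul, Complex.norm_real, Real.norm_eq_abs, abs_of_pos ha]
  set s := √‖ν‖ with hsd
  have hs0 : 0 < s := Real.sqrt_pos.2 hν0
  have hsn : ‖ν‖ = s ^ 2 := (Real.sq_sqrt hν0.le).symm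
  rw [← le_div_iff₀' hν0]
  refine ContinuousLinearMap.opNorm_le_bound _ (by positivity) fun f => ?_
  rw [div_mul_eq_mul_div, le_div_iff₀' hν0]
  obtain ⟨q0, q1⟩ := hs.energy_res (t := 1) (by simp) f
  set u := oscSol (a * ν) 1 (embL 1 0 0 f) with hu
  set v := hp.sol L₁ L₂ a ν (embL 1 0 0 f) with hv
  have hum : u ∈ formDomain univ := SectorData.oscSol_mem _ _ _
  have hvm : v ∈ formDomain (interval L₁ L₂) := FormData.sol_mem _
  set y := mk3 (X (u 0)) (X (u 1) + X' (u 0)) (X (u 2)) with hy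
  have hym : y ∈ formDomain (interval L₁ L₂) := hX.mem u hum
  set w := v - y with hw
  have hwm : w ∈ formDomain (interval L₁ L₂) := Submodule.sub_mem _ hvm hym
  have hwm' : w ∈ formDomain univ := formDomain_mono (subset_univ _) hwm
  have e1 := h.inner_sol (embL 1 0 0 f) hwm
  -- The Dirichlet equation is tested with w and the oscillator equation with χw. In the difference,
  -- the main terms in f, u and xu cancel where χ = 1.
  have e2 := hs.inner_oscSol (t := 1) (by simp) (embL 1 0 0 f)
    (formDomain_mono (subset_univ _) (hX.mem w hwm'))
  rw [← hv] at e1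
  rw [← hu] at e2
  simp only [inner_embL, mk3_zero, mk3_one, mk3_two, inner_add_left, ← hX.symm, mul_one, one_mul,
    zero_mul, add_zero] at e1 e2
  -- The form at w equals the commutator errors. The term (1 - χ)w is rewritten as ((1 - χ)/x)·xw,
  -- because xw is smaller than w by a factor of order |ν|^(-1/2).
  have e3 : inner ℂ w (formOp ν (a * ν * 1) hp.op w) = inner ℂ (G (w 2)) f +
      inner ℂ (X' (w 0)) (u 1) - inner ℂ (w 1) (X' (u 0)) - ν ^ 2 * inner ℂ (w 2) (Q (u 2)) := by
    have a0 : w 0 = v 0 - X (u 0) := rfl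
    have a1 : w 1 = v 1 - (X (u 1) + X' (u 0)) := rfl
    have a2 : w 2 = v 2 - X (u 2) := rfl
    have i0 : inner ℂ (w 0) (w 0) = inner ℂ (w 0) (v 0) - inner ℂ (w 0) (X (u 0)) := by
      nth_rewrite 2 [a0]; rw [inner_sub_right]
    have i1 : inner ℂ (w 1) (w 1) = inner ℂ (w 1) (v 1) - inner ℂ (w 1) (X (u 1))
        - inner ℂ (w 1) (X' (u 0)) := by
      nth_rewrite 2 [a1]; rw [inner_sub_right, inner_add_right, sub_sub]
    have i2 : inner ℂ (w 2) (hp.op (hp.op (w 2))) = inner ℂ (w 2) (hp.op (hp.op (v 2))) -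
        (a : ℂ) ^ 2 * inner ℂ (w 2) (X (u 2)) - inner ℂ (w 2) (Q (u 2)) := by
      nth_rewrite 2 [a2]
      rw [map_sub, map_sub, hX.defect, inner_sub_right, inner_add_right, inner_smul_right, sub_sub]
    rw [inner_formOp, i0, i1, i2, ← hX.compl w hwm', inner_sub_left, ← hX.symm]
    linear_combination e1 - e2
  have e4 := h.energy_le 1 w
  rw [e3] at e4
  have e5 : m * (‖w 1‖ ^ 2 + s ^ 4 * ‖w 2‖ ^ 2) ≤ K * ‖w 2‖ * ‖f‖ + K * ‖w 0‖ * ‖u 1‖ +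
      K * ‖w 1‖ * ‖u 0‖ + s ^ 4 * (η * ‖w 2‖ * ‖u 2‖) := by
    have j1 : m * (‖w 1‖ ^ 2 + s ^ 4 * ‖w 2‖ ^ 2) ≤
        κ * (‖w 1‖ ^ 2 + ‖ν‖ ^ 2 * ‖hp.op (w 2)‖ ^ 2) := by
      have l1 : min 1 (c ^ 2) * ‖w 1‖ ^ 2 ≤ 1 * ‖w 1‖ ^ 2 := by gcongr; exact min_le_left _ _
      have l2 : min 1 (c ^ 2) * (s ^ 4 * ‖w 2‖ ^ 2) ≤ c ^ 2 * (s ^ 4 * ‖w 2‖ ^ 2) := by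
        gcongr; exact min_le_right _ _
      have l3 : s ^ 4 * (c * ‖w 2‖) ^ 2 ≤ s ^ 4 * ‖hp.op (w 2)‖ ^ 2 := by
        have := h.lower (w 2)
        gcongr
      rw [hm, hsn, mul_assoc]
      gcongr
      nlinarith
    have j2 : 0 ≤ a * ‖ν‖ * (1 : ℂ).re * ‖w 0‖ ^ 2 := by
      rw [Complex.one_re]; positivity
    have m1 : ‖inner ℂ (G (w 2)) f‖ ≤ K * ‖w 2‖ * ‖f‖ :=
      (norm_inner_le_norm _ _).trans (by gcongr; exact hX.norm_compl _)
    have m2 : ‖inner ℂ (X' (w 0)) (u 1)‖ ≤ K * ‖w 0‖ * ‖u 1‖ :=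
      (norm_inner_le_norm _ _).trans (by gcongr; exact hX.norm_deriv _)
    have m3 : ‖inner ℂ (w 1) (X' (u 0))‖ ≤ ‖w 1‖ * (K * ‖u 0‖) :=
      (norm_inner_le_norm _ _).trans (by gcongr; exact hX.norm_deriv _)
    have m4 : ‖ν ^ 2 * inner ℂ (w 2) (Q (u 2))‖ ≤ s ^ 4 * (‖w 2‖ * (η * ‖u 2‖)) := by
      rw [norm_mul, norm_pow, hsn, ← pow_mul]
      gcongr
      exact (norm_inner_le_norm _ _).trans (by gcongr; exact hX.norm_defect _)
    have n1 := norm_sub_le (inner ℂ (G (w 2)) f + inner ℂ (X' (w 0)) (u 1) -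
      inner ℂ (w 1) (X' (u 0))) (ν ^ 2 * inner ℂ (w 2) (Q (u 2)))
    have n2 := norm_sub_le (inner ℂ (G (w 2)) f + inner ℂ (X' (w 0)) (u 1))
      (inner ℂ (w 1) (X' (u 0)))
    have n3 := norm_add_le (inner ℂ (G (w 2)) f) (inner ℂ (X' (w 0)) (u 1))
    linarith
  rw [hna, ← hra, hsn] at q0 q1
  have hN := norm_nonneg f
  obtain ⟨hu0, hu1, hu2⟩ := energy_scaling hκ hr0 hs0 hN hA₁ hA₂ hA₃ q0 q1
  have main := energy_estimate hs0 hN hK hη.le hm0 hA1 (norm_nonneg _) (norm_nonneg _)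
    (norm_nonneg _) (formDomain_heisenberg hwm) hu0 hu1 hu2 e5
  -- v - u = (v - χu) - (1 - χ)u, and the last term is again ((1 - χ)/x)·xu, with xu of size
  -- |ν|^(-3/2).
  have hdiff : (hp.res L₁ L₂ a ν - oscRes (a * ν) 1) f = w 0 - G (u 2) := by
    have o1 : oscRes (a * ν) 1 f = u 0 := by
      simp only [oscRes, ContinuousLinearMap.comp_apply, outL_apply, one_smul, zero_smul,
        add_zero, hu]
    rw [sub_apply, hp.res_apply, o1, ← hv, ← hX.compl u hum]
    change _ = (v 0 - X (u 0)) - _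
    abel
  rw [hdiff, hsn]
  have hG : s ^ 2 * ‖G (u 2)‖ ≤ A₀ * (K / s) * ‖f‖ := by
    calc s ^ 2 * ‖G (u 2)‖ ≤ s ^ 2 * (K * (A₀ * ‖f‖ / s ^ 3)) := by
          gcongr
          exact (hX.norm_compl _).trans (by gcongr)
      _ = _ := by field_simp
  have htri := norm_sub_le (w 0) (G (u 2))
  calc s ^ 2 * ‖w 0 - G (u 2)‖ ≤ s ^ 2 * ‖w 0‖ + s ^ 2 * ‖G (u 2)‖ := by
        rw [← mul_add]; gcongr
    _ ≤ 3 * A₀ / m * (η + K / s) * ‖f‖ + A₀ * (0 + K / s) * ‖f‖ := by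
        rw [zero_add]; exact add_le_add main hG
    _ ≤ 3 * A₀ / m * (η + K / s) * ‖f‖ + A₀ * (η + K / s) * ‖f‖ := by gcongr
    _ = _ := by ring

/-! ### Spectral consequences -/

theorem cos_mul_norm_le_re {θ₀ : ℝ} (hθ₀' : θ₀ < Real.pi / 2) {ν : ℂ} (hν : ν ∈ sector θ₀) :
    Real.cos θ₀ * ‖ν‖ ≤ ν.re := by
  rw [← Complex.norm_mul_cos_arg ν, mul_comm, ← Real.cos_abs ν.arg]
  gcongr
  exact Real.cos_le_cos_of_nonneg_of_le_pi (abs_nonneg _) (by linarith [Real.pi_pos]) hν.2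

/-- The ground state of the harmonic oscillator. -/
theorem SectorData.spectralProjection_oscillator {β : ℂ} {κ : ℝ} (h : SectorData β κ)
    {φ : L2R} {ψ : L2R →L[ℂ] ℂ} {C : ℝ}
    (hM : SimpleModel ((2 * β) • (oscRaise β ∘L oscLower β)) φ ψ C)
    (hR : ∀ f, (2 * β) • oscRes β 1 f =
      ((2 * β) • (oscRaise β ∘L oscLower β) + ψ.smulRight φ) f) :
    IsAlgebraicallySimple (oscillator β) β ∧
      spectralProjection (oscillator β) β = ψ.smulRight φ := by
  have hid : ‖ContinuousLinearMap.id ℂ L2R‖ ≤ 1 := ContinuousLinearMap.norm_id_le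
  -- The perturbation theorem with no perturbation: for D = 0 and δ = 0 its estimates become
  -- equalities and identify both the eigenvalue and the projection.
  obtain ⟨l, h1, -, h3, h4⟩ := hM.perturbation (ι := ContinuousLinearMap.id ℂ L2R)
    (ρ := ContinuousLinearMap.id ℂ L2R) (D := 0) (δ := 0) (fun _ => rfl) hid hid
    (mul_ne_zero two_ne_zero h.ne_zero) h.isResolventAt_oscillator
    (fun x => by rw [add_zero]; exact hR x) (by rw [norm_zero]) (by rw [mul_zero]; exact zero_le_one)
  rw [mul_zero, mul_zero, zero_mul] at h1
  rw [mul_zero] at h4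
  have hl : l = β := by
    have := sub_eq_zero.1 (norm_eq_zero.1 (le_antisymm h1 (norm_nonneg _)))
    rw [this]; ring
  subst hl
  refine ⟨h3, ?_⟩
  exact sub_eq_zero.1 (norm_eq_zero.1 (le_antisymm h4 (norm_nonneg _)))

/-- The spectrum of `P_ν` near `a ν`, in terms of the difference of the resolvents. -/
theorem spectral_comparison {p q : ℝ → ℝ} {c B κ a L₁ L₂ : ℝ} (hp : Profile p c B) (hκ : 0 < κ)
    (ha : 0 < a) (hq : ∀ x ∈ interval L₁ L₂, q x = x * p x) {ν : ℂ} (hν0 : 0 < ‖ν‖)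
    (hν : κ * ‖ν‖ ≤ ν.re) {δ : ℝ}
    (hD : 2 * a * (‖ν‖ * ‖hp.res L₁ L₂ a ν - oscRes (a * ν) 1‖) ≤ δ)
    (hδ : 100 * (25 / κ ^ 3) ^ 4 * δ ≤ 1) :
    ∃ l : ℂ, ‖l - a * ν‖ ≤ 10 * (25 / κ ^ 3) ^ 2 * a * δ * ‖ν‖ ∧
      (∀ z, (IsEigenvalue (P L₁ L₂ q ν) z ∧ ‖z - a * ν‖ ≤ a * ‖ν‖) ↔ z = l) ∧
      IsAlgebraicallySimple (P L₁ L₂ q ν) l ∧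
      ‖spectralProjection (P L₁ L₂ q ν) l - (restrict L₁ L₂).comp
        ((spectralProjection (oscillator (a * ν)) (a * ν)).comp (extendZero L₁ L₂))‖ ≤
          200 * (25 / κ ^ 3) ^ 7 * δ := by
  have hs := SectorData.of_sector hν0 hκ hν ha
  obtain ⟨φ, ψ, hM, hR⟩ := hs.exists_simpleModel
  have h := hp.formData hν0 hκ hν ha
  have hb : ‖2 * ((a : ℂ) * ν)‖ = 2 * a * ‖ν‖ := by
    rw [norm_mul, norm_mul, Complex.norm_real, Real.norm_eq_abs, abs_of_pos ha, mul_assoc]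
    norm_num
  -- With z₀ = -aν and b = 2aν, the disc of radius |b|/2 about z₀ + b is exactly the disc of radius
  -- a|ν| about aν.
  have hz : -((a : ℂ) * ν) + 2 * (a * ν) = a * ν := by ring
  obtain ⟨l, h1, h2, h3, h4⟩ := hM.perturbation (ι := extendZero L₁ L₂) (ρ := restrict L₁ L₂)
    (D := (2 * ((a : ℂ) * ν)) • (hp.res L₁ L₂ a ν - oscRes (a * ν) 1)) (δ := δ)
    restrict_extendZero norm_extendZero_le norm_restrict_le
    (mul_ne_zero two_ne_zero hs.ne_zero) (h.isResolventAt_P hq)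
    (fun x => by
      rw [h.extendZero_res_restrict]
      have := hR x
      simp only [add_apply, smul_apply, sub_apply] at this ⊢
      rw [add_right_comm, ← this]
      module)
    (by rw [norm_smul, hb, mul_assoc]; exact hD) hδ
  rw [hz, hb] at h1
  rw [hz, hb] at h2
  have hC := hM.one_le
  set C := 25 / κ ^ 3
  have hδ0 : 0 ≤ δ := le_trans (by positivity) hD
  have h1' : ‖l - a * ν‖ ≤ 10 * C ^ 2 * a * δ * ‖ν‖ := h1.trans (le_of_eq (by ring))
  refine ⟨l, h1', fun z => ⟨fun hE => ?_, fun e => ?_⟩, h3, ?_⟩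
  · exact (h2 z (hE.2.trans (le_of_eq (by ring)))).1 hE.1
  · have hl : ‖l - a * ν‖ ≤ a * ‖ν‖ := by
      refine h1'.trans ?_
      have k1 : C ^ 2 ≤ C ^ 4 := pow_le_pow_right₀ hC (by norm_num)
      have k2 : C ^ 2 * δ ≤ C ^ 4 * δ := by gcongr
      have k3 : 10 * (C ^ 2 * δ) ≤ 1 := by nlinarith
      calc 10 * C ^ 2 * a * δ * ‖ν‖ = 10 * (C ^ 2 * δ) * (a * ‖ν‖) := by ring
        _ ≤ 1 * (a * ‖ν‖) := by gcongr
        _ = _ := one_mul _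
    rw [e]
    exact ⟨(h2 l (hl.trans (le_of_eq (by ring)))).2 rfl, hl⟩
  · rw [(hs.spectralProjection_oscillator hM hR).2]
    exact h4

/-- Two successive choices: η makes the cut-off defect half of ε, then |ν| ≥ (K/η)² makes K/√|ν| at
most η. -/
theorem exists_norm_res_sub_le {p : ℝ → ℝ} {c B κ L₁ L₂ ε : ℝ} (hp : Profile p c B) (hκ : 0 < κ)
    (ha : 0 < p 0) (hL₁ : 0 < L₁) (hL₂ : 0 < L₂) (hε : 0 < ε) :
    ∃ R : ℝ, 0 ≤ R ∧ ∀ ν : ℂ, 0 < ‖ν‖ → κ * ‖ν‖ ≤ ν.re → R ≤ ‖ν‖ →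
      2 * p 0 * (‖ν‖ * ‖hp.res L₁ L₂ (p 0) ν - oscRes (p 0 * ν) 1‖) ≤ ε := by
  obtain ⟨A, hA, hAν⟩ := norm_res_sub_oscRes_le hp hκ ha
  set η := ε / (4 * p 0 * A) with hη
  have hη0 : 0 < η := by positivity
  obtain ⟨K, X, X', G, Q, hX⟩ := exists_cutoffData hp hL₁ hL₂ hη0
  refine ⟨(K / η) ^ 2, by positivity, fun ν hν0 hν hR => ?_⟩
  have hK : K / √‖ν‖ ≤ η := by
    rw [div_le_iff₀ (Real.sqrt_pos.2 hν0), ← div_le_iff₀' hη0]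
    exact Real.le_sqrt_of_sq_le hR
  calc _ ≤ 2 * p 0 * (A * (η + K / √‖ν‖)) :=
        mul_le_mul_of_nonneg_left (hAν L₁ L₂ η K X X' G Q hX ν hν0 hν) (by positivity)
    _ ≤ 2 * p 0 * (A * (η + η)) := by gcongr
    _ = ε := by rw [hη]; field_simp; ring

theorem eventually_sector {θ₀ R : ℝ} {r : ℂ → Prop} (h : ∀ ν ∈ sector θ₀, R ≤ ‖ν‖ → r ν) :
    ∀ᶠ ν in Bornology.cobounded ℂ ⊓ 𝓟 (sector θ₀), r ν := by
  rw [eventually_inf_principal]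
  filter_upwards [tendsto_norm_cobounded_atTop.eventually_ge_atTop R] with ν h1 h2
  exact h ν h2 h1

end Grushin

end

/-! ### The main theorem -/

theorem proposition4p2 (L₁ L₂ : ℝ) (hL₁ : 0 < L₁) (hL₂ : 0 < L₂) (q : ℝ → ℝ)
    (hq : ContDiffOn ℝ 2 q (Set.Icc (-L₁) L₂)) (hq0 : q 0 = 0) (hq0' : 0 < deriv q 0)
    (hqne : ∀ x ∈ Set.Icc (-L₁) L₂, x ≠ 0 → q x ≠ 0)
    (θ₀ : ℝ) (hθ₀ : 0 ≤ θ₀) (hθ₀' : θ₀ < Real.pi / 2) :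
    ∃ (ν₀ : ℝ) (lam : ℂ → ℂ), 0 ≤ ν₀ ∧
      -- `lam ν` is the unique eigenvalue in the closed disc, and it is algebraically simple
      (∀ ν ∈ Grushin.sector θ₀, ν₀ ≤ ‖ν‖ →
        (∀ μ : ℂ, (Grushin.IsEigenvalue (Grushin.P L₁ L₂ q ν) μ ∧
            ‖μ - ((deriv q 0 : ℝ) : ℂ) * ν‖ ≤ deriv q 0 * ‖ν‖) ↔ μ = lam ν) ∧
        Grushin.IsAlgebraicallySimple (Grushin.P L₁ L₂ q ν) (lam ν)) ∧
      -- asymptotics of the eigenvalue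
      ((fun ν : ℂ => lam ν - ((deriv q 0 : ℝ) : ℂ) * ν)
        =o[Bornology.cobounded ℂ ⊓ 𝓟 (Grushin.sector θ₀)] fun ν : ℂ => ‖ν‖) ∧
      -- `q'(0) ν` is an isolated eigenvalue of the harmonic oscillator
      (∀ ν ∈ Grushin.sector θ₀, Grushin.IsIsolatedEigenvalue
        (Grushin.oscillator (((deriv q 0 : ℝ) : ℂ) * ν)) (((deriv q 0 : ℝ) : ℂ) * ν)) ∧
      -- convergence of the spectral projections, in operator norm
      Filter.Tendsto (fun ν : ℂ =>
          ‖Grushin.spectralProjection (Grushin.P L₁ L₂ q ν) (lam ν) -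
            (Grushin.restrict L₁ L₂).comp
              ((Grushin.spectralProjection (Grushin.oscillator (((deriv q 0 : ℝ) : ℂ) * ν))
                (((deriv q 0 : ℝ) : ℂ) * ν)).comp (Grushin.extendZero L₁ L₂))‖)
        (Bornology.cobounded ℂ ⊓ 𝓟 (Grushin.sector θ₀)) (𝓝 0) := by
  have hθ : 0 < Real.cos θ₀ := Real.cos_pos_of_mem_Ioo ⟨by linarith [Real.pi_pos], hθ₀'⟩
  obtain ⟨p, c, B, hp, hp0, hqp⟩ := Grushin.exists_profile hL₁ hL₂ hq hq0 hq0' hqne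
  rw [← hp0] at hq0' ⊢
  set κ := Real.cos θ₀
  set a := p 0
  set C := 25 / κ ^ 3 with hC
  have hC0 : 0 < C := by positivity
  have hpos : ∀ ν ∈ Grushin.sector θ₀, 0 < ‖ν‖ := fun ν hν => lt_of_lt_of_le one_pos hν.1
  have hre : ∀ ν ∈ Grushin.sector θ₀, κ * ‖ν‖ ≤ ν.re := fun ν hν =>
    Grushin.cos_mul_norm_le_re hθ₀' hν
  obtain ⟨ν₀, hν₀, hR⟩ := Grushin.exists_norm_res_sub_le hp hθ hq0' hL₁ hL₂
    (ε := 1 / (100 * C ^ 4)) (by positivity)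
  -- By `le_rfl`, δ is the scaled resolvent difference itself and not an upper bound for it. The
  -- eigenvalue is thus chosen once, and the same estimates later serve for every ε.
  have hex : ∀ ν ∈ Grushin.sector θ₀, ν₀ ≤ ‖ν‖ → _ := fun ν hν hle =>
    Grushin.spectral_comparison hp hθ hq0' hqp (hpos ν hν) (hre ν hν) le_rfl (by
      have := hR ν (hpos ν hν) (hre ν hν) hle
      calc 100 * C ^ 4 * _ ≤ 100 * C ^ 4 * (1 / (100 * C ^ 4)) := by gcongr
        _ = 1 := by field_simp)
  choose! lam h1 h2 h3 h4 using hex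
  refine ⟨ν₀, lam, hν₀, fun ν hν hle => ⟨h2 ν hν hle, h3 ν hν hle⟩, ?_, fun ν hν => ?_, ?_⟩
  · refine Asymptotics.isLittleO_iff.2 fun ε hε => ?_
    obtain ⟨R, -, hRε⟩ := Grushin.exists_norm_res_sub_le hp hθ hq0' hL₁ hL₂
      (ε := ε / (10 * C ^ 2 * a)) (by positivity)
    refine Grushin.eventually_sector (R := max ν₀ R) fun ν hν hle => ?_
    rw [norm_norm]
    refine (h1 ν hν ((le_max_left _ _).trans hle)).trans ?_
    gcongr
    calc _ ≤ 10 * C ^ 2 * a * (ε / (10 * C ^ 2 * a)) := by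
          gcongr
          exact hRε ν (hpos ν hν) (hre ν hν) ((le_max_right _ _).trans hle)
      _ = ε := by field_simp
  · have hs := Grushin.SectorData.of_sector (hpos ν hν) hθ (hre ν hν) hq0'
    obtain ⟨φ, ψ, hM, hMR⟩ := hs.exists_simpleModel
    exact (hs.spectralProjection_oscillator hM hMR).1.1
  · refine Metric.tendsto_nhds.2 fun ε hε => ?_
    obtain ⟨R, -, hRε⟩ := Grushin.exists_norm_res_sub_le hp hθ hq0' hL₁ hL₂
      (ε := ε / 2 / (200 * C ^ 7)) (by positivity)
    refine Grushin.eventually_sector (R := max ν₀ R) fun ν hν hle => ?_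
    rw [dist_zero_right, norm_norm]
    refine (h4 ν hν ((le_max_left _ _).trans hle)).trans_lt ?_
    calc _ ≤ 200 * C ^ 7 * (ε / 2 / (200 * C ^ 7)) := by
          gcongr
          exact hRε ν (hpos ν hν) (hre ν hν) ((le_max_right _ _).trans hle)
      _ = ε / 2 := by field_simp
      _ < ε := half_lt_self hε
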